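/- For integers $n\ge 0$, $k\ge 2$ and $p\in[0,1]$, let $\mathcal H(k,n,p)$ be the random $k$-uniform hypergraph on $[n]$ that contains each $k$-element subset of $[n]$ as a hyperedge independently with probability $p$. For a $k$-uniform hypergraph $H$, a clique is a set $S$ of vertices all of whose $k$-element subsets are hyperedges (so every set of at most $k-1$ vertices is a clique), and $\omega(H)$ is the largest size of a clique. Let $k'=k$ if $k$ is even and $k'=k-1$ if $k$ is odd. There is one algorithm that takes as input a $k$-uniform hypergraph $H$ on $n$ vertices ($k\ge 2$), a real parameter $p\in[0,1]$ and an integer $d\ge 1$, and outputs in time $\max(n,2)^{O(d+k)}$ a value $\omega_{\mathrm{alg}}(H)=\omega_{\mathrm{alg}}(H,p,d)\in[0,n]$ with the following properties. (Time is counted on a random access machine that works on natural numbers, at a cost polynomially related to bit operations; the machine is given $n,k,d$, asks whether a given $k$-tuple of vertices forms a hyperedge at cost $k+1$, and obtains $\lfloor 2^j p\rfloor$ at cost $j+1$.) (1) Completeness: $\omega(H)\le\omega_{\mathrm{alg}}(H)$ for all $H$. (2) High probability bound: for every constant $c\in\mathbb N$ there is a constant $C$, depending only on $c$, such that for all $n\ge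 0$, $k\ge2$, $d\ge1$ and $0\le p<1$, if $H\sim\mathcal H(k,n,p)$, then with probability at least $1-n^{-c}$ $$\omega_{\mathrm{alg}}(H)\le d+C\,k\left(\frac{d\log^2 n}{1-p}\right)^{2/k'}\sqrt{\max\left(n\,p^{\binom{d}{k'-1}},\,d\log n\right)}$$ (for $n=0$, read $\log 0=0$; the inequality then holds with certainty). (3) In particular, for constant $k$ and $d$ and for $p$ bounded away from $1$, the algorithm certifies $\omega(H)\le\tilde O(\sqrt n)$ in polynomial time: for all $k\ge2$, $d\ge1$, $q<1$ and $c\in\mathbb N$ there are $C$ and $a\in\mathbb N$ such that for all $n\ge2$ and all $p\in[0,1]$ with $p\le q$, if $H\sim\mathcal H(k,n,p)$, then $\omega_{\mathrm{alg}}(H)\le C\sqrt n\,(\log n)^a$ with probability at least $1-n^{-c}$. -/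

import Mathlib

open MeasureTheory ProbabilityTheory unitInterval

/-! ### Uniform hypergraphs, cliques, random hypergraphs -/

/-- A `k`-uniform hypergraph on the vertex set `Fin n`: a set of `k`-element subsets. -/
abbrev UniformHypergraph (n k : ℕ) : Type := Set {e : Finset (Fin n) // e.card = k}

/-- `S` is a clique of `H` if every `k`-element subset of `S` is a hyperedge. In particular every
`S` with fewer than `k` vertices is a clique. -/
def UniformHypergraph.IsClique {n k : ℕ} (H : UniformHypergraph n k) (S : Finset (Fin n)) : Prop :=
  ∀ e : {e : Finset (Fin n) // e.card = k}, e.1 ⊆ S → e ∈ H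

open Classical in
/-- The clique number `ω(H)`: the largest size of a clique. -/
noncomputable def UniformHypergraph.cliqueNumber {n k : ℕ} (H : UniformHypergraph n k) : ℕ :=
  (Finset.univ.filter fun S : Finset (Fin n) => H.IsClique S).sup Finset.card

/-- The random hypergraph `H(k, n, p)`: every `k`-element subset of the vertex set is a hyperedge
with probability `p`, independently. -/
noncomputable def randomHypergraph (k n : ℕ) (p : I) : Measure (UniformHypergraph n k) :=
  setBernoulli Set.univ p

/-- `k' = k` if `k` is even, and `k' = k - 1` if `k` is odd. -/
def evenPart (k : ℕ) : ℕ := if Even k then k else k - 1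

/-! ### The machine model

Programs for a random access machine with memory cells indexed by `ℕ` that hold natural numbers.
Time is counted so that it is polynomially related to the number of bit operations: a step of unit
cost increases the bit length of the largest stored number by at most one (plus a constant that
depends only on the program), and multiplication and division are charged the bit lengths of their
operands. -/

/-- Programs. Below `[x]` is the content of the memory cell `x`. -/
inductive Prog : Type
  /-- `[x] := c` for a constant `c` -/
  | const (x c : ℕ) : Prog
  /-- `[x] := [y] + [z]` -/
  | plus (x y z : ℕ) : Prog
  /-- `[x] := max([y] - [z], 0)` -/
  | minus (x y z : ℕ) : Prog
  /-- `[x] := [y] * [z]` -/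
  | times (x y z : ℕ) : Prog
  /-- `[x] := ⌊[y] / [z]⌋`, and `0` if `[z] = 0` -/
  | quot (x y z : ℕ) : Prog
  /-- `[x] := [[y]]` -/
  | load (x y : ℕ) : Prog
  /-- `[[x]] := [y]` -/
  | store (x y : ℕ) : Prog
  /-- query to the input hypergraph: `[x] := 1` if the `k` consecutive cells that start at the
  address `[y]` list the vertices of a hyperedge, and `[x] := 0` otherwise -/
  | edge (x y : ℕ) : Prog
  /-- query to the input parameter `p` with precision `j = [y]`: `[x] := ⌊2 ^ j * p⌋` -/
  | approx (x y : ℕ) : Prog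
  /-- do nothing -/
  | skip : Prog
  /-- first `P`, then `Q` -/
  | seq (P Q : Prog) : Prog
  /-- if `[x] ≠ 0` then `P` else `Q` -/
  | cond (x : ℕ) (P Q : Prog) : Prog
  /-- while `[x] ≠ 0` do `P` -/
  | loop (x : ℕ) (P : Prog) : Prog

/-- An input: a `k`-uniform hypergraph on `n` vertices, the real parameter `p ∈ [0, 1]`, and the
integer parameter `d`. -/
structure CliqueInput where
  n : ℕ
  k : ℕ
  H : UniformHypergraph n k
  p : I
  d : ℕ

/-- Contents of the memory. -/
abbrev Memory : Type := ℕ → ℕ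

open Classical in
/-- The answer to an edge query: do `v 0, …, v (k - 1)` list the vertices of a hyperedge? -/
noncomputable def UniformHypergraph.edgeBit {n k : ℕ} (H : UniformHypergraph n k) (v : ℕ → ℕ) : ℕ :=
  if ∃ e ∈ H, e.1.image (fun i : Fin n => (i : ℕ)) = (Finset.range k).image v then 1 else 0

/-- `Exec i P m t m'`: on the input `i`, the program `P`, started with the memory `m`, halts after
time `t` with the memory `m'`. -/
inductive Exec (i : CliqueInput) : Prog → Memory → ℕ → Memory → Prop
  | const (x c : ℕ) (m : Memory) :
      Exec i (.const x c) m 1 (Function.update m x c)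
  | plus (x y z : ℕ) (m : Memory) :
      Exec i (.plus x y z) m 1 (Function.update m x (m y + m z))
  | minus (x y z : ℕ) (m : Memory) :
      Exec i (.minus x y z) m 1 (Function.update m x (m y - m z))
  | times (x y z : ℕ) (m : Memory) :
      Exec i (.times x y z) m (1 + Nat.size (m y) + Nat.size (m z))
        (Function.update m x (m y * m z))
  | quot (x y z : ℕ) (m : Memory) :
      Exec i (.quot x y z) m (1 + Nat.size (m y) + Nat.size (m z))
        (Function.update m x (m y / m z))
  | load (x y : ℕ) (m : Memory) :
      Exec i (.load x y) m 1 (Function.update m x (m (m y)))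
  | store (x y : ℕ) (m : Memory) :
      Exec i (.store x y) m 1 (Function.update m (m x) (m y))
  | edge (x y : ℕ) (m : Memory) :
      Exec i (.edge x y) m (1 + i.k)
        (Function.update m x (i.H.edgeBit fun j => m (m y + j)))
  | approx (x y : ℕ) (m : Memory) :
      Exec i (.approx x y) m (1 + m y)
        (Function.update m x ⌊(2 : ℝ) ^ m y * (i.p : ℝ)⌋₊)
  | skip (m : Memory) : Exec i .skip m 1 m
  | seq {P Q : Prog} {m m₁ m₂ : Memory} {t₁ t₂ : ℕ} (h₁ : Exec i P m t₁ m₁)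
      (h₂ : Exec i Q m₁ t₂ m₂) : Exec i (.seq P Q) m (t₁ + t₂) m₂
  | condTrue {x : ℕ} {P Q : Prog} {m m₁ : Memory} {t : ℕ} (hx : m x ≠ 0)
      (h : Exec i P m t m₁) : Exec i (.cond x P Q) m (1 + t) m₁
  | condFalse {x : ℕ} {P Q : Prog} {m m₁ : Memory} {t : ℕ} (hx : m x = 0)
      (h : Exec i Q m t m₁) : Exec i (.cond x P Q) m (1 + t) m₁
  | loopStep {x : ℕ} {P : Prog} {m m₁ m₂ : Memory} {t₁ t₂ : ℕ} (hx : m x ≠ 0)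
      (h₁ : Exec i P m t₁ m₁) (h₂ : Exec i (.loop x P) m₁ t₂ m₂) :
      Exec i (.loop x P) m (1 + t₁ + t₂) m₂
  | loopDone {x : ℕ} {P : Prog} {m : Memory} (hx : m x = 0) : Exec i (.loop x P) m 1 m

/-- Initially the cells `0`, `1`, `2` hold `n`, `k`, `d`, and all other cells hold `0`. The
hypergraph and `p` are accessed through queries. -/
def CliqueInput.initMemory (i : CliqueInput) : Memory := fun a =>
  if a = 0 then i.n else if a = 1 then i.k else if a = 2 then i.d else 0

/-- On the input `i`, the program `P` halts after time `t`, with the output `v` in the cell `0`. -/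
def Prog.Outputs (P : Prog) (i : CliqueInput) (v t : ℕ) : Prop :=
  ∃ m : Memory, Exec i P i.initMemory t m ∧ m 0 = v

/-!
Write `h = k / 2` and `N = n ^ h`. For a vertex `v` and a `d`-tuple `D` of other vertices, call a
vertex `w` outside of `D` and `v` a *common neighbour* if every `(2h - 1)`-subset of `D`, together
with `w` (and with `v` if `k` is odd), is a hyperedge. Consider the `N × N` matrix, indexed by pairs
of `h`-tuples of common neighbours, with entries `1 - p` at edges, `-p` at non-edges, and `0` where
the concatenation of the two tuples is not strictly increasing (a hyperedge then occurs in at most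
one entry).

*Completeness* (`CliqueInput.cliqueNumber_le_output`). If a clique contains `v`, the `d` vertices of
`D`, and beyond these `2h` consecutive blocks of `q` vertices, then all these vertices are common
neighbours, and the rectangle of the tuples that take one vertex from each block contributes
`(1 - p) q ^ (2h)` to the quadratic form of the matrix, on vectors of norm `q ^ (h / 2)`. Hence
`(1 - p) q ^ h` is at most the operator norm, and the maximal `q` for which the matrices do not
refute this bounds the clique number by `d + 1 + 2h (1 + q)`. The algorithm uses as a substitute for
the operator norm the Frobenius norm of a high power of the Gram matrix
(`dotProduct_mulVec_pow_le_frobMoment`), which is off by at most a constant factor because the power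
exceeds `log N`.

*Running time* (`exists_prog_output`). Everything is done in exact integer arithmetic: `p` is
replaced by `⌊2 ^ N * p⌋`, the entries are multiplied by `2 ^ N`, negative numbers are represented
modulo a large power `R` of `2`, and a matrix is held in a single memory cell as the number with the
base-`R` digits given by its entries. The class of functions which some program computes in time
polynomial in `max (n, 2) ^ (d + k)` (`Comp`) is closed under arithmetic, case distinctions and
bounded summation (`Comp.fold`), and the output is built from these.

*Soundness* (`output_le_whp`). With high probability, two events hold for all `v` and `D`. By
Hoeffding's inequality and a union bound over rectangles, all rectangle sums of the centred adjacency
matrix of the whole hypergraph are small (`real_exists_rectSum_ge_le`); the matrices above are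
submatrices of it, so `D` does not enter into the union bound. And the number of common neighbours is
at most a constant times `max (n p ^ (d choose (2h - 1))) (d log n)`
(`real_exists_card_nbhd_gt_le`). Small rectangle sums bound the operator norm up to a factor
logarithmic in `N` (`frobMoment_le_of_rectangles`): after scaling and rounding, a vector is a
combination of indicators given by its binary digits. The two events together bound `q`
(`CliqueInput.Passes.le`, `le_of_mul_pow_le`).
-/

/-! ### A calculus of polynomial-time functions -/

/-- A type `α` of program states: every state determines the input, and `vars` are the functions of
the state whose values are held in memory cells while a program works on it. -/
class ProgState (α : Type) where
  inp : α → CliqueInput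
  two_le : ∀ a, 2 ≤ (inp a).k
  vars : Set (α → ℕ)

open ProgState

/-- The quantity `max (n, 2) ^ (d + k)`, in terms of which running times are measured. -/
def scale {α : Type} [ProgState α] (a : α) : ℕ :=
  max (inp a).n 2 ^ ((inp a).d + (inp a).k)

/-- `T` is bounded by a fixed power of `scale`. -/
def PolyB {α : Type} [ProgState α] (T : α → ℕ) : Prop := ∃ b, ∀ a, T a ≤ scale a ^ b

section PolyB

variable {α : Type} [ProgState α] {f g : α → ℕ}

theorem two_le_scale (a : α) : 2 ≤ scale a :=
  calc 2 = 2 ^ 1 := rfl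
    _ ≤ max (inp a).n 2 ^ 1 := Nat.pow_le_pow_left (le_max_right _ _) _
    _ ≤ _ := Nat.pow_le_pow_right (by positivity) (by have := two_le a; omega)

theorem PolyB.mono (hg : PolyB g) (h : ∀ a, f a ≤ g a) : PolyB f :=
  let ⟨b, hb⟩ := hg; ⟨b, fun a => (h a).trans (hb a)⟩

theorem PolyB.const (c : ℕ) : PolyB fun _ : α => c :=
  ⟨c, fun a => Nat.lt_two_pow_self.le.trans (Nat.pow_le_pow_left (two_le_scale a) c)⟩

theorem PolyB.mul (hf : PolyB f) (hg : PolyB g) : PolyB fun a => f a * g a := by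
  obtain ⟨b, hb⟩ := hf
  obtain ⟨c, hc⟩ := hg
  exact ⟨b + c, fun a => by rw [pow_add]; exact Nat.mul_le_mul (hb a) (hc a)⟩

theorem PolyB.add (hf : PolyB f) (hg : PolyB g) : PolyB fun a => f a + g a := by
  obtain ⟨b, hb⟩ := hf
  obtain ⟨c, hc⟩ := hg
  refine ⟨b + c + 1, fun a => ?_⟩
  have h2 := two_le_scale a
  have hp : 1 ≤ scale a := by omega
  have h3 : scale a ^ b ≤ scale a ^ (b + c) := Nat.pow_le_pow_right hp (by omega)
  have h4 : scale a ^ c ≤ scale a ^ (b + c) := Nat.pow_le_pow_right hp (by omega)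
  have := hb a
  have := hc a
  rw [pow_succ]
  nlinarith [Nat.mul_le_mul_left (scale a ^ (b + c)) h2]

theorem PolyB.n_pow_d : PolyB fun a : α => (inp a).n ^ (inp a).d :=
  ⟨1, fun a => by
    rw [pow_one]
    exact (Nat.pow_le_pow_left (le_max_left _ _) _).trans
      (Nat.pow_le_pow_right (by positivity) (by omega))⟩

theorem PolyB.n_pow (j : α → ℕ) (hj : ∀ a, j a ≤ (inp a).k) : PolyB fun a : α => (inp a).n ^ j a :=
  ⟨1, fun a => by
    rw [pow_one]
    exact (Nat.pow_le_pow_left (le_max_left _ _) _).trans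
      (Nat.pow_le_pow_right (by positivity) ((hj a).trans (by omega)))⟩

theorem PolyB.d_add_k : PolyB fun a : α => (inp a).d + (inp a).k :=
  ⟨1, fun a => by
    rw [pow_one]
    exact Nat.lt_two_pow_self.le.trans (Nat.pow_le_pow_left (le_max_right _ _) _)⟩

theorem PolyB.k : PolyB fun a : α => (inp a).k := PolyB.d_add_k.mono fun _ => by omega

theorem PolyB.d : PolyB fun a : α => (inp a).d := PolyB.d_add_k.mono fun _ => by omega

theorem PolyB.n : PolyB fun a : α => (inp a).n :=
  (PolyB.n_pow (fun _ => 1) fun a => by have := two_le a; omega).mono fun _ => by simp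

theorem PolyB.size (hf : PolyB f) : PolyB fun a => (f a).size :=
  hf.mono fun _ => Nat.size_le.2 Nat.lt_two_pow_self

end PolyB

/-- Where the variables of the states in `α` are stored: `(c, g) ∈ rel` says that the cell `c < s`
holds the value of `g`. -/
structure Layout (α : Type) [ProgState α] (s : ℕ) where
  rel : Set (ℕ × (α → ℕ))
  lt : ∀ c g, (c, g) ∈ rel → c < s
  covers : ∀ g ∈ vars (α := α), ∃ c, (c, g) ∈ rel

/-- The memory `m` holds `n`, `k`, `d` and the values of the variables, as the layout says. -/
def Layout.Holds {α : Type} [ProgState α] {s : ℕ} (Λ : Layout α s) (a : α) (m : Memory) : Prop :=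
  m 0 = (inp a).n ∧ m 1 = (inp a).k ∧ m 2 = (inp a).d ∧ ∀ c g, (c, g) ∈ Λ.rel → m c = g a

/-- The program `P` writes `f` to the cell `s` in time at most `T`, and does not change the cells
below `s`. -/
def Layout.Computes {α : Type} [ProgState α] {s : ℕ} (Λ : Layout α s) (P : Prog) (f T : α → ℕ) :
    Prop :=
  ∀ a m, Λ.Holds a m → ∃ t m', Exec (inp a) P m t m' ∧ t ≤ T a ∧ m' s = f a ∧ ∀ x < s, m' x = m x

/-- `f` has values of polynomial bit length and can be computed in polynomial time from the
variables of the state, wherever in memory these are stored. -/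
def Comp {α : Type} [ProgState α] (f : α → ℕ) : Prop :=
  PolyB (fun a => (f a).size) ∧
    ∀ (s : ℕ) (Λ : Layout α s), 3 ≤ s → ∃ (P : Prog) (T : α → ℕ), PolyB T ∧ Λ.Computes P f T

/-- The layout `Λ`, seen as a layout in a larger part of the memory. -/
def Layout.mono {α : Type} [ProgState α] {s s' : ℕ} (Λ : Layout α s) (h : s ≤ s') : Layout α s' :=
  ⟨Λ.rel, fun c g hc => (Λ.lt c g hc).trans_le h, Λ.covers⟩

theorem Layout.Holds.of_eq {α : Type} [ProgState α] {s : ℕ} {Λ : Layout α s} {a : α}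
    {m m' : Memory} (h : Λ.Holds a m) (hs : 3 ≤ s) (hm : ∀ x < s, m' x = m x) : Λ.Holds a m' := by
  refine ⟨?_, ?_, ?_, fun c g hc => ?_⟩
  · rw [hm 0 (by omega), h.1]
  · rw [hm 1 (by omega), h.2.1]
  · rw [hm 2 (by omega), h.2.2.1]
  · rw [hm c (Λ.lt c g hc), h.2.2.2 c g hc]

/-- Copy the cell `y` to the cell `x`, for `x ≠ y`. -/
def Prog.move (x y : ℕ) : Prog := .seq (.const x 0) (.plus x x y)

theorem Exec.move {i : CliqueInput} {x y : ℕ} (h : x ≠ y) (m : Memory) :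
    Exec i (.move x y) m 2 (Function.update m x (m y)) := by
  have := Exec.seq (.const x 0 m) (.plus (i := i) x x y (Function.update m x 0))
  simpa [Function.update_of_ne h.symm, Prog.move] using this

section Comp

variable {α : Type} [ProgState α] {f g e : α → ℕ}

theorem Comp.const (c : ℕ) : Comp fun _ : α => c :=
  ⟨PolyB.const _, fun s _ _ => ⟨.const s c, fun _ => 1, PolyB.const 1, fun _ m _ =>
    ⟨1, _, .const s c m, le_rfl, by simp, fun x hx => by simp [hx.ne]⟩⟩⟩

/-- Values that every layout keeps in some memory cell can be computed by copying. -/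
theorem Comp.of_cell (hf : PolyB fun a => (f a).size)
    (h : ∀ (s : ℕ) (Λ : Layout α s), 3 ≤ s → ∃ c < s, ∀ a m, Λ.Holds a m → m c = f a) : Comp f :=
  ⟨hf, fun s Λ hs => by
    obtain ⟨c, hc, hcf⟩ := h s Λ hs
    exact ⟨.move s c, fun _ => 2, PolyB.const 2, fun a m hm =>
      ⟨2, _, .move hc.ne' m, le_rfl, by simp [hcf a m hm], fun x hx => by simp [hx.ne]⟩⟩⟩

theorem Comp.var (hf : f ∈ vars (α := α)) (hs : PolyB fun a => (f a).size) : Comp f :=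
  .of_cell hs fun s Λ _ => by
    obtain ⟨c, hc⟩ := Λ.covers f hf
    exact ⟨c, Λ.lt _ _ hc, fun a m hm => hm.2.2.2 c f hc⟩

theorem Comp.n : Comp fun a : α => (inp a).n :=
  .of_cell PolyB.n.size fun s _ hs => ⟨0, by omega, fun _ _ h => h.1⟩

theorem Comp.k : Comp fun a : α => (inp a).k :=
  .of_cell PolyB.k.size fun s _ hs => ⟨1, by omega, fun _ _ h => h.2.1⟩

theorem Comp.d : Comp fun a : α => (inp a).d :=
  .of_cell PolyB.d.size fun s _ hs => ⟨2, by omega, fun _ _ h => h.2.2.1⟩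

/-- A binary operation of the machine can be applied to computable functions. -/
theorem Comp.binop (ins : ℕ → ℕ → ℕ → Prog) (op : ℕ → ℕ → ℕ)
    (hins : ∀ i x y z m, ∃ t, Exec i (ins x y z) m t (Function.update m x (op (m y) (m z))) ∧
      t ≤ 1 + (m y).size + (m z).size)
    (hop : PolyB fun a => (op (f a) (g a)).size) (hf : Comp f) (hg : Comp g) :
    Comp fun a => op (f a) (g a) := by
  refine ⟨hop, fun s Λ hs => ?_⟩
  obtain ⟨P, T, hT, hP⟩ := hf.2 s Λ hs
  obtain ⟨Q, U, hU, hQ⟩ := hg.2 (s + 1) (Λ.mono s.le_succ) (by omega)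
  refine ⟨.seq P (.seq Q (ins s s (s + 1))), fun a => T a + (U a + (1 + (f a).size + (g a).size)),
    hT.add (hU.add (((PolyB.const 1).add hf.1).add hg.1)), fun a m hm => ?_⟩
  obtain ⟨t₁, m₁, h₁, ht₁, hv₁, hm₁⟩ := hP a m hm
  obtain ⟨t₂, m₂, h₂, ht₂, hv₂, hm₂⟩ := hQ a m₁ (Layout.Holds.of_eq hm hs hm₁ : Λ.Holds a m₁)
  obtain ⟨t₃, h₃, ht₃⟩ := hins (inp a) s s (s + 1) m₂
  have hs₂ : m₂ s = f a := (hm₂ s (by omega)).trans hv₁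
  rw [hs₂, hv₂] at ht₃ h₃
  refine ⟨_, _, .seq h₁ (.seq h₂ h₃), by dsimp only; omega, by simp, fun x hx => ?_⟩
  rw [Function.update_of_ne hx.ne, hm₂ x (by omega), hm₁ x hx]

theorem Nat.size_add_le (a b : ℕ) : (a + b).size ≤ a.size + b.size + 1 := by
  rw [Nat.size_le]
  have ha := Nat.lt_size_self a
  have hb := Nat.lt_size_self b
  have h1 : 2 ^ a.size ≤ 2 ^ (a.size + b.size) := Nat.pow_le_pow_right (by omega) (by omega)
  have h2 : 2 ^ b.size ≤ 2 ^ (a.size + b.size) := Nat.pow_le_pow_right (by omega) (by omega)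
  rw [pow_succ]; omega

theorem Nat.size_mul_le (a b : ℕ) : (a * b).size ≤ a.size + b.size := by
  rw [Nat.size_le, pow_add]
  exact Nat.mul_lt_mul'' (Nat.lt_size_self a) (Nat.lt_size_self b)

theorem Comp.add (hf : Comp f) (hg : Comp g) : Comp fun a => f a + g a :=
  .binop .plus (· + ·) (fun _ x y z m => ⟨1, .plus x y z m, by omega⟩)
    (((hf.1.add hg.1).add (PolyB.const 1)).mono fun _ => Nat.size_add_le _ _) hf hg

theorem Comp.sub (hf : Comp f) (hg : Comp g) : Comp fun a => f a - g a :=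
  .binop .minus (· - ·) (fun _ x y z m => ⟨1, .minus x y z m, by omega⟩)
    (hf.1.mono fun _ => Nat.size_le_size (Nat.sub_le _ _)) hf hg

theorem Comp.mul (hf : Comp f) (hg : Comp g) : Comp fun a => f a * g a :=
  .binop .times (· * ·) (fun _ x y z m => ⟨_, .times x y z m, le_rfl⟩)
    ((hf.1.add hg.1).mono fun _ => Nat.size_mul_le _ _) hf hg

theorem Comp.div (hf : Comp f) (hg : Comp g) : Comp fun a => f a / g a :=
  .binop .quot (· / ·) (fun _ x y z m => ⟨_, .quot x y z m, le_rfl⟩)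
    (hf.1.mono fun _ => Nat.size_le_size (Nat.div_le_self _ _)) hf hg

theorem Comp.mod (hf : Comp f) (hg : Comp g) : Comp fun a => f a % g a := by
  have h : (fun a => f a % g a) = fun a => f a - g a * (f a / g a) := by
    funext a
    have := Nat.div_add_mod (f a) (g a)
    omega
  rw [h]
  exact hf.sub (hg.mul (hf.div hg))

theorem Comp.cond (he : Comp e) (hf : Comp f) (hg : Comp g) :
    Comp fun a => if e a ≠ 0 then f a else g a := by
  refine ⟨(hf.1.add hg.1).mono fun a => by dsimp only; split_ifs <;> omega, fun s Λ hs => ?_⟩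
  obtain ⟨P, T, hT, hP⟩ := he.2 s Λ hs
  obtain ⟨Q, U, hU, hQ⟩ := hf.2 s Λ hs
  obtain ⟨Q', U', hU', hQ'⟩ := hg.2 s Λ hs
  refine ⟨.seq P (.cond s Q Q'), fun a => T a + (1 + (U a + U' a)),
    hT.add ((PolyB.const 1).add (hU.add hU')), fun a m hm => ?_⟩
  obtain ⟨t₁, m₁, h₁, ht₁, hv₁, hm₁⟩ := hP a m hm
  have hm₁' := Layout.Holds.of_eq hm hs hm₁
  by_cases hc : e a = 0
  · obtain ⟨t₂, m₂, h₂, ht₂, hv₂, hm₂⟩ := hQ' a m₁ hm₁'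
    exact ⟨_, _, .seq h₁ (.condFalse (hv₁.trans hc) h₂), by dsimp only; omega, by simpa [hc] using hv₂,
      fun x hx => by rw [hm₂ x hx, hm₁ x hx]⟩
  · obtain ⟨t₂, m₂, h₂, ht₂, hv₂, hm₂⟩ := hQ a m₁ hm₁'
    exact ⟨_, _, .seq h₁ (.condTrue (by rwa [hv₁]) h₂), by dsimp only; omega, by simpa [hc] using hv₂,
      fun x hx => by rw [hm₂ x hx, hm₁ x hx]⟩

theorem Comp.approx (hf : Comp f) (hb : PolyB f) :
    Comp fun a => ⌊(2 : ℝ) ^ f a * ((inp a).p : ℝ)⌋₊ := by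
  refine ⟨(hb.add (PolyB.const 1)).mono fun a => ?_, fun s Λ hs => ?_⟩
  · rw [Nat.size_le, Nat.floor_lt (by have := (inp a).p.2.1; positivity)]
    have h1 := (inp a).p.2.2
    push_cast
    rw [pow_succ]
    have : (0 : ℝ) < 2 ^ f a := by positivity
    nlinarith
  · obtain ⟨P, T, hT, hP⟩ := hf.2 s Λ hs
    refine ⟨.seq P (.approx s s), fun a => T a + (1 + f a), hT.add ((PolyB.const 1).add hb),
      fun a m hm => ?_⟩
    obtain ⟨t₁, m₁, h₁, ht₁, hv₁, hm₁⟩ := hP a m hm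
    refine ⟨_, _, .seq h₁ (.approx s s m₁), by dsimp only; omega, by simp [hv₁], fun x hx => ?_⟩
    rw [Function.update_of_ne hx.ne, hm₁ x hx]

/-- Computability is preserved by maps of states under which variables remain variables. -/
theorem Comp.comp {β : Type} [ProgState β] (hf : Comp f) (φ : β → α)
    (hi : ∀ b, inp (φ b) = inp b) (hv : ∀ g ∈ vars (α := α), g ∘ φ ∈ vars (α := β)) :
    Comp fun b => f (φ b) := by
  have hB : ∀ {T : α → ℕ}, PolyB T → PolyB fun b => T (φ b) := fun {T} ⟨b, hb⟩ =>
    ⟨b, fun x => (hb (φ x)).trans (by simp [scale, hi])⟩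
  refine ⟨hB hf.1, fun s Λ hs => ?_⟩
  obtain ⟨P, T, hT, hP⟩ := hf.2 s
    ⟨{q | (q.1, q.2 ∘ φ) ∈ Λ.rel}, fun c g h => Λ.lt c _ h, fun g hg => Λ.covers _ (hv g hg)⟩ hs
  refine ⟨P, _, hB hT, fun b m hm => ?_⟩
  have := hP (φ b) m ⟨by rw [hi, hm.1], by rw [hi, hm.2.1], by rw [hi, hm.2.2.1],
    fun c g h => hm.2.2.2 c _ h⟩
  rwa [hi] at this

end Comp

/-- States of a loop: a state `a`, and a counter that is less than `c a`. -/
def Below {α : Type} (c : α → ℕ) : Type := (a : α) × Fin (c a)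

/-- States of a loop with an accumulator: a state `a`, and a counter `x` that is less than `c a`.
The content of the accumulator at this moment is `A a x`. -/
def WithAcc {α : Type} (c : α → ℕ) (_A : α → ℕ → ℕ) : Type := (a : α) × Fin (c a)

instance {α : Type} [ProgState α] (c : α → ℕ) : ProgState (Below c) where
  inp p := inp p.1
  two_le p := two_le p.1
  vars := {f | (∃ g ∈ vars (α := α), f = fun p => g p.1) ∨ f = fun p => (p.2 : ℕ)}

instance {α : Type} [ProgState α] (c : α → ℕ) (A : α → ℕ → ℕ) : ProgState (WithAcc c A) where
  inp p := inp p.1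
  two_le p := two_le p.1
  vars := {f | (∃ g ∈ vars (α := α), f = fun p => g p.1) ∨ (f = fun p => (p.2 : ℕ)) ∨
    f = fun p => A p.1 p.2}

section Loop

variable {α : Type} [ProgState α] {c f : α → ℕ} {A : α → ℕ → ℕ}

theorem PolyB.below (hf : PolyB f) : PolyB fun p : Below c => f p.1 :=
  let ⟨b, hb⟩ := hf; ⟨b, fun p => hb p.1⟩

theorem PolyB.withAcc (hf : PolyB f) : PolyB fun p : WithAcc c A => f p.1 :=
  let ⟨b, hb⟩ := hf; ⟨b, fun p => hb p.1⟩

theorem PolyB.counter (hc : PolyB c) : PolyB fun p : Below c => (p.2 : ℕ) :=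
  hc.below.mono fun p => p.2.2.le

theorem PolyB.counter_withAcc (hc : PolyB c) : PolyB fun p : WithAcc c A => (p.2 : ℕ) :=
  hc.withAcc.mono fun p => p.2.2.le

theorem Comp.below (hf : Comp f) : Comp fun p : Below c => f p.1 :=
  hf.comp (fun p : Below c => p.1) (fun _ => rfl) fun g hg => .inl ⟨g, hg, rfl⟩

theorem Comp.withAcc (hf : Comp f) : Comp fun p : WithAcc c A => f p.1 :=
  hf.comp (fun p : WithAcc c A => p.1) (fun _ => rfl) fun g hg => .inl ⟨g, hg, rfl⟩

theorem Comp.counter (hc : PolyB c) : Comp fun p : Below c => (p.2 : ℕ) :=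
  .var (.inr rfl) (PolyB.counter hc).size

theorem Comp.below_withAcc {f : Below c → ℕ} (hf : Comp f) :
    Comp fun p : WithAcc c A => f p := by
  refine hf.comp (fun p : WithAcc c A => (p : Below c)) (fun _ => rfl) fun g hg => ?_
  rcases hg with ⟨g, hg, rfl⟩ | rfl
  · exact .inl ⟨g, hg, rfl⟩
  · exact .inr (.inl rfl)

/-- The state of the loop `for x < c`, with the accumulator in the cell `s` and the counter in the
cell `s + 1`. -/
def Layout.loop {s : ℕ} (Λ : Layout α s) (c : α → ℕ) (A : α → ℕ → ℕ) :
    Layout (WithAcc c A) (s + 3) where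
  rel := {q | (∃ g, (q.1, g) ∈ Λ.rel ∧ q.2 = fun p => g p.1) ∨ (q = (s + 1, fun p => (p.2 : ℕ))) ∨
    q = (s, fun p => A p.1 p.2)}
  lt := by
    rintro x g (⟨g, hg, -⟩ | h | h)
    · exact (Λ.lt _ _ hg).trans (by omega)
    all_goals simp only [Prod.mk.injEq] at h; omega
  covers := by
    rintro g (⟨g, hg, rfl⟩ | rfl | rfl)
    · obtain ⟨c, hc⟩ := Λ.covers g hg
      exact ⟨c, .inl ⟨g, hc, rfl⟩⟩
    · exact ⟨s + 1, .inr (.inl rfl)⟩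
    · exact ⟨s, .inr (.inr rfl)⟩

/-- The body of a loop: `P` computes the new content of the accumulator `s` in the cell `s + 3`;
`s + 1` counts up, `s + 2` counts down. -/
def Prog.loopBody (P : Prog) (s : ℕ) : Prog :=
  .seq P (.seq (.move s (s + 3)) (.seq (.const (s + 3) 1)
    (.seq (.plus (s + 1) (s + 1) (s + 3)) (.minus (s + 2) (s + 2) (s + 3)))))

/-- A run of the loop from the state after `x` rounds, with `r` rounds left. -/
theorem Layout.exec_loop {s : ℕ} {Λ : Layout α s} (hs : 3 ≤ s) {P : Prog}
    {T : WithAcc c A → ℕ} (hP : (Λ.loop c A).Computes P (fun p => A p.1 (p.2 + 1)) T) {b : ℕ}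
    (a : α) (hT : ∀ x (hx : x < c a), T ⟨a, x, hx⟩ ≤ b) (r : ℕ) :
    ∀ (x : ℕ) (m : Memory), x + r = c a → Λ.Holds a m → m s = A a x → m (s + 1) = x →
      m (s + 2) = r →
      ∃ t m', Exec (inp a) (.loop (s + 2) (.loopBody P s)) m t m' ∧ t ≤ 1 + r * (b + 6) ∧
        m' s = A a (c a) ∧ ∀ y < s, m' y = m y := by
  induction r with
  | zero =>
    intro x m hx hm hA hs1 hs2
    exact ⟨1, m, .loopDone hs2, by omega, by rw [hA, ← hx, add_zero], fun _ _ => rfl⟩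
  | succ r ih =>
    intro x m hx hm hA hs1 hs2
    have hxc : x < c a := by omega
    have hH : (Λ.loop c A).Holds ⟨a, x, hxc⟩ m := by
      refine ⟨hm.1, hm.2.1, hm.2.2.1, ?_⟩
      rintro y g (⟨g, hg, h⟩ | h | h)
      · simp only at h
        subst h
        exact hm.2.2.2 _ _ hg
      all_goals
        simp only [Prod.mk.injEq] at h
        obtain ⟨rfl, rfl⟩ := h
        assumption
    obtain ⟨t₁, m₁, h₁, ht₁, hv₁, hm₁⟩ := hP ⟨a, x, hxc⟩ m hH
    simp only at hv₁
    have hb := hT x hxc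
    set m₂ := Function.update m₁ s (m₁ (s + 3)) with hm₂
    set m₃ := Function.update m₂ (s + 3) 1 with hm₃
    set m₄ := Function.update m₃ (s + 1) (m₃ (s + 1) + m₃ (s + 3)) with hm₄
    set m₅ := Function.update m₄ (s + 2) (m₄ (s + 2) - m₄ (s + 3)) with hm₅
    have hlow : ∀ y < s, m₅ y = m y := fun y hy => by
      rw [← hm₁ y (by omega)]
      simp [hm₅, hm₄, hm₃, hm₂, hy.ne, show y ≠ s + 1 by omega,
        show y ≠ s + 2 by omega, show y ≠ s + 3 by omega]
    have e0 : m₅ s = A a (x + 1) := by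
      simp [hm₅, hm₄, hm₃, hm₂, hv₁]
    have e1 : m₅ (s + 1) = x + 1 := by
      simp [hm₅, hm₄, hm₃, hm₂, hm₁ (s + 1) (by omega), hs1]
    have e2 : m₅ (s + 2) = r := by
      simp [hm₅, hm₄, hm₃, hm₂, hm₁ (s + 2) (by omega), hs2]
    obtain ⟨t₆, m₆, h₆, ht₆, hv₆, hm₆⟩ := ih (x + 1) m₅ (by omega)
      (Layout.Holds.of_eq hm hs hlow) e0 e1 e2
    refine ⟨_, m₆, .loopStep (by omega) (.seq h₁ (.seq (.move (by omega) m₁)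
      (.seq (.const _ _ _) (.seq (.plus _ _ _ _) (.minus _ _ _ _))))) h₆, ?_, hv₆,
      fun y hy => by rw [hm₆ y hy, hlow y hy]⟩
    have : (r + 1) * (b + 6) = r * (b + 6) + (b + 6) := by ring
    change t₁ ≤ T ⟨a, x, hxc⟩ at ht₁
    omega

/-- Loops with an accumulator: `A a x` is its content after `x` rounds. -/
theorem Comp.fold (hc : Comp c) (hcb : PolyB c) (h0 : Comp fun a => A a 0)
    (h1 : Comp fun p : WithAcc c A => A p.1 (p.2 + 1)) : Comp fun a => A a (c a) := by
  have hsize : PolyB fun a => (A a (c a)).size := by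
    obtain ⟨b0, hb0⟩ := h0.1
    obtain ⟨b1, hb1⟩ := h1.1
    refine PolyB.mono (PolyB.add ⟨b0, fun a => le_rfl⟩ ⟨b1, fun a => le_rfl⟩) fun a => ?_
    rcases hca : c a with _ | x
    · exact (hb0 a).trans (by omega)
    · exact (hb1 ⟨a, x, by omega⟩).trans (Nat.le_add_left _ _)
  refine ⟨hsize, fun s Λ hs => ?_⟩
  obtain ⟨P0, T0, hT0, hP0⟩ := h0.2 s Λ hs
  obtain ⟨Pc, Tc, hTc, hPc⟩ := hc.2 (s + 1) (Λ.mono (by omega)) (by omega)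
  obtain ⟨P1, T1, ⟨b, hb⟩, hP1⟩ := h1.2 (s + 3) (Λ.loop c A) (by omega)
  refine ⟨.seq P0 (.seq Pc (.seq (.move (s + 2) (s + 1)) (.seq (.const (s + 1) 0)
    (.loop (s + 2) (.loopBody P1 s))))),
    fun a => T0 a + (Tc a + (4 + c a * (scale a ^ b + 6))),
    hT0.add (hTc.add ((PolyB.const 4).add (hcb.mul (PolyB.add ⟨b, fun _ => le_rfl⟩
      (PolyB.const 6))))), fun a m hm => ?_⟩
  obtain ⟨t₁, m₁, h₁, ht₁, hv₁, hm₁⟩ := hP0 a m hm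
  have hm₁' := Layout.Holds.of_eq hm hs hm₁
  obtain ⟨t₂, m₂, h₂, ht₂, hv₂, hm₂⟩ := hPc a m₁ hm₁'
  set m₃ := Function.update m₂ (s + 2) (m₂ (s + 1)) with hm₃
  set m₄ := Function.update m₃ (s + 1) 0 with hm₄
  have hlow : ∀ y < s, m₄ y = m y := fun y hy => by
    rw [← hm₁ y hy, ← hm₂ y (by omega)]
    simp [hm₄, hm₃, show y ≠ s + 1 by omega, show y ≠ s + 2 by omega]
  obtain ⟨t₅, m₅, h₅, ht₅, hv₅, hm₅⟩ := Layout.exec_loop (b := scale a ^ b) hs hP1 a (fun x hx => hb ⟨a, x, hx⟩)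
    (c a) 0 m₄ (by omega) (Layout.Holds.of_eq hm hs hlow)
    (by simp [hm₄, hm₃, hm₂ s (by omega), hv₁])
    (by simp [hm₄]) (by simp [hm₄, hm₃, hv₂])
  refine ⟨_, m₅, .seq h₁ (.seq h₂ (.seq (.move (by omega) m₂) (.seq (.const _ _ _) h₅))), ?_, hv₅,
    fun y hy => by rw [hm₅ y hy, hlow y hy]⟩
  dsimp only
  omega

end Loop

/-! ### Programs with edge queries -/

theorem UniformHypergraph.edgeBit_congr {n k : ℕ} (H : UniformHypergraph n k) {v w : ℕ → ℕ}
    (h : (Finset.range k).image v = (Finset.range k).image w) : H.edgeBit v = H.edgeBit w := by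
  unfold UniformHypergraph.edgeBit
  split_ifs with h1 h2 h2
  · rfl
  · obtain ⟨e, he, h'⟩ := h1
    exact absurd ⟨e, he, h'.trans h⟩ h2
  · obtain ⟨e, he, h'⟩ := h2
    exact absurd ⟨e, he, h'.trans h.symm⟩ h1
  · rfl

section Edge

variable {α : Type} [ProgState α] {f : α → ℕ}

/-- One round of the loop that writes the base-`n` digits of the content of the cell `s`, the least
significant one first, to consecutive cells; `s + 2` holds the current address, and `s + 1` counts
down. -/
def Prog.writeDigit (s : ℕ) : Prog :=
  .seq (.quot (s + 3) s 0) (.seq (.times (s + 4) (s + 3) 0) (.seq (.minus (s + 4) s (s + 4))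
    (.seq (.store (s + 2) (s + 4)) (.seq (.move s (s + 3)) (.seq (.const (s + 4) 1)
      (.seq (.plus (s + 2) (s + 2) (s + 4)) (.minus (s + 1) (s + 1) (s + 4))))))))

/-- A run of the loop when `j` digits of `v` have been written to the cells from `s + 5` on, and `r`
are left: the cell `s` then holds `v / n ^ j`. The base `n` is read from the cell `0`. -/
theorem Exec.writeDigits (i : CliqueInput) {s : ℕ} (hs : 3 ≤ s) (v r : ℕ) :
    ∀ (j : ℕ) (m : Memory), m 0 = i.n → m s = v / i.n ^ j → m (s + 1) = r →
      m (s + 2) = s + 5 + j → (∀ l < j, m (s + 5 + l) = v / i.n ^ l % i.n) →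
      ∃ t m', Exec i (.loop (s + 1) (.writeDigit s)) m t m' ∧
        t ≤ 1 + r * (2 * v.size + 2 * i.n.size + 11) ∧
        (∀ l < j + r, m' (s + 5 + l) = v / i.n ^ l % i.n) ∧ ∀ y < s, m' y = m y := by
  induction r with
  | zero =>
    intro j m h0 hs0 hs1 hs2 hd
    exact ⟨1, m, .loopDone hs1, by omega, hd, fun _ _ => rfl⟩
  | succ r ih =>
    intro j m h0 hs0 hs1 hs2 hd
    set q := v / i.n ^ j with hq
    set m₁ := Function.update m (s + 3) (m s / m 0) with hm₁
    set m₂ := Function.update m₁ (s + 4) (m₁ (s + 3) * m₁ 0) with hm₂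
    set m₃ := Function.update m₂ (s + 4) (m₂ s - m₂ (s + 4)) with hm₃
    set m₄ := Function.update m₃ (m₃ (s + 2)) (m₃ (s + 4)) with hm₄
    set m₅ := Function.update m₄ s (m₄ (s + 3)) with hm₅
    set m₆ := Function.update m₅ (s + 4) 1 with hm₆
    set m₇ := Function.update m₆ (s + 2) (m₆ (s + 2) + m₆ (s + 4)) with hm₇
    set m₈ := Function.update m₇ (s + 1) (m₇ (s + 1) - m₇ (s + 4)) with hm₈
    have a0 : (0 : ℕ) ≠ s + 3 := by omega
    have a1 : (0 : ℕ) ≠ s + 4 := by omega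
    have c3 : m₃ (s + 2) = s + 5 + j := by simp [hm₃, hm₂, hm₁, hs2]
    have e3 : m₃ (s + 4) = q % i.n := by
      have := Nat.div_add_mod q i.n
      have h2 : m₁ 0 = i.n := by simp [hm₁, h0]
      simp only [hm₃, hm₂, Function.update_self, h2]
      simp only [hm₁, Function.update_self, Function.update_of_ne (show s ≠ s + 4 by omega),
        Function.update_of_ne (show s ≠ s + 3 by omega), hs0, h0]
      rw [mul_comm]; omega
    have m4 : ∀ y, y ≠ s + 5 + j → m₄ y = m₃ y := fun y hy => by
      rw [hm₄, c3, Function.update_of_ne hy]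
    have m4' : m₄ (s + 5 + j) = q % i.n := by rw [hm₄, c3, Function.update_self, e3]
    have f0 : m₈ s = v / i.n ^ (j + 1) := by
      rw [pow_succ, ← Nat.div_div_eq_div_mul, ← hq]
      simp [hm₈, hm₇, hm₆, hm₅, m4 (s + 3) (by omega), hm₃, hm₂, hm₁, hs0, h0]
    have f1 : m₈ (s + 1) = r := by
      simp [hm₈, hm₇, hm₆, hm₅, m4 (s + 1) (by omega), hm₃, hm₂, hm₁, hs1]
    have f2 : m₈ (s + 2) = s + 5 + (j + 1) := by
      simp [hm₈, hm₇, hm₆, hm₅, m4 (s + 2) (by omega), hm₃, hm₂, hm₁, hs2]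
      omega
    have f3 : ∀ y, s + 5 ≤ y → m₈ y = m₄ y := fun y hy => by
      simp [hm₈, hm₇, hm₆, hm₅, show y ≠ s by omega, show y ≠ s + 1 by omega,
        show y ≠ s + 2 by omega, show y ≠ s + 4 by omega]
    have f4 : ∀ y, s + 5 ≤ y → m₃ y = m y := fun y hy => by
      simp [hm₃, hm₂, hm₁, show y ≠ s + 3 by omega, show y ≠ s + 4 by omega]
    have f5 : ∀ y < s, m₈ y = m y := fun y hy => by
      simp [hm₈, hm₇, hm₆, hm₅, m4 y (by omega), hm₃, hm₂, hm₁, show y ≠ s by omega,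
        show y ≠ s + 1 by omega, show y ≠ s + 2 by omega, show y ≠ s + 3 by omega,
        show y ≠ s + 4 by omega]
    obtain ⟨t₉, m₉, h₉, ht₉, hv₉, hm₉⟩ := ih (j + 1) m₈ ((f5 0 (by omega)).trans h0) f0 f1 f2
      (fun l hl => by
        rcases eq_or_ne l j with rfl | hlj
        · rw [f3 _ (by omega), m4', hq]
        · rw [f3 _ (by omega), m4 _ (by omega), f4 _ (by omega), hd l (by omega)])
    refine ⟨_, m₉, .loopStep (by omega) (.seq (.quot _ _ _ m) (.seq (.times _ _ _ m₁)
      (.seq (.minus _ _ _ m₂) (.seq (.store _ _ m₃) (.seq (.move (by omega) m₄)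
        (.seq (.const _ _ m₅) (.seq (.plus _ _ _ m₆) (.minus _ _ _ m₇)))))))) h₉, ?_,
      fun l hl => hv₉ l (by omega), fun y hy => by rw [hm₉ y hy, f5 y hy]⟩
    have s1 : (m s).size ≤ v.size := by rw [hs0]; exact Nat.size_le_size (Nat.div_le_self _ _)
    have s2 : (m₁ (s + 3)).size ≤ v.size := by
      simp only [hm₁, Function.update_self]
      exact (Nat.size_le_size (Nat.div_le_self _ _)).trans s1
    have s3 : m₁ 0 = i.n := by simp [hm₁, h0]
    rw [s3, h0]
    have : (r + 1) * (2 * v.size + 2 * i.n.size + 11) =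
      r * (2 * v.size + 2 * i.n.size + 11) + (2 * v.size + 2 * i.n.size + 11) := by ring
    omega

/-- An edge query for the vertices that are the `k` lowest digits of `f a` in base `n`. -/
theorem Comp.edge (hf : Comp f) :
    Comp fun a => (inp a).H.edgeBit fun j => f a / (inp a).n ^ j % (inp a).n := by
  have hle : ∀ a, ((inp a).H.edgeBit fun j => f a / (inp a).n ^ j % (inp a).n) ≤ 1 := fun a => by
    unfold UniformHypergraph.edgeBit; split_ifs <;> omega
  refine ⟨(PolyB.mono (PolyB.const 1) hle).size, fun s Λ hs => ?_⟩
  obtain ⟨P, T, hT, hP⟩ := hf.2 s Λ hs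
  refine ⟨.seq P (.seq (.move (s + 1) 1) (.seq (.const (s + 2) (s + 5))
    (.seq (.loop (s + 1) (.writeDigit s)) (.seq (.const (s + 2) (s + 5)) (.edge s (s + 2)))))),
    fun a => T a + (6 + (inp a).k * (2 * (f a).size + 2 * (inp a).n.size + 11) + (inp a).k),
    hT.add (((PolyB.const 6).add (PolyB.k.mul ((((PolyB.const 2).mul hf.1).add
      ((PolyB.const 2).mul PolyB.n.size)).add (PolyB.const 11)))).add PolyB.k), fun a m hm => ?_⟩
  obtain ⟨t₁, m₁, h₁, ht₁, hv₁, hm₁⟩ := hP a m hm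
  have hm₁' := Layout.Holds.of_eq hm hs hm₁
  set m₂ := Function.update m₁ (s + 1) (m₁ 1) with hm₂
  set m₃ := Function.update m₂ (s + 2) (s + 5) with hm₃
  have hlow : ∀ y < s, m₃ y = m₁ y := fun y hy => by
    simp [hm₃, hm₂, show y ≠ s + 1 by omega, show y ≠ s + 2 by omega]
  obtain ⟨t₄, m₄, h₄, ht₄, hv₄, hm₄⟩ := Exec.writeDigits (inp a) hs (f a) (inp a).k 0 m₃
    (by rw [hlow 0 (by omega), hm₁'.1]) (by simp [hm₃, hm₂, hv₁])
    (by simp [hm₃, hm₂, hm₁'.2.1]) (by simp [hm₃]) (fun l hl => by omega)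
  set m₅ := Function.update m₄ (s + 2) (s + 5) with hm₅
  refine ⟨_, _, .seq h₁ (.seq (.move (by omega) m₁) (.seq (.const _ _ m₂) (.seq h₄
    (.seq (.const _ _ m₄) (.edge s (s + 2) m₅))))), ?_, ?_, fun y hy => ?_⟩
  · dsimp only; omega
  · rw [Function.update_self]
    refine UniformHypergraph.edgeBit_congr _ ?_
    have : (Finset.range (inp a).k).image (fun j => m₅ (m₅ (s + 2) + j)) =
        (Finset.range (inp a).k).image fun j => f a / (inp a).n ^ j % (inp a).n := by
      refine Finset.image_congr fun l hl => ?_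
      have hl' : l < (inp a).k := by simpa using hl
      simp only [hm₅, Function.update_self]
      rw [Function.update_of_ne (by omega), hv₄ l (by omega)]
    exact this
  · rw [Function.update_of_ne hy.ne, hm₅, Function.update_of_ne (by omega), hm₄ y hy, hlow y hy,
      hm₁ y hy]

end Edge

/-! ### Closure properties -/

section Closure

variable {α : Type} [ProgState α] {c f g : α → ℕ} {A : α → ℕ → ℕ} {p q : α → Prop}

theorem Comp.congr (hf : Comp f) (h : ∀ a, g a = f a) : Comp g := by
  rwa [funext h]

/-- The accumulator can be read in the body of a loop. Its bit length has to be bounded beforehand,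
since it could grow exponentially with the number of rounds. -/
theorem Comp.acc (h : PolyB fun p : WithAcc c A => (A p.1 p.2).size) :
    Comp fun p : WithAcc c A => A p.1 p.2 :=
  .var (.inr (.inr rfl)) h

/-- Polynomial-time decidable predicates. -/
def CompPred (p : α → Prop) : Prop :=
  ∃ f : α → ℕ, Comp f ∧ ∀ a, p a ↔ f a ≠ 0

theorem Comp.ite [DecidablePred p] (hp : CompPred p) (hf : Comp f) (hg : Comp g) :
    Comp fun a => if p a then f a else g a := by
  obtain ⟨e, he, hpe⟩ := hp
  simp only [hpe]
  exact Comp.cond he hf hg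

theorem CompPred.lt (hf : Comp f) (hg : Comp g) : CompPred fun a => f a < g a :=
  ⟨_, hg.sub hf, fun a => by omega⟩

theorem CompPred.and (hp : CompPred p) (hq : CompPred q) : CompPred fun a => p a ∧ q a := by
  obtain ⟨e, he, hpe⟩ := hp
  obtain ⟨e', he', hpe'⟩ := hq
  exact ⟨_, he.mul he', fun a => by simp [hpe, hpe']⟩

theorem CompPred.not (hp : CompPred p) : CompPred fun a => ¬ p a := by
  obtain ⟨e, he, hpe⟩ := hp
  exact ⟨_, (Comp.const 1).sub he, fun a => by simp only [hpe]; omega⟩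

theorem CompPred.imp (hp : CompPred p) (hq : CompPred q) : CompPred fun a => p a → q a := by
  have h : (fun a => p a → q a) = fun a => ¬ (p a ∧ ¬ q a) := by
    funext a; simp only [not_and, not_not]
  rw [h]; exact (hp.and hq.not).not

theorem CompPred.le (hf : Comp f) (hg : Comp g) : CompPred fun a => f a ≤ g a := by
  simp only [← not_lt]; exact (CompPred.lt hg hf).not

theorem CompPred.eq (hf : Comp f) (hg : Comp g) : CompPred fun a => f a = g a := by
  simp only [le_antisymm_iff]; exact (CompPred.le hf hg).and (.le hg hf)

theorem CompPred.forall {p : α → ℕ → Prop} (hc : Comp c) (hcb : PolyB c)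
    (hp : CompPred fun q : Below c => p q.1 q.2) : CompPred fun a => ∀ x < c a, p a x := by
  classical
  obtain ⟨e, he, hpe⟩ := hp
  let A : α → ℕ → ℕ := fun a m => if ∀ x < m, p a x then 1 else 0
  have hA : ∀ a m, (A a m).size ≤ 1 := fun a m => by
    simp only [A]; split_ifs <;> simp
  refine ⟨fun a => A a (c a), Comp.fold hc hcb ((Comp.const 1).congr fun a => by simp [A]) ?_,
    fun a => by simp [A]⟩
  refine (Comp.ite (p := fun q : WithAcc c A => p q.1 q.2) ⟨fun q => e q, he.below_withAcc, hpe⟩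
    (Comp.acc (.mono (.const 1) fun q => hA _ _)) (.const 0)).congr fun q => ?_
  simp only [A, Nat.forall_lt_succ_right]
  split_ifs <;> tauto

theorem CompPred.exists {p : α → ℕ → Prop} (hc : Comp c) (hcb : PolyB c)
    (hp : CompPred fun q : Below c => p q.1 q.2) : CompPred fun a => ∃ x < c a, p a x := by
  have h : (fun a => ∃ x < c a, p a x) = fun a => ¬ ∀ x < c a, ¬ p a x := by
    funext a; simp
  rw [h]; exact (CompPred.forall hc hcb hp.not).not

theorem Nat.size_sum_range_le {B : ℕ} {u : ℕ → ℕ} (m : ℕ) (h : ∀ x < m, (u x).size ≤ B) :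
    (∑ x ∈ Finset.range m, u x).size ≤ B + m := by
  rw [Nat.size_le, pow_add]
  rcases Nat.eq_zero_or_pos m with rfl | hm
  · simp
  calc ∑ x ∈ Finset.range m, u x < ∑ x ∈ Finset.range m, 2 ^ B :=
        Finset.sum_lt_sum_of_nonempty (by simpa using hm.ne') fun x hx =>
          Nat.size_le.1 (h x (Finset.mem_range.1 hx))
    _ = 2 ^ B * m := by simp [mul_comm]
    _ ≤ 2 ^ B * 2 ^ m := Nat.mul_le_mul_left _ Nat.lt_two_pow_self.le

theorem Comp.sum {f : α → ℕ → ℕ} (hc : Comp c) (hcb : PolyB c)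
    (hf : Comp fun q : Below c => f q.1 q.2) :
    Comp fun a => ∑ x ∈ Finset.range (c a), f a x := by
  obtain ⟨b, hb⟩ := hf.1
  let A : α → ℕ → ℕ := fun a m => ∑ x ∈ Finset.range m, f a x
  have hA : PolyB fun q : WithAcc c A => (A q.1 q.2).size := by
    refine .mono (.add (f := fun q : WithAcc c A => scale q.1 ^ b) ⟨b, fun _ => le_rfl⟩
      (.counter_withAcc hcb)) fun q => Nat.size_sum_range_le _ fun x hx => ?_
    exact hb ⟨q.1, x, hx.trans q.2.2⟩
  refine Comp.fold (A := A) hc hcb ((Comp.const 0).congr fun a => by simp [A]) ?_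
  exact ((Comp.acc hA).add hf.below_withAcc).congr fun q => Finset.sum_range_succ _ _

theorem Comp.max (hf : Comp f) (hg : Comp g) : Comp fun a => max (f a) (g a) :=
  (hf.add (hg.sub hf)).congr fun a => by omega

theorem Comp.min (hf : Comp f) (hg : Comp g) : Comp fun a => min (f a) (g a) :=
  (hf.sub (hf.sub hg)).congr fun a => by omega

theorem Comp.sup {f : α → ℕ → ℕ} (hc : Comp c) (hcb : PolyB c)
    (hf : Comp fun q : Below c => f q.1 q.2) :
    Comp fun a => (Finset.range (c a)).sup (f a) := by
  obtain ⟨b, hb⟩ := hf.1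
  let A : α → ℕ → ℕ := fun a m => (Finset.range m).sup (f a)
  have hA : PolyB fun q : WithAcc c A => (A q.1 q.2).size := by
    refine .mono (f := fun q : WithAcc c A => (A q.1 q.2).size)
      (g := fun q : WithAcc c A => scale q.1 ^ b) ⟨b, fun _ => le_rfl⟩ fun q => ?_
    rw [Nat.size_le]
    refine (Finset.sup_lt_iff (by simp)).2 fun x hx => Nat.size_le.1 ?_
    exact hb ⟨q.1, x, (Finset.mem_range.1 hx).trans q.2.2⟩
  refine Comp.fold (A := A) hc hcb ((Comp.const 0).congr fun a => by simp [A]) ?_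
  refine ((Comp.acc hA).max hf.below_withAcc).congr fun q => ?_
  simp only [A, Finset.range_add_one, Finset.sup_insert]
  exact max_comm _ _

theorem Nat.size_pow_le (u m : ℕ) : (u ^ m).size ≤ u.size * m + 1 := by
  rw [Nat.size_le]
  calc u ^ m ≤ (2 ^ u.size) ^ m := Nat.pow_le_pow_left (Nat.lt_size_self u).le m
    _ = 2 ^ (u.size * m) := by rw [pow_mul]
    _ < _ := Nat.pow_lt_pow_right (by omega) (by omega)

theorem Comp.pow (hf : Comp f) (hg : Comp g) (hgb : PolyB g) : Comp fun a => f a ^ g a := by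
  let A : α → ℕ → ℕ := fun a m => f a ^ m
  have hA : PolyB fun q : WithAcc g A => (A q.1 q.2).size :=
    .mono (((PolyB.withAcc hf.1).mul (.counter_withAcc hgb)).add (.const 1))
      fun q => Nat.size_pow_le _ _
  refine Comp.fold (A := A) hg hgb ((Comp.const 1).congr fun a => by simp [A]) ?_
  exact ((Comp.acc hA).mul hf.withAcc).congr fun q => pow_succ _ _

theorem Comp.natSize (hf : Comp f) (hfb : PolyB f) : Comp fun a => (f a).size := by
  refine (Comp.sum (f := fun a x => if 2 ^ x ≤ f a then 1 else 0) hf hfb (.ite (.le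
    ((Comp.const 2).pow (.counter hfb) (.counter hfb)) hf.below) (.const 1) (.const 0))).congr
    fun a => ?_
  -- the bit length counts the powers of `2` that are at most `f a`
  have : (Finset.range (f a)).filter (fun x => 2 ^ x ≤ f a) = Finset.range (f a).size := by
    ext x
    simp only [Finset.mem_filter, Finset.mem_range, Nat.lt_size]
    exact ⟨fun h => h.2, fun h => ⟨Nat.lt_two_pow_self.trans_le h, h⟩⟩
  rw [Finset.sum_boole, this]; simp

end Closure

/-! ### The algorithm -/

/-- The digit of `c` at the position `j` in base `n`. A natural number is used as a code for the
tuple of its digits. -/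
def dig (n c j : ℕ) : ℕ := c / n ^ j % n

/-- The first `m` digits of `c` in base `n` are strictly increasing. -/
def Incr (n m c : ℕ) : Prop := ∀ j < m - 1, dig n c j < dig n c (j + 1)

namespace CliqueInput

variable (i : CliqueInput)

/-- Half of the uniformity: `evenPart i.k = 2 * i.h`. -/
def h : ℕ := i.k / 2

/-- The number of codes of `h`-tuples of vertices. -/
def N : ℕ := i.n ^ i.h

/-- The numerator of the approximation to `p` with denominator `2 ^ N`. -/
noncomputable def pNum : ℕ := ⌊(2 : ℝ) ^ i.N * (i.p : ℝ)⌋₊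

/-- A modulus that exceeds the true values of all moments (`frobMoment_lt`), so that these can be
computed modulo `R`. -/
def R : ℕ := 2 ^ (17 * (i.N * i.N) + 1)

/-- The answer to the edge query for the vertices with code `c`. -/
noncomputable def query (c : ℕ) : ℕ := i.H.edgeBit fun j => c / i.n ^ j % i.n

/-- The vertex `w` is in the common neighbourhood of `D`, in the hypergraph of uniformity `2 * h`
that is `H` if `k` is even and the link of the vertex `v` if `k` is odd. (If `k` is even, the query
does not depend on the digit `v`.) -/
def Common (v D w : ℕ) : Prop :=
  w ≠ v ∧ (∀ l < i.d, dig i.n D l ≠ w) ∧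
    ∀ T < i.n ^ (2 * i.h - 1), Incr i.n (2 * i.h - 1) T →
      (∀ j < 2 * i.h - 1, ∃ l < i.d, dig i.n T j = dig i.n D l) →
      i.query (T + i.n ^ (2 * i.h - 1) * w + i.n ^ (2 * i.h) * v) = 1

/-- `E` is the code of a strictly increasing `2 * h`-tuple in the common neighbourhood of `D`. -/
def Admissible (v D E : ℕ) : Prop :=
  Incr i.n (2 * i.h) E ∧ ∀ j < 2 * i.h, i.Common v D (dig i.n E j)

open Classical in
/-- The entry of the scaled, centred adjacency matrix at the concatenation `E` of a row index and a
column index, modulo `R`. -/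
noncomputable def entry (v D E : ℕ) : ℕ :=
  if i.Admissible v D E then 2 ^ i.N * i.query (E + i.n ^ (2 * i.h) * v) + (i.R - i.pNum) else 0

/-- The matrix with the entries `f A B`, modulo `R`, as a number in base `R`. -/
def encode (f : ℕ → ℕ → ℕ) : ℕ :=
  ∑ x ∈ Finset.range (i.N * i.N), f (x % i.N) (x / i.N) % i.R * i.R ^ x

/-- The entry of an encoded matrix. -/
def decode (Z A B : ℕ) : ℕ := Z / i.R ^ (A + i.N * B) % i.R

/-- The code of `G ^ (2 ^ l)`, where `G` is the Gram matrix of the rows of the centred adjacency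
matrix. -/
noncomputable def gramPow (v D : ℕ) : ℕ → ℕ
  | 0 => i.encode fun A B =>
      ∑ C ∈ Finset.range i.N, i.entry v D (A + i.N * C) * i.entry v D (B + i.N * C)
  | l + 1 => i.encode fun A B =>
      ∑ C ∈ Finset.range i.N, i.decode (gramPow v D l) A C * i.decode (gramPow v D l) C B

/-- The squared Frobenius norm of `G ^ (2 ^ l)`, for `l` with `N < 2 ^ l`. -/
noncomputable def moment (v D : ℕ) : ℕ :=
  (∑ A ∈ Finset.range i.N, ∑ B ∈ Finset.range i.N,
    i.decode (i.gramPow v D i.N.size) A B ^ 2) % i.R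

/-- The moment does not exclude a clique with `2 * h * q` vertices in the common neighbourhood. -/
def Passes (v D q : ℕ) : Prop :=
  ((2 ^ i.N - i.pNum) * q ^ i.h) ^ 2 ^ (i.N.size + 2) ≤ i.moment v D

/-- `D` is the code of a strictly increasing `d`-tuple of vertices different from `v`. -/
def GoodTuple (v D : ℕ) : Prop := Incr i.n i.d D ∧ ∀ l < i.d, dig i.n D l ≠ v

open Classical in
/-- The largest `q` that is not excluded for some choice of `v` and `D`. -/
noncomputable def maxBlock : ℕ :=
  (Finset.range i.n).sup fun v => (Finset.range (i.n ^ i.d)).sup fun D =>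
    if i.GoodTuple v D then (Finset.range (i.n + 1)).sup fun q =>
      if i.Passes v D q then q else 0
    else 0

/-- The output of the algorithm. -/
noncomputable def output : ℕ := min i.n (i.d + 1 + 2 * i.h * (1 + i.maxBlock))

theorem two_h_le : 2 * i.h ≤ i.k := by unfold h; omega

theorem R_pos : 0 < i.R := by unfold R; positivity

theorem encode_lt_aux (R : ℕ) (g : ℕ → ℕ) (hg : ∀ x, g x < R) (m : ℕ) :
    ∑ x ∈ Finset.range m, g x * R ^ x < R ^ m := by
  induction m with
  | zero => simp
  | succ m ih =>
    rw [Finset.sum_range_succ, pow_succ]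
    have := Nat.mul_le_mul_right (R ^ m) (Nat.succ_le_of_lt (hg m))
    rw [Nat.succ_mul] at this
    nlinarith

theorem sum_digits_div_mod (R : ℕ) (hR : 0 < R) (g : ℕ → ℕ) (hg : ∀ x, g x < R) (m x : ℕ)
    (hx : x < m) : (∑ y ∈ Finset.range m, g y * R ^ y) / R ^ x % R = g x := by
  induction m with
  | zero => omega
  | succ m ih =>
    rw [Finset.sum_range_succ]
    rcases Nat.lt_succ_iff_lt_or_eq.1 hx with hx' | rfl
    · obtain ⟨r, rfl⟩ := Nat.exists_eq_add_of_lt hx'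
      have : g (x + r + 1) * R ^ (x + r + 1) = R ^ x * (R * (g (x + r + 1) * R ^ r)) := by ring
      rw [this, Nat.add_mul_div_left _ _ (by positivity), Nat.add_mul_mod_self_left, ih (by omega)]
    · rw [mul_comm (g x), Nat.add_mul_div_left _ _ (by positivity),
        Nat.div_eq_of_lt (encode_lt_aux R g hg x), zero_add, Nat.mod_eq_of_lt (hg x)]

theorem encode_lt (f : ℕ → ℕ → ℕ) : i.encode f < i.R ^ (i.N * i.N) :=
  encode_lt_aux _ _ (fun _ => Nat.mod_lt _ i.R_pos) _

theorem decode_encode (f : ℕ → ℕ → ℕ) {A B : ℕ} (hA : A < i.N) (hB : B < i.N) :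
    i.decode (i.encode f) A B = f A B % i.R := by
  unfold decode encode
  rw [sum_digits_div_mod i.R i.R_pos (fun x => f (x % i.N) (x / i.N) % i.R)
    (fun _ => Nat.mod_lt _ i.R_pos)]
  · rw [Nat.add_mul_mod_self_left, Nat.mod_eq_of_lt hA, Nat.add_mul_div_left _ _ (by omega),
      Nat.div_eq_of_lt hA, zero_add]
  · nlinarith

end CliqueInput

/-! ### The algorithm runs in polynomial time -/

section Comp

variable {α : Type} [ProgState α] {c f v D w j E q l : α → ℕ}

theorem Comp.dig (hc : Comp c) (hj : Comp j) (hjb : PolyB j) :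
    Comp fun a => dig (inp a).n (c a) (j a) :=
  (hc.div (Comp.n.pow hj hjb)).mod .n

theorem CompPred.incr {m : α → ℕ} (hm : Comp m) (hmb : PolyB m) (hc : Comp c) :
    CompPred fun a => Incr (inp a).n (m a) (c a) := by
  have hb : PolyB fun a => m a - 1 := hmb.mono fun a => Nat.sub_le _ _
  exact CompPred.forall (hm.sub (.const 1)) hb (.lt (Comp.dig hc.below (.counter hb) (.counter hb))
    (Comp.dig hc.below ((Comp.counter hb).add (.const 1)) ((PolyB.counter hb).add (.const 1))))

theorem Comp.h : Comp fun a : α => (inp a).h := Comp.k.div (.const 2)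

theorem PolyB.h : PolyB fun a : α => (inp a).h := PolyB.k.mono fun _ => Nat.div_le_self _ _

theorem Comp.N : Comp fun a : α => (inp a).N := Comp.n.pow .h .h

theorem PolyB.N : PolyB fun a : α => (inp a).N := PolyB.n_pow _ fun _ => Nat.div_le_self _ _

theorem Comp.pNum : Comp fun a : α => (inp a).pNum := Comp.approx .N .N

theorem Comp.R : Comp fun a : α => (inp a).R :=
  (Comp.const 2).pow (((Comp.const 17).mul (Comp.N.mul .N)).add (.const 1))
    (((PolyB.const 17).mul (PolyB.N.mul .N)).add (.const 1))

theorem Comp.query (hc : Comp c) : Comp fun a => (inp a).query (c a) := hc.edge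

theorem Comp.twoH : Comp fun a : α => 2 * (inp a).h := (Comp.const 2).mul .h

theorem PolyB.twoH : PolyB fun a : α => 2 * (inp a).h := (PolyB.const 2).mul .h

theorem Comp.twoH_sub : Comp fun a : α => 2 * (inp a).h - 1 := Comp.twoH.sub (.const 1)

theorem PolyB.twoH_sub : PolyB fun a : α => 2 * (inp a).h - 1 :=
  PolyB.twoH.mono fun _ => Nat.sub_le _ _

/-- The `(2h - 1)`-tuples are enumerated through their codes, of which there are at most `n ^ k`. -/
theorem CompPred.common (hv : Comp v) (hD : Comp D) (hw : Comp w) :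
    CompPred fun a => (inp a).Common (v a) (D a) (w a) := by
  have hb : PolyB fun a : α => (inp a).n ^ (2 * (inp a).h - 1) :=
    .n_pow _ fun a => (Nat.sub_le _ _).trans (inp a).two_h_le
  refine (CompPred.eq hw hv).not.and (.and (.forall .d .d (.not (.eq
    (.dig hD.below (.counter .d) (.counter .d)) hw.below))) (.forall (Comp.n.pow .twoH_sub .twoH_sub)
    hb (.imp (.incr .twoH_sub .twoH_sub (.counter hb)) (.imp (.forall .twoH_sub .twoH_sub
    (.exists .d .d (.eq (.dig (Comp.counter hb).below.below (Comp.counter .twoH_sub).below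
      (PolyB.counter .twoH_sub).below) (.dig hD.below.below.below (.counter .d) (.counter .d)))))
    (.eq (.query (((Comp.counter hb).add ((Comp.n.pow .twoH_sub .twoH_sub).mul hw.below)).add
      ((Comp.n.pow .twoH .twoH).mul hv.below))) (.const 1))))))

theorem CompPred.admissible (hv : Comp v) (hD : Comp D) (hE : Comp E) :
    CompPred fun a => (inp a).Admissible (v a) (D a) (E a) :=
  (CompPred.incr .twoH .twoH hE).and (.forall .twoH .twoH (.common hv.below hD.below
    (.dig hE.below (.counter .twoH) (.counter .twoH))))

theorem Comp.entry (hv : Comp v) (hD : Comp D) (hE : Comp E) :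
    Comp fun a => (inp a).entry (v a) (D a) (E a) := by
  classical
  refine (Comp.ite (.admissible hv hD hE) ((((Comp.const 2).pow .N .N).mul (.query (hE.add
    ((Comp.n.pow .twoH .twoH).mul hv)))).add (Comp.R.sub .pNum)) (.const 0)).congr fun a => ?_
  unfold CliqueInput.entry
  congr

theorem PolyB.NN : PolyB fun a : α => (inp a).N * (inp a).N := PolyB.N.mul .N

theorem Comp.NN : Comp fun a : α => (inp a).N * (inp a).N := Comp.N.mul .N

/-- Loops over the indices of matrices. -/
theorem Comp.encode {f : α → ℕ → ℕ → ℕ}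
    (hf : Comp fun p : Below fun a : α => (inp a).N * (inp a).N =>
      f p.1 (p.2 % (inp p.1).N) (p.2 / (inp p.1).N)) :
    Comp fun a => (inp a).encode (f a) :=
  .sum .NN .NN ((hf.mod .R).mul (Comp.R.pow (.counter .NN) (.counter .NN)))

theorem Comp.decode {Z A B : α → ℕ} (hZ : Comp Z) (hA : Comp A) (hB : Comp B) (hAb : PolyB A)
    (hBb : PolyB B) : Comp fun a => (inp a).decode (Z a) (A a) (B a) :=
  (hZ.div (Comp.R.pow (hA.add (Comp.N.mul hB)) (hAb.add (PolyB.N.mul hBb)))).mod .R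

theorem PolyB.size_R_pow :
    PolyB fun a : α => ((inp a).R ^ ((inp a).N * (inp a).N)).size := by
  have h : Comp fun a : α => (inp a).R ^ ((inp a).N * (inp a).N) := Comp.R.pow .NN .NN
  exact h.1

/-- Repeated squaring. The bit length of the code of a matrix does not grow, because the entries are
reduced modulo `R`. -/
theorem Comp.gramPow (hv : Comp v) (hD : Comp D) (hl : Comp l) (hlb : PolyB l) :
    Comp fun a => (inp a).gramPow (v a) (D a) (l a) := by
  refine Comp.fold (A := fun a m => (inp a).gramPow (v a) (D a) m) hl hlb ?_ ?_
  · refine Comp.encode (.sum .N .N ?_)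
    exact (Comp.entry hv.below.below hD.below.below
        (((Comp.counter .NN).mod .N).below.add (Comp.N.mul (.counter .N)))).mul
      (Comp.entry hv.below.below hD.below.below
        (((Comp.counter .NN).div .N).below.add (Comp.N.mul (.counter .N))))
  · have hacc : Comp fun q : WithAcc l fun a m => (inp a).gramPow (v a) (D a) m =>
        (inp q.1).gramPow (v q.1) (D q.1) q.2 := by
      refine Comp.acc (.mono (PolyB.size_R_pow) fun q => Nat.size_le_size ?_)
      rcases (q.2 : ℕ) with _ | m <;> exact (CliqueInput.encode_lt _ _).le
    have h1 := (PolyB.counter (α := WithAcc l fun a m => (inp a).gramPow (v a) (D a) m) .NN)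
    refine Comp.encode (.sum .N .N ?_)
    exact (Comp.decode hacc.below.below ((Comp.counter .NN).mod .N).below (.counter .N)
        (h1.mono (f := fun p => (p.2 : ℕ) % (inp p.1).N) fun _ => Nat.mod_le _ _).below (.counter .N)).mul
      (Comp.decode hacc.below.below (.counter .N) ((Comp.counter .NN).div .N).below (.counter .N)
        (h1.mono (f := fun p => (p.2 : ℕ) / (inp p.1).N) fun _ => Nat.div_le_self _ _).below)

theorem PolyB.levels : PolyB fun a : α => (inp a).N.size := PolyB.N.size

theorem Comp.levels : Comp fun a : α => (inp a).N.size := .natSize .N .N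

theorem Comp.moment (hv : Comp v) (hD : Comp D) :
    Comp fun a => (inp a).moment (v a) (D a) :=
  (Comp.sum .N .N (.sum .N .N ((Comp.decode (.gramPow hv.below.below hD.below.below .levels .levels)
    (Comp.counter .N).below (.counter .N) (PolyB.counter .N).below (.counter .N)).pow (.const 2)
    (.const 2)))).mod .R

theorem Nat.two_pow_size_le_of_pos {N : ℕ} (h : 0 < N) : 2 ^ N.size ≤ 2 * N := by
  obtain ⟨m, hm⟩ : ∃ m, N.size = m + 1 := ⟨N.size - 1, by have := Nat.size_pos.2 h; omega⟩
  have : 2 ^ m ≤ N := Nat.lt_size.1 (by omega)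
  rw [hm, pow_succ]; omega

theorem Nat.two_pow_size_le (N : ℕ) : 2 ^ N.size ≤ 2 * N + 1 := by
  rcases Nat.eq_zero_or_pos N with rfl | h
  · simp
  · exact (Nat.two_pow_size_le_of_pos h).trans (Nat.le_succ _)

theorem CompPred.passes (hv : Comp v) (hD : Comp D) (hq : Comp q) :
    CompPred fun a => (inp a).Passes (v a) (D a) (q a) := by
  -- the exponent is at most `8 N + 4`, so that the power has polynomial bit length
  have h : PolyB fun a : α => 2 ^ ((inp a).N.size + 2) :=
    .mono (((PolyB.const 8).mul .N).add (.const 4)) fun a => by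
      have := Nat.two_pow_size_le (inp a).N
      rw [pow_add]; omega
  exact .le (((((Comp.const 2).pow .N .N).sub .pNum).mul (hq.pow .h .h)).pow
    ((Comp.const 2).pow (Comp.levels.add (.const 2)) (PolyB.levels.add (.const 2))) h)
    (.moment hv hD)

theorem CompPred.goodTuple (hv : Comp v) (hD : Comp D) :
    CompPred fun a => (inp a).GoodTuple (v a) (D a) :=
  (CompPred.incr .d .d hD).and (.forall .d .d (.not (.eq (.dig hD.below (.counter .d) (.counter .d))
    hv.below)))

theorem Comp.output : Comp fun a : α => (inp a).output := by
  classical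
  have h1 {β : Type} [ProgState β] : PolyB fun a : β => (inp a).n + 1 := PolyB.n.add (.const 1)
  have h2 {β : Type} [ProgState β] {v D : β → ℕ} (hv : Comp v) (hD : Comp D) :
      Comp fun a => if (inp a).GoodTuple (v a) (D a) then (Finset.range ((inp a).n + 1)).sup fun q =>
        if (inp a).Passes (v a) (D a) q then q else 0 else 0 :=
    .ite (.goodTuple hv hD) (.sup (Comp.n.add (.const 1)) h1
      (.ite (.passes hv.below hD.below (.counter h1)) (.counter h1) (.const 0))) (.const 0)
  have h3 {β : Type} [ProgState β] {v : β → ℕ} (hv : Comp v) :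
      Comp fun a => (Finset.range ((inp a).n ^ (inp a).d)).sup fun D =>
        if (inp a).GoodTuple (v a) D then (Finset.range ((inp a).n + 1)).sup fun q =>
          if (inp a).Passes (v a) D q then q else 0 else 0 :=
    Comp.sup (Comp.n.pow .d .d) .n_pow_d (h2 (hv.below (c := fun a => (inp a).n ^ (inp a).d))
      (.counter .n_pow_d))
  refine Comp.n.min ((Comp.d.add (.const 1)).add (Comp.twoH.mul ((Comp.const 1).add ?_)))
  refine (Comp.sup (f := fun a v => (Finset.range ((inp a).n ^ (inp a).d)).sup fun D =>
    if (inp a).GoodTuple v D then (Finset.range ((inp a).n + 1)).sup fun q =>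
      if (inp a).Passes v D q then q else 0 else 0) .n .n (h3 (.counter .n))).congr fun a => ?_
  unfold CliqueInput.maxBlock
  congr! 4

end Comp

/-- The initial states: the inputs, without any further variables. -/
instance : ProgState {i : CliqueInput // 2 ≤ i.k} where
  inp := Subtype.val
  two_le i := i.2
  vars := ∅

/-- Some program computes `output` in time `max (n, 2) ^ O(d + k)`. -/
theorem exists_prog_output : ∃ (P : Prog) (B : ℕ), ∀ i : CliqueInput, 2 ≤ i.k →
    ∃ t, P.Outputs i i.output t ∧ t ≤ max i.n 2 ^ (B * (i.d + i.k)) := by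
  obtain ⟨-, h⟩ := Comp.output (α := {i : CliqueInput // 2 ≤ i.k})
  obtain ⟨P, T, hT, hP⟩ := h 3 ⟨∅, by simp, by simp [ProgState.vars]⟩ le_rfl
  obtain ⟨B, hB⟩ := hT.add (.const 2)
  -- the cells `0`, `1`, `2` hold the input, so the result is computed in the cell `3`
  refine ⟨.seq P (.move 0 3), B, fun i hi => ?_⟩
  obtain ⟨t, m, ht, htT, hm, -⟩ := hP ⟨i, hi⟩ i.initMemory
    ⟨by simp [CliqueInput.initMemory, inp], by simp [CliqueInput.initMemory, inp],
      by simp [CliqueInput.initMemory, inp], by simp⟩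
  refine ⟨_, ⟨_, .seq ht (.move (by omega) m), by simpa [inp] using hm⟩, ?_⟩
  rw [mul_comm, pow_mul]
  exact (Nat.add_le_add_right htT 2).trans (hB ⟨i, hi⟩)

/-! ### Spectral certificates -/

section LinearAlgebra

open Matrix

variable {ι : Type*} [Fintype ι]

theorem dotProduct_sq_le (x y : ι → ℝ) : (x ⬝ᵥ y) ^ 2 ≤ (x ⬝ᵥ x) * (y ⬝ᵥ y) := by
  simpa [dotProduct, sq] using Finset.sum_mul_sq_le_sq_mul_sq Finset.univ x y

theorem dotProduct_self_nonneg' (x : ι → ℝ) : 0 ≤ x ⬝ᵥ x :=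
  Finset.sum_nonneg fun i _ => mul_self_nonneg (x i)

theorem dotProduct_mulVec_eq (M : Matrix ι ι ℝ) (x y : ι → ℝ) :
    x ⬝ᵥ M *ᵥ y = (Mᵀ *ᵥ x) ⬝ᵥ y := by
  rw [dotProduct_mulVec, mulVec_transpose]

variable [DecidableEq ι]

/-- Repeated squaring: for a positive semidefinite `G`, the form of `G ^ (2 ^ l)` dominates the
power of the form of `G`. -/
theorem pow_dotProduct_mulVec_le {G : Matrix ι ι ℝ} (hG : Gᵀ = G) (x : ι → ℝ)
    (h0 : 0 ≤ x ⬝ᵥ G *ᵥ x) (hx : 0 < x ⬝ᵥ x) (l : ℕ) :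
    (x ⬝ᵥ G *ᵥ x) ^ 2 ^ l * (x ⬝ᵥ x) ≤ (x ⬝ᵥ x) ^ 2 ^ l * (x ⬝ᵥ (G ^ 2 ^ l) *ᵥ x) := by
  induction l with
  | zero => simp [mul_comm]
  | succ l ih =>
    set t := x ⬝ᵥ x
    set H := G ^ 2 ^ l with hH
    have hHt : Hᵀ = H := by rw [hH, transpose_pow, hG]
    have h1 : (x ⬝ᵥ H *ᵥ x) ^ 2 ≤ t * (x ⬝ᵥ (G ^ 2 ^ (l + 1)) *ᵥ x) := by
      refine (dotProduct_sq_le _ _).trans_eq ?_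
      rw [pow_succ 2 l, pow_mul, ← hH, sq, ← mulVec_mulVec, dotProduct_mulVec_eq H x, hHt]
    have h2 := pow_le_pow_left₀ (by positivity) ih 2
    rw [mul_pow, mul_pow, ← pow_mul, ← pow_mul, ← pow_succ] at h2
    have h3 : t * ((x ⬝ᵥ G *ᵥ x) ^ 2 ^ (l + 1) * t) ≤
        t * (t ^ 2 ^ (l + 1) * (x ⬝ᵥ (G ^ 2 ^ (l + 1)) *ᵥ x)) := by
      calc _ = (x ⬝ᵥ G *ᵥ x) ^ 2 ^ (l + 1) * t ^ 2 := by ring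
        _ ≤ _ := h2
        _ ≤ t ^ 2 ^ (l + 1) * (t * (x ⬝ᵥ (G ^ 2 ^ (l + 1)) *ᵥ x)) := by gcongr
        _ = _ := by ring
    exact le_of_mul_le_mul_left h3 hx

/-- The squared Frobenius norm of `(M Mᵀ) ^ (2 ^ l)`, that is, the trace of
`(M Mᵀ) ^ (2 ^ (l + 1))`. -/
def frobMoment {R : Type*} [CommRing R] (M : Matrix ι ι R) (l : ℕ) : R :=
  ∑ A, ∑ B, ((M * Mᵀ) ^ 2 ^ l) A B ^ 2

omit [DecidableEq ι] in
theorem dotProduct_mulVec_sq_le_frob (H : Matrix ι ι ℝ) (x : ι → ℝ) :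
    (x ⬝ᵥ H *ᵥ x) ^ 2 ≤ (x ⬝ᵥ x) ^ 2 * ∑ A, ∑ B, H A B ^ 2 := by
  refine (dotProduct_sq_le _ _).trans ?_
  rw [sq (x ⬝ᵥ x), mul_assoc]
  refine mul_le_mul_of_nonneg_left ?_ (dotProduct_self_nonneg' x)
  rw [Finset.mul_sum]
  refine Finset.sum_le_sum fun A _ => ?_
  have := dotProduct_sq_le (H A) x
  simp only [mulVec, ← sq] at this ⊢
  refine this.trans_eq ?_
  rw [mul_comm]
  simp [dotProduct, sq]

/-- Every bilinear form value is dominated by the moments of the matrix. -/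
theorem dotProduct_mulVec_pow_le_frobMoment (M : Matrix ι ι ℝ) (x y : ι → ℝ) {t : ℝ} (ht : 0 < t)
    (hx : x ⬝ᵥ x = t) (hy : y ⬝ᵥ y = t) (l : ℕ) :
    (x ⬝ᵥ M *ᵥ y) ^ 2 ^ (l + 2) ≤ t ^ 2 ^ (l + 2) * frobMoment M l := by
  set G := M * Mᵀ with hG
  have hGt : Gᵀ = G := by simp [hG, transpose_mul]
  have hGx : x ⬝ᵥ G *ᵥ x = (Mᵀ *ᵥ x) ⬝ᵥ (Mᵀ *ᵥ x) := by
    rw [hG, ← mulVec_mulVec, dotProduct_mulVec_eq]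
  have h0 : 0 ≤ x ⬝ᵥ G *ᵥ x := by rw [hGx]; exact dotProduct_self_nonneg' _
  have h1 : (x ⬝ᵥ M *ᵥ y) ^ 2 ≤ t * (x ⬝ᵥ G *ᵥ x) := by
    rw [dotProduct_mulVec_eq, hGx, mul_comm, ← hy]
    exact dotProduct_sq_le _ _
  have h2 := pow_dotProduct_mulVec_le hGt x h0 (hx ▸ ht) l
  rw [hx] at h2
  have h3 := dotProduct_mulVec_sq_le_frob (G ^ 2 ^ l) x
  rw [hx] at h3
  have h4 : (x ⬝ᵥ G *ᵥ x) ^ 2 ^ (l + 1) ≤ t ^ 2 ^ (l + 1) * frobMoment M l := by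
    have h5 := pow_le_pow_left₀ (by positivity) h2 2
    rw [mul_pow, mul_pow, ← pow_mul, ← pow_mul, ← pow_succ] at h5
    have h6 : (x ⬝ᵥ G *ᵥ x) ^ 2 ^ (l + 1) * t ^ 2 ≤
        (t ^ 2 ^ (l + 1) * frobMoment M l) * t ^ 2 :=
      h5.trans (by
        calc _ ≤ t ^ 2 ^ (l + 1) * (t ^ 2 * ∑ A, ∑ B, (G ^ 2 ^ l) A B ^ 2) := by gcongr
          _ = _ := by rw [frobMoment]; ring)
    exact le_of_mul_le_mul_right h6 (by positivity)
  calc (x ⬝ᵥ M *ᵥ y) ^ 2 ^ (l + 2) = ((x ⬝ᵥ M *ᵥ y) ^ 2) ^ 2 ^ (l + 1) := by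
        rw [← pow_mul, ← pow_succ']
    _ ≤ (t * (x ⬝ᵥ G *ᵥ x)) ^ 2 ^ (l + 1) := by gcongr
    _ = t ^ 2 ^ (l + 1) * (x ⬝ᵥ G *ᵥ x) ^ 2 ^ (l + 1) := mul_pow _ _ _
    _ ≤ t ^ 2 ^ (l + 1) * (t ^ 2 ^ (l + 1) * frobMoment M l) := by gcongr
    _ = _ := by rw [← mul_assoc, ← pow_add]; congr 2; ring

/-- The moments are bounded in terms of the operator norm. -/
theorem frobMoment_le (M : Matrix ι ι ℝ) {K : ℝ} (hK : 0 ≤ K)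
    (h1 : ∀ y, (M *ᵥ y) ⬝ᵥ (M *ᵥ y) ≤ K * (y ⬝ᵥ y))
    (h2 : ∀ y, (Mᵀ *ᵥ y) ⬝ᵥ (Mᵀ *ᵥ y) ≤ K * (y ⬝ᵥ y)) (l : ℕ) :
    frobMoment M l ≤ Fintype.card ι * K ^ 2 ^ (l + 1) := by
  have h3 : ∀ (m : ℕ) (y : ι → ℝ),
      (((M * Mᵀ) ^ m) *ᵥ y) ⬝ᵥ (((M * Mᵀ) ^ m) *ᵥ y) ≤ K ^ (2 * m) * (y ⬝ᵥ y) := by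
    intro m
    induction m with
    | zero => simp
    | succ m ih =>
      intro y
      rw [pow_succ', ← mulVec_mulVec, ← mulVec_mulVec]
      calc _ ≤ K * (K * (((M * Mᵀ) ^ m) *ᵥ y ⬝ᵥ ((M * Mᵀ) ^ m) *ᵥ y)) :=
            (h1 _).trans (mul_le_mul_of_nonneg_left (h2 _) hK)
        _ ≤ K * (K * (K ^ (2 * m) * (y ⬝ᵥ y))) := by gcongr; exact ih y
        _ = _ := by ring
  -- column by column: the columns are the images of the unit vectors
  rw [frobMoment, Finset.sum_comm]
  calc _ ≤ ∑ B : ι, K ^ 2 ^ (l + 1) := Finset.sum_le_sum fun B _ => by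
        have := h3 (2 ^ l) (Pi.single B 1)
        simpa [dotProduct, ← sq, ← pow_succ', Pi.single_apply] using this
    _ = _ := by simp

/-- A crude bound for the moments in terms of the size of the entries. -/
theorem frobMoment_le_of_abs_le (M : Matrix ι ι ℝ) {b : ℝ} (hb : ∀ A B, |M A B| ≤ b) (l : ℕ) :
    frobMoment M l ≤ Fintype.card ι * ((Fintype.card ι * b) ^ 2) ^ 2 ^ (l + 1) := by
  have h : ∀ (M : Matrix ι ι ℝ), (∀ A B, |M A B| ≤ b) → ∀ y,
      (M *ᵥ y) ⬝ᵥ (M *ᵥ y) ≤ (Fintype.card ι * b) ^ 2 * (y ⬝ᵥ y) := by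
    intro M hb y
    have h1 : ∀ A, (M *ᵥ y) A * (M *ᵥ y) A ≤ Fintype.card ι * b ^ 2 * (y ⬝ᵥ y) := by
      intro A
      rw [← sq]
      refine (dotProduct_sq_le _ _).trans ?_
      refine mul_le_mul_of_nonneg_right ?_ (dotProduct_self_nonneg' y)
      calc M A ⬝ᵥ M A ≤ ∑ _B : ι, b ^ 2 := Finset.sum_le_sum fun B _ => by
            rw [← sq]; exact sq_le_sq' (abs_le.1 (hb A B)).1 (abs_le.1 (hb A B)).2
        _ = _ := by simp
    calc (M *ᵥ y) ⬝ᵥ (M *ᵥ y) ≤ ∑ _A : ι, Fintype.card ι * b ^ 2 * (y ⬝ᵥ y) :=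
          Finset.sum_le_sum fun A _ => h1 A
      _ = _ := by simp; ring
  exact frobMoment_le M (sq_nonneg _) (h M hb) (h Mᵀ fun A B => hb B A) l

/-! ### From sums over rectangles to the operator norm -/

/-- `X a` is the set of the indices `i` for which the binary digit of `u i` at the position `a` is `1`. -/
theorem exists_binary_digits (L : ℕ) (u : ι → ℕ) (hu : ∀ i, u i < 2 ^ L) :
    ∃ X : ℕ → Finset ι, (∀ i, (u i : ℝ) = ∑ a ∈ Finset.range L, if i ∈ X a then (2 : ℝ) ^ a else 0) ∧
      ∑ a ∈ Finset.range L, (4 : ℝ) ^ a * (X a).card ≤ ∑ i, (u i : ℝ) ^ 2 := by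
  classical
  have hd : ∀ (L m : ℕ), m % 2 ^ L = ∑ a ∈ Finset.range L, if m / 2 ^ a % 2 = 1 then 2 ^ a else 0 := by
    intro L m
    induction L with
    | zero => simp [Nat.mod_one]
    | succ L ih =>
      rw [Nat.mod_pow_succ, Finset.sum_range_succ, ← ih]
      rcases Nat.mod_two_eq_zero_or_one (m / 2 ^ L) with h | h <;> simp [h]
  have hu' : ∀ i, (u i : ℝ) =
      ∑ a ∈ Finset.range L, if u i / 2 ^ a % 2 = 1 then (2 : ℝ) ^ a else 0 := fun i => by
    have := hd L (u i)
    rw [Nat.mod_eq_of_lt (hu i)] at this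
    conv_lhs => rw [this]
    push_cast
    rfl
  refine ⟨fun a => Finset.univ.filter fun i => u i / 2 ^ a % 2 = 1, by simpa using hu', ?_⟩
  have h2 : ∀ i, ∑ a ∈ Finset.range L, (if u i / 2 ^ a % 2 = 1 then (4 : ℝ) ^ a else 0) ≤
      (u i : ℝ) ^ 2 := fun i => by
    rw [hu' i]
    refine le_trans (le_of_eq ?_) (Finset.sum_sq_le_sq_sum_of_nonneg fun a _ => ?_)
    · refine Finset.sum_congr rfl fun a _ => ?_
      split_ifs
      · rw [← pow_mul, mul_comm, pow_mul]; norm_num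
      · simp
    · positivity
  refine le_trans (le_of_eq ?_) (Finset.sum_le_sum fun i _ => h2 i)
  rw [Finset.sum_comm]
  refine Finset.sum_congr rfl fun a _ => ?_
  rw [← Finset.sum_filter]
  simp [mul_comm]

omit [DecidableEq ι] in
/-- For vectors of natural numbers with `L` binary digits, the passage from sums over rectangles to
the bilinear form costs a factor `L`. -/
theorem abs_sum_natCast_le (M : Matrix ι ι ℝ) {κ : ℝ} (hκ : 0 ≤ κ)
    (hM : ∀ X Y : Finset ι, |∑ i ∈ X, ∑ j ∈ Y, M i j| ≤ κ * √((X.card : ℝ) * Y.card)) (L : ℕ)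
    (u w : ι → ℕ) (hu : ∀ i, u i < 2 ^ L) (hw : ∀ i, w i < 2 ^ L) :
    |∑ i, ∑ j, (u i : ℝ) * M i j * w j| ≤
      κ * L * (√(∑ i, (u i : ℝ) ^ 2) * √(∑ i, (w i : ℝ) ^ 2)) := by
  classical
  obtain ⟨X, hX, hXu⟩ := exists_binary_digits L u hu
  obtain ⟨Y, hY, hYw⟩ := exists_binary_digits L w hw
  have hsum : ∑ i, ∑ j, (u i : ℝ) * M i j * w j = ∑ a ∈ Finset.range L, ∑ b ∈ Finset.range L,
      (2 : ℝ) ^ a * 2 ^ b * ∑ i ∈ X a, ∑ j ∈ Y b, M i j := by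
    have h1 : ∀ a b, (2 : ℝ) ^ a * 2 ^ b * ∑ i ∈ X a, ∑ j ∈ Y b, M i j =
        ∑ i, ∑ j, (if i ∈ X a then (2 : ℝ) ^ a else 0) * M i j * (if j ∈ Y b then 2 ^ b else 0) := by
      intro a b
      have h2 : ∀ i, ∑ j, (if i ∈ X a then (2 : ℝ) ^ a else 0) * M i j *
          (if j ∈ Y b then 2 ^ b else 0) =
          if i ∈ X a then ∑ j ∈ Y b, 2 ^ a * 2 ^ b * M i j else 0 := fun i => by
        split_ifs
        · simp only [mul_ite, mul_zero, Finset.sum_ite_mem, Finset.univ_inter]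
          exact Finset.sum_congr rfl fun j _ => by ring
        · simp
      simp only [h2, Finset.sum_ite_mem, Finset.univ_inter, Finset.mul_sum]
    have h3 : ∀ i j, (u i : ℝ) * M i j * w j = ∑ a ∈ Finset.range L, ∑ b ∈ Finset.range L,
        (if i ∈ X a then (2 : ℝ) ^ a else 0) * M i j * (if j ∈ Y b then 2 ^ b else 0) :=
      fun i j => by rw [hX, hY, Finset.sum_mul, Finset.sum_mul_sum]
    rw [Finset.sum_congr rfl fun i _ => Finset.sum_congr rfl fun j _ => h3 i j,
      Finset.sum_congr rfl fun a _ => Finset.sum_congr rfl fun b _ => h1 a b,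
      Finset.sum_congr rfl fun i _ => Finset.sum_comm, Finset.sum_comm]
    refine Finset.sum_congr rfl fun a _ => ?_
    rw [Finset.sum_congr rfl fun i _ => Finset.sum_comm, Finset.sum_comm]
  -- the Cauchy–Schwarz inequality for the sum over the `L` positions
  have hS : ∀ (X : ℕ → Finset ι) (S : ℝ), ∑ a ∈ Finset.range L, (4 : ℝ) ^ a * (X a).card ≤ S →
      ∑ a ∈ Finset.range L, (2 : ℝ) ^ a * √((X a).card : ℝ) ≤ √L * √S := by
    intro X S hS
    rw [← Real.sqrt_mul (by positivity)]
    refine Real.le_sqrt_of_sq_le ?_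
    refine (sq_sum_le_card_mul_sum_sq).trans ?_
    simp only [Finset.card_range]
    refine mul_le_mul_of_nonneg_left (le_trans (le_of_eq ?_) hS) (by positivity)
    refine Finset.sum_congr rfl fun a _ => ?_
    rw [mul_pow, Real.sq_sqrt (by positivity), ← pow_mul, mul_comm a, pow_mul]
    norm_num
  rw [hsum]
  calc _ ≤ ∑ a ∈ Finset.range L, ∑ b ∈ Finset.range L,
        (2 : ℝ) ^ a * 2 ^ b * (κ * √((X a).card * (Y b).card)) := by
        refine (Finset.abs_sum_le_sum_abs _ _).trans (Finset.sum_le_sum fun a _ => ?_)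
        refine (Finset.abs_sum_le_sum_abs _ _).trans (Finset.sum_le_sum fun b _ => ?_)
        rw [abs_mul, abs_of_nonneg (by positivity : (0 : ℝ) ≤ 2 ^ a * 2 ^ b)]
        gcongr
        exact hM _ _
    _ = κ * ((∑ a ∈ Finset.range L, (2 : ℝ) ^ a * √((X a).card : ℝ)) *
        ∑ b ∈ Finset.range L, (2 : ℝ) ^ b * √((Y b).card : ℝ)) := by
        rw [Finset.sum_mul_sum, Finset.mul_sum]
        refine Finset.sum_congr rfl fun a _ => ?_
        rw [Finset.mul_sum]
        refine Finset.sum_congr rfl fun b _ => ?_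
        rw [Real.sqrt_mul (by positivity)]
        ring
    _ ≤ κ * ((√L * √(∑ i, (u i : ℝ) ^ 2)) * (√L * √(∑ i, (w i : ℝ) ^ 2))) := by
        exact mul_le_mul_of_nonneg_left (mul_le_mul (hS X _ hXu) (hS Y _ hYw)
          (Finset.sum_nonneg fun b _ => mul_nonneg (pow_nonneg zero_le_two _) (Real.sqrt_nonneg _))
          (mul_nonneg (Real.sqrt_nonneg _) (Real.sqrt_nonneg _))) hκ
    _ = _ := by
        rw [mul_mul_mul_comm, Real.mul_self_sqrt (Nat.cast_nonneg L), mul_assoc]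

omit [DecidableEq ι] in
/-- The passage from sums over rectangles to the bilinear form, for unit vectors: `x` and `y` are
rounded to multiples of `2 ^ (-L)`. -/
theorem abs_dotProduct_mulVec_le_of_unit (M : Matrix ι ι ℝ) {κ : ℝ} (hκ : 0 ≤ κ)
    (hM : ∀ X Y : Finset ι, |∑ i ∈ X, ∑ j ∈ Y, M i j| ≤ κ * √((X.card : ℝ) * Y.card)) {L : ℕ}
    (hL : Fintype.card ι ^ 2 ≤ 2 ^ L) (x y : ι → ℝ) (hx : x ⬝ᵥ x = 1) (hy : y ⬝ᵥ y = 1) :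
    |x ⬝ᵥ M *ᵥ y| ≤ κ * (4 * (L + 1) + 2) := by
  have hentry : ∀ i j, |M i j| ≤ κ := fun i j => by simpa using hM {i} {j}
  have habs : ∀ z : ι → ℝ, z ⬝ᵥ z = 1 → ∀ i, |z i| ≤ 1 := fun z hz i => by
    rw [← sq_le_one_iff_abs_le_one, ← hz, sq]
    exact Finset.single_le_sum (f := fun i => z i * z i) (fun i _ => mul_self_nonneg _)
      (Finset.mem_univ i)
  -- the nonnegative part of `2 ^ L * z`, rounded down
  let rd : (ι → ℝ) → ι → ℕ := fun z i => ⌊2 ^ L * max (z i) 0⌋₊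
  have hrd_lt : ∀ z : ι → ℝ, z ⬝ᵥ z = 1 → ∀ i, rd z i < 2 ^ (L + 1) := fun z hz i => by
    rw [Nat.floor_lt (by positivity)]
    have h1 : max (z i) 0 ≤ 1 := max_le ((le_abs_self _).trans (habs z hz i)) zero_le_one
    have h2 : (0 : ℝ) < 2 ^ L := by positivity
    push_cast
    rw [pow_succ]
    nlinarith
  have hrd_le : ∀ (z : ι → ℝ) i, (rd z i : ℝ) ≤ 2 ^ L * max (z i) 0 := fun z i =>
    Nat.floor_le (by positivity)
  have hrd_gt : ∀ (z : ι → ℝ) i, 2 ^ L * max (z i) 0 - 1 ≤ (rd z i : ℝ) := fun z i =>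
    (Nat.sub_one_lt_floor _).le
  have hrd_sq : ∀ z : ι → ℝ, z ⬝ᵥ z = 1 → √(∑ i, (rd z i : ℝ) ^ 2) ≤ 2 ^ L := fun z hz => by
    refine Real.sqrt_le_iff.2 ⟨by positivity, ?_⟩
    calc ∑ i, (rd z i : ℝ) ^ 2 ≤ ∑ i, (2 ^ L) ^ 2 * (z i * z i) := Finset.sum_le_sum fun i _ => by
          calc (rd z i : ℝ) ^ 2 ≤ (2 ^ L * max (z i) 0) ^ 2 := by gcongr; exact hrd_le z i
            _ = (2 ^ L) ^ 2 * (max (z i) 0) ^ 2 := by ring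
            _ ≤ (2 ^ L) ^ 2 * (z i * z i) := by
              gcongr
              rcases le_total (z i) 0 with h | h
              · rw [max_eq_right h]; nlinarith
              · rw [max_eq_left h, sq]
      _ = (2 ^ L) ^ 2 := by
          rw [← Finset.mul_sum]
          have : ∑ i, z i * z i = 1 := hz
          rw [this, mul_one]
  have hneg : ∀ z : ι → ℝ, z ⬝ᵥ z = 1 → (-z) ⬝ᵥ (-z) = 1 := fun z hz => by simpa using hz
  have hform : ∀ z z' : ι → ℝ, z ⬝ᵥ z = 1 → z' ⬝ᵥ z' = 1 →
      |∑ i, ∑ j, (rd z i : ℝ) * M i j * rd z' j| ≤ κ * (L + 1) * (2 ^ L * 2 ^ L) := by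
    intro z z' hz hz'
    have := abs_sum_natCast_le M hκ hM (L + 1) (rd z) (rd z') (hrd_lt z hz) (hrd_lt z' hz')
    push_cast at this
    refine this.trans ?_
    gcongr
    · exact hrd_sq z hz
    · exact hrd_sq z' hz'
  -- `z`, rounded towards zero to a multiple of `2 ^ (-L)`
  let v : (ι → ℝ) → ι → ℝ := fun z i => ((rd z i : ℝ) - rd (-z) i) / 2 ^ L
  have hp : (0 : ℝ) < 2 ^ L := by positivity
  have hsplit : ∀ z : ι → ℝ, ∀ i, z i = max (z i) 0 - max (-z i) 0 := fun z i => by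
    rcases le_total (z i) 0 with h | h
    · rw [max_eq_right h, max_eq_left (by linarith)]; ring
    · rw [max_eq_left h, max_eq_right (by linarith)]; ring
  have hv_err : ∀ (z : ι → ℝ) i, |z i - v z i| ≤ 1 / 2 ^ L := fun z i => by
    have e : z i - v z i = (2 ^ L * z i - ((rd z i : ℝ) - rd (-z) i)) / 2 ^ L := by
      simp only [v]; field_simp
    rw [e, abs_div, abs_of_pos hp]
    gcongr
    have h1 := hrd_le z i
    have h2 := hrd_gt z i
    have h3 := hrd_le (-z) i
    have h4 := hrd_gt (-z) i
    simp only [Pi.neg_apply] at h3 h4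
    rw [abs_le]
    rw [hsplit z i]
    rcases le_total (z i) 0 with h | h
    · simp only [max_eq_right h, max_eq_left (neg_nonneg.2 h)] at *
      constructor <;> nlinarith [Nat.cast_nonneg (α := ℝ) (rd z i)]
    · simp only [max_eq_left h, max_eq_right (neg_nonpos.2 h)] at *
      constructor <;> nlinarith [Nat.cast_nonneg (α := ℝ) (rd (-z) i)]
  have hv_abs : ∀ z : ι → ℝ, z ⬝ᵥ z = 1 → ∀ i, |v z i| ≤ 1 := fun z hz i => by
    have h1 := hrd_le z i
    have h3 := hrd_le (-z) i
    have h5 := abs_le.1 (habs z hz i)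
    simp only [Pi.neg_apply] at h3
    simp only [v]
    rw [abs_div, abs_of_pos hp, div_le_one hp, abs_le]
    have h6 : max (z i) 0 ≤ 1 := max_le h5.2 zero_le_one
    have h7 : max (-z i) 0 ≤ 1 := max_le (by linarith) zero_le_one
    constructor <;> nlinarith [Nat.cast_nonneg (α := ℝ) (rd z i),
      Nat.cast_nonneg (α := ℝ) (rd (-z) i)]
  -- rounding errors: the entries of `M` are at most `κ`, and there are at most `2 ^ L` of them
  have hsmall : ∀ a b : ι → ℝ, (∀ i j, |a i| * |b j| ≤ 1 / 2 ^ L) →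
      |a ⬝ᵥ M *ᵥ b| ≤ κ := by
    intro a b hab
    have e : a ⬝ᵥ M *ᵥ b = ∑ i, ∑ j, a i * (M i j * b j) := by
      simp [dotProduct, mulVec, Finset.mul_sum]
    rw [e]
    calc _ ≤ ∑ _i : ι, ∑ _j : ι, κ * (1 / 2 ^ L) := by
          refine (Finset.abs_sum_le_sum_abs _ _).trans (Finset.sum_le_sum fun i _ => ?_)
          refine (Finset.abs_sum_le_sum_abs _ _).trans (Finset.sum_le_sum fun j _ => ?_)
          rw [abs_mul, abs_mul]
          calc |a i| * (|M i j| * |b j|) = |M i j| * (|a i| * |b j|) := by ring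
            _ ≤ _ := mul_le_mul (hentry i j) (hab i j) (by positivity) hκ
      _ = κ * ((Fintype.card ι : ℝ) ^ 2 / 2 ^ L) := by simp; ring
      _ ≤ κ * 1 := by
          gcongr
          rw [div_le_one hp]
          exact_mod_cast hL
      _ = κ := mul_one _
  have hmain : |v x ⬝ᵥ M *ᵥ v y| ≤ κ * (4 * (L + 1)) := by
    have e : v x ⬝ᵥ M *ᵥ v y = (∑ i, ∑ j, (rd x i : ℝ) * M i j * rd y j
        - ∑ i, ∑ j, (rd x i : ℝ) * M i j * rd (-y) j
        - ∑ i, ∑ j, (rd (-x) i : ℝ) * M i j * rd y j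
        + ∑ i, ∑ j, (rd (-x) i : ℝ) * M i j * rd (-y) j) / (2 ^ L * 2 ^ L) := by
      simp only [← Finset.sum_sub_distrib, ← Finset.sum_add_distrib, Finset.sum_div, dotProduct,
        mulVec, Finset.mul_sum, v]
      refine Finset.sum_congr rfl fun i _ => Finset.sum_congr rfl fun j _ => ?_
      field_simp
      ring
    rw [e, abs_div, abs_of_pos (by positivity : (0 : ℝ) < 2 ^ L * 2 ^ L), div_le_iff₀ (by positivity)]
    have h1 := abs_le.1 (hform x y hx hy)
    have h2 := abs_le.1 (hform x (-y) hx (hneg y hy))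
    have h3 := abs_le.1 (hform (-x) y (hneg x hx) hy)
    have h4 := abs_le.1 (hform (-x) (-y) (hneg x hx) (hneg y hy))
    rw [abs_le]
    constructor <;> linarith [h1.1, h1.2, h2.1, h2.2, h3.1, h3.2, h4.1, h4.2]
  have hdecomp : x ⬝ᵥ M *ᵥ y = (x - v x) ⬝ᵥ M *ᵥ y + v x ⬝ᵥ M *ᵥ (y - v y) + v x ⬝ᵥ M *ᵥ v y := by
    rw [sub_dotProduct, mulVec_sub, dotProduct_sub]; ring
  have he1 := hsmall (x - v x) y fun i j =>
    (mul_le_mul (hv_err x i) (habs y hy j) (abs_nonneg _) (by positivity)).trans_eq (mul_one _)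
  have he2 := hsmall (v x) (y - v y) fun i j =>
    (mul_le_mul (hv_abs x hx i) (hv_err y j) (abs_nonneg _) zero_le_one).trans_eq (one_mul _)
  rw [hdecomp]
  calc _ ≤ _ := abs_add_three _ _ _
    _ ≤ κ + κ + κ * (4 * (L + 1)) := by gcongr
    _ = _ := by ring

omit [DecidableEq ι] in
/-- If the sum of the entries over every rectangle `X × Y` is at most `κ * √(|X| |Y|)`, then the
operator norm is at most `κ` times a logarithm of the dimension. -/
theorem mulVec_dotProduct_self_le (M : Matrix ι ι ℝ) {κ : ℝ} (hκ : 0 ≤ κ)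
    (hM : ∀ X Y : Finset ι, |∑ i ∈ X, ∑ j ∈ Y, M i j| ≤ κ * √((X.card : ℝ) * Y.card)) {L : ℕ}
    (hL : Fintype.card ι ^ 2 ≤ 2 ^ L) (y : ι → ℝ) :
    (M *ᵥ y) ⬝ᵥ (M *ᵥ y) ≤ (κ * (4 * (L + 1) + 2)) ^ 2 * (y ⬝ᵥ y) := by
  set Q := κ * (4 * (L + 1) + 2) with hQ
  set x := M *ᵥ y with hx
  have hx0 := dotProduct_self_nonneg' x
  have hy0 := dotProduct_self_nonneg' y
  rcases hx0.eq_or_lt with h | hxp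
  · rw [← h]; positivity
  rcases hy0.eq_or_lt with h | hyp
  · have : y = 0 := dotProduct_self_eq_zero.1 h.symm
    rw [hx, this]; simp
  have hsx := Real.sqrt_pos.2 hxp
  have hsy := Real.sqrt_pos.2 hyp
  have h := abs_dotProduct_mulVec_le_of_unit M hκ hM hL ((√(x ⬝ᵥ x))⁻¹ • x) ((√(y ⬝ᵥ y))⁻¹ • y)
    (by
      rw [smul_dotProduct, dotProduct_smul, smul_eq_mul, smul_eq_mul, ← mul_assoc, ← mul_inv,
        Real.mul_self_sqrt hx0, inv_mul_cancel₀ hxp.ne'])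
    (by
      rw [smul_dotProduct, dotProduct_smul, smul_eq_mul, smul_eq_mul, ← mul_assoc, ← mul_inv,
        Real.mul_self_sqrt hy0, inv_mul_cancel₀ hyp.ne'])
  rw [mulVec_smul, smul_dotProduct, dotProduct_smul, smul_eq_mul, smul_eq_mul, ← hx, ← hQ] at h
  have h2 := (le_abs_self _).trans h
  have h3 : x ⬝ᵥ x ≤ Q * (√(x ⬝ᵥ x) * √(y ⬝ᵥ y)) := by
    have := mul_le_mul_of_nonneg_right h2 (mul_pos hsx hsy).le
    refine le_trans (le_of_eq ?_) this
    field_simp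
  have h4 : √(x ⬝ᵥ x) ≤ Q * √(y ⬝ᵥ y) := by
    have h5 : √(x ⬝ᵥ x) * √(x ⬝ᵥ x) ≤ √(x ⬝ᵥ x) * (Q * √(y ⬝ᵥ y)) := by
      rw [Real.mul_self_sqrt hx0]; linarith
    exact le_of_mul_le_mul_left h5 hsx
  calc x ⬝ᵥ x = √(x ⬝ᵥ x) ^ 2 := (Real.sq_sqrt hx0).symm
    _ ≤ (Q * √(y ⬝ᵥ y)) ^ 2 := by gcongr
    _ = _ := by rw [mul_pow, Real.sq_sqrt hy0]

/-- The bound for the moments that follows from bounds for sums over rectangles. -/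
theorem frobMoment_le_of_rectangles (M : Matrix ι ι ℝ) {κ : ℝ} (hκ : 0 ≤ κ)
    (hM : ∀ X Y : Finset ι, |∑ i ∈ X, ∑ j ∈ Y, M i j| ≤ κ * √((X.card : ℝ) * Y.card)) {L : ℕ}
    (hL : Fintype.card ι ^ 2 ≤ 2 ^ L) (l : ℕ) :
    frobMoment M l ≤ Fintype.card ι * (κ * (4 * (L + 1) + 2)) ^ 2 ^ (l + 2) := by
  refine (frobMoment_le M (sq_nonneg _) (mulVec_dotProduct_self_le M hκ hM hL)
    (mulVec_dotProduct_self_le Mᵀ hκ (fun X Y => ?_) hL) l).trans_eq ?_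
  · simp only [transpose_apply]
    rw [Finset.sum_comm, mul_comm (X.card : ℝ)]
    exact hM Y X
  · rw [← pow_mul, ← pow_succ']

end LinearAlgebra

/-! ### Codes of tuples -/

section Codes

variable {n m : ℕ}

theorem dig_lt (hn : 0 < n) (c j : ℕ) : dig n c j < n := Nat.mod_lt _ hn

theorem dig_add_of_lt {c j : ℕ} (b : ℕ) (hj : j < m) : dig n (c + n ^ m * b) j = dig n c j := by
  obtain ⟨r, rfl⟩ := Nat.exists_eq_add_of_lt hj
  rcases Nat.eq_zero_or_pos n with rfl | hn
  · simp [dig]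
  unfold dig
  have : n ^ (j + r + 1) * b = n ^ j * (n * (n ^ r * b)) := by ring
  rw [this, Nat.add_mul_div_left _ _ (by positivity), Nat.add_mul_mod_self_left]

theorem dig_add_of_le {c : ℕ} (hc : c < n ^ m) (b j : ℕ) :
    dig n (c + n ^ m * b) (m + j) = dig n b j := by
  unfold dig
  rw [pow_add, ← Nat.div_div_eq_div_mul, Nat.add_mul_div_left _ _ (by omega),
    Nat.div_eq_of_lt hc, zero_add]

theorem dig_zero_of_lt {b : ℕ} (hb : b < n) : dig n b 0 = b := by
  simp [dig, Nat.mod_eq_of_lt hb]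

theorem exists_code (f : ℕ → ℕ) (hf : ∀ j < m, f j < n) :
    ∃ c < n ^ m, ∀ j < m, dig n c j = f j := by
  rcases Nat.eq_zero_or_pos m with rfl | hm
  · exact ⟨0, by simp, by simp⟩
  have hn : 0 < n := (Nat.zero_le _).trans_lt (hf 0 hm)
  have hg : ∀ j, (if j < m then f j else 0) < n := fun j => by
    split_ifs with h
    exacts [hf j h, hn]
  refine ⟨_, CliqueInput.encode_lt_aux n _ hg m, fun j hj => ?_⟩
  rw [dig, CliqueInput.sum_digits_div_mod n hn _ hg m j hj, if_pos hj]

theorem code_ext {c c' : ℕ} (hc : c < n ^ m) (hc' : c' < n ^ m)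
    (h : ∀ j < m, dig n c j = dig n c' j) : c = c' := by
  induction m generalizing c c' with
  | zero => simp at hc hc'; omega
  | succ m ih =>
    have h0 := h 0 (by omega)
    simp only [dig, pow_zero, Nat.div_one] at h0
    have h1 : c / n = c' / n := by
      refine ih (Nat.div_lt_of_lt_mul (by rwa [← pow_succ'])) (Nat.div_lt_of_lt_mul
        (by rwa [← pow_succ'])) fun j hj => ?_
      have := h (j + 1) (by omega)
      simp only [dig, pow_succ'] at this ⊢
      rwa [Nat.div_div_eq_div_mul, Nat.div_div_eq_div_mul]
    rw [← Nat.div_add_mod c n, ← Nat.div_add_mod c' n, h0, h1]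

theorem Incr.lt {c : ℕ} (h : Incr n m c) {a b : ℕ} (hab : a < b) (hb : b < m) :
    dig n c a < dig n c b := by
  induction b with
  | zero => omega
  | succ b ih =>
    have h1 := h b (by omega)
    rcases Nat.lt_succ_iff_lt_or_eq.1 hab with h2 | rfl
    · exact (ih h2 (by omega)).trans h1
    · exact h1

/-- The set of the first `m` digits. -/
def digSet (n m c : ℕ) : Finset ℕ := (Finset.range m).image (dig n c)

theorem mem_digSet {c x : ℕ} : x ∈ digSet n m c ↔ ∃ j < m, dig n c j = x := by
  simp [digSet]

theorem Incr.injOn {c : ℕ} (h : Incr n m c) : Set.InjOn (dig n c) (Finset.range m : Set ℕ) := by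
  intro a ha b hb hab
  simp only [Finset.coe_range, Set.mem_Iio] at ha hb
  rcases lt_trichotomy a b with h1 | h1 | h1
  · exact absurd hab (h.lt h1 hb).ne
  · exact h1
  · exact absurd hab (h.lt h1 ha).ne'

theorem Incr.card_digSet {c : ℕ} (h : Incr n m c) : (digSet n m c).card = m := by
  rw [digSet, Finset.card_image_of_injOn h.injOn, Finset.card_range]

/-- A strictly increasing tuple is determined by the set of its entries. -/
theorem Incr.ext {c c' : ℕ} (h : Incr n m c) (h' : Incr n m c') (hc : c < n ^ m) (hc' : c' < n ^ m)
    (hs : digSet n m c = digSet n m c') : c = c' := by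
  have hmono : ∀ {c}, Incr n m c → StrictMono fun j : Fin m => dig n c j :=
    fun h a b hab => h.lt hab b.2
  have hrange : ∀ c, Set.range (fun j : Fin m => dig n c j) = (digSet n m c : Set ℕ) := fun c => by
    ext x
    simp only [Set.mem_range, Finset.mem_coe, mem_digSet]
    exact ⟨fun ⟨j, hj⟩ => ⟨j, j.2, hj⟩, fun ⟨j, hj, e⟩ => ⟨⟨j, hj⟩, e⟩⟩
  have := (hmono h).range_inj (hmono h') |>.1 (by rw [hrange, hrange, hs])
  exact code_ext hc hc' fun j hj => congrFun this ⟨j, hj⟩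

/-- Every set of vertices is the set of entries of a strictly increasing tuple. -/
theorem exists_incr_code {U : Finset ℕ} (hU : ∀ u ∈ U, u < n) (hm : U.card = m) :
    ∃ c < n ^ m, Incr n m c ∧ digSet n m c = U := by
  let f : ℕ → ℕ := fun j => if hj : j < m then U.orderEmbOfFin hm ⟨j, hj⟩ else 0
  have hfU : ∀ j < m, f j ∈ U := fun j hj => by
    simp only [f, dif_pos hj]; exact Finset.orderEmbOfFin_mem _ _ _
  obtain ⟨c, hc, hcf⟩ := exists_code (n := n) (m := m) f fun j hj => hU _ (hfU j hj)
  have hinc : Incr n m c := fun j hj => by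
    rw [hcf j (by omega), hcf (j + 1) (by omega)]
    simp only [f, dif_pos (show j < m by omega), dif_pos (show j + 1 < m by omega)]
    exact (U.orderEmbOfFin hm).strictMono (by simp)
  refine ⟨c, hc, hinc, Finset.eq_of_subset_of_card_le (fun x hx => ?_) ?_⟩
  · obtain ⟨j, hj, rfl⟩ := mem_digSet.1 hx
    rw [hcf j hj]; exact hfU j hj
  · rw [hm, hinc.card_digSet]

theorem digSet_add {c b : ℕ} (hc : c < n ^ m) (hb : b < n) :
    digSet n (m + 1) (c + n ^ m * b) = insert b (digSet n m c) := by
  rw [digSet, Finset.range_add_one, Finset.image_insert]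
  congr 1
  · have := dig_add_of_le hc b 0
    rw [add_zero] at this
    rw [this, dig_zero_of_lt hb]
  · exact Finset.image_congr fun j hj => dig_add_of_lt b (by simpa using hj)

end Codes

/-! ### Hyperedges as sets of numbers -/

/-- The set `U` of numbers is a hyperedge. -/
def UniformHypergraph.Has {n k : ℕ} (H : UniformHypergraph n k) (U : Finset ℕ) : Prop :=
  ∃ e ∈ H, e.1.image (fun i : Fin n => (i : ℕ)) = U

theorem UniformHypergraph.IsClique.has {n k : ℕ} {H : UniformHypergraph n k} {S : Finset (Fin n)}
    (hS : H.IsClique S) {U : Finset ℕ} (hU : U ⊆ S.image fun i : Fin n => (i : ℕ))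
    (hk : U.card = k) : H.Has U := by
  obtain ⟨e, he, rfl⟩ := Finset.subset_image_iff.1 hU
  have hc : e.card = k := by
    rwa [Finset.card_image_of_injective _ Fin.val_injective] at hk
  exact ⟨⟨e, hc⟩, hS ⟨e, hc⟩ (by exact_mod_cast he), rfl⟩

/-- The set of vertices that is queried for `U` and `v`: a hyperedge of the link of `v` is completed
by `v` if `k` is odd. -/
def linkSet (k v : ℕ) (U : Finset ℕ) : Finset ℕ := if Even k then U else insert v U

namespace CliqueInput

variable (i : CliqueInput)

theorem edgeBit_eq_one_iff {n k : ℕ} (H : UniformHypergraph n k) (v : ℕ → ℕ) :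
    H.edgeBit v = 1 ↔ H.Has ((Finset.range k).image v) := by
  unfold UniformHypergraph.edgeBit UniformHypergraph.Has
  split_ifs with h
  · simpa using h
  · simpa using h

theorem query_le_one (c : ℕ) : i.query c ≤ 1 := by
  unfold query UniformHypergraph.edgeBit; split_ifs <;> omega

/-- A query reads `k` digits, so it reads the digit `v` at the position `2h` only if `k` is odd. -/
theorem query_eq_one_iff {c v : ℕ} (hc : c < i.n ^ (2 * i.h)) (hv : v < i.n) :
    i.query (c + i.n ^ (2 * i.h) * v) = 1 ↔ i.H.Has (linkSet i.k v (digSet i.n (2 * i.h) c)) := by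
  rw [query, edgeBit_eq_one_iff]
  have : (Finset.range i.k).image (fun j => (c + i.n ^ (2 * i.h) * v) / i.n ^ j % i.n) =
      linkSet i.k v (digSet i.n (2 * i.h) c) := by
    unfold linkSet
    split_ifs with hk
    · have hk2 : i.k = 2 * i.h := by obtain ⟨r, hr⟩ := hk; unfold h; omega
      rw [hk2, digSet]
      exact Finset.image_congr fun j hj => dig_add_of_lt v (by simpa using hj)
    · have hk2 : i.k = 2 * i.h + 1 := by
        obtain ⟨r, hr⟩ := Nat.not_even_iff_odd.1 hk; unfold h; omega
      rw [hk2, ← digSet_add hc hv]; rfl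
  rw [this]

theorem card_linkSet {k v : ℕ} {U : Finset ℕ} (hU : U.card = 2 * (k / 2)) (hv : v ∉ U) :
    (linkSet k v U).card = k := by
  unfold linkSet
  split_ifs with hk
  · obtain ⟨r, hr⟩ := hk; omega
  · rw [Finset.card_insert_of_notMem hv]
    obtain ⟨r, hr⟩ := Nat.not_even_iff_odd.1 hk; omega

theorem linkSet_subset {k v : ℕ} (U : Finset ℕ) : linkSet k v U ⊆ insert v U := by
  unfold linkSet
  split_ifs
  · exact Finset.subset_insert _ _
  · exact subset_rfl

/-! ### The moments computed by the algorithm -/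

theorem pNum_le : i.pNum ≤ 2 ^ i.N := by
  unfold pNum
  refine Nat.floor_le_of_le ?_
  have := i.p.2.2
  have h2 : (0 : ℝ) < 2 ^ i.N := by positivity
  push_cast
  nlinarith

open Classical in
/-- The scaled, centred adjacency matrix of the hypergraph that `v` and `D` determine: rows and
columns are indexed by codes of `h`-tuples. -/
noncomputable def mat (v D : ℕ) : Matrix (Fin i.N) (Fin i.N) ℤ := fun A B =>
  if i.Admissible v D (A + i.N * B) then
    2 ^ i.N * i.query (A + i.N * B + i.n ^ (2 * i.h) * v) - i.pNum else 0

theorem pNum_le_R : i.pNum ≤ i.R := by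
  refine i.pNum_le.trans (Nat.pow_le_pow_right (by omega) ?_)
  nlinarith

theorem entry_modEq (v D : ℕ) (A B : Fin i.N) :
    (i.entry v D (A + i.N * B) : ℤ) ≡ i.mat v D A B [ZMOD i.R] := by
  unfold entry mat
  split_ifs
  · rw [Int.modEq_iff_dvd]
    push_cast [Nat.cast_sub i.pNum_le_R]
    exact ⟨-1, by ring⟩
  · rfl

theorem sum_modEq {ι : Type*} {s : Finset ι} {f g : ι → ℤ} {R : ℤ}
    (h : ∀ x ∈ s, f x ≡ g x [ZMOD R]) : ∑ x ∈ s, f x ≡ ∑ x ∈ s, g x [ZMOD R] := by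
  classical
  induction s using Finset.induction_on with
  | empty => rfl
  | insert a s ha ih =>
    rw [Finset.sum_insert ha, Finset.sum_insert ha]
    exact (h a (by simp)).add (ih fun x hx => h x (by simp [hx]))

open Matrix

theorem gramPow_modEq (v D l : ℕ) (A B : Fin i.N) :
    (i.decode (i.gramPow v D l) A B : ℤ) ≡
      ((i.mat v D * (i.mat v D)ᵀ) ^ 2 ^ l) A B [ZMOD i.R] := by
  induction l generalizing A B with
  | zero =>
    rw [gramPow, decode_encode _ _ A.2 B.2, pow_zero, pow_one, mul_apply]
    push_cast
    refine (Int.mod_modEq _ _).trans ?_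
    rw [Finset.sum_range]
    exact sum_modEq fun C _ => (i.entry_modEq v D A C).mul (i.entry_modEq v D B C)
  | succ l ih =>
    rw [gramPow, decode_encode _ _ A.2 B.2, pow_succ 2 l, pow_mul, sq, mul_apply]
    push_cast
    refine (Int.mod_modEq _ _).trans ?_
    rw [Finset.sum_range]
    exact sum_modEq fun C _ => (ih A C).mul (ih C B)

theorem moment_modEq (v D : ℕ) :
    (i.moment v D : ℤ) ≡ frobMoment (i.mat v D) i.N.size [ZMOD i.R] := by
  rw [moment]
  push_cast
  refine (Int.mod_modEq _ _).trans ?_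
  rw [Finset.sum_range, frobMoment]
  refine sum_modEq fun A _ => ?_
  rw [Finset.sum_range]
  exact sum_modEq fun B _ => (i.gramPow_modEq v D _ A B).pow 2

theorem abs_mat_le (v D : ℕ) (A B : Fin i.N) : |i.mat v D A B| ≤ 2 ^ i.N := by
  unfold mat
  have h1 := i.query_le_one (A + i.N * B + i.n ^ (2 * i.h) * v)
  have h2 : (i.pNum : ℤ) ≤ 2 ^ i.N := by exact_mod_cast i.pNum_le
  split_ifs
  · interval_cases i.query (A + i.N * B + i.n ^ (2 * i.h) * v)
    · simpa using h2
    · rw [abs_of_nonneg (by push_cast; linarith)]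
      push_cast
      linarith [Int.natCast_nonneg i.pNum]
  · simp

/-- The adjacency matrix with real entries. -/
noncomputable def matR (v D : ℕ) : Matrix (Fin i.N) (Fin i.N) ℝ := (i.mat v D).map (Int.cast)

theorem frobMoment_matR (v D l : ℕ) :
    frobMoment (i.matR v D) l = (frobMoment (i.mat v D) l : ℤ) := by
  have h : (i.matR v D * (i.matR v D)ᵀ) ^ 2 ^ l =
      ((i.mat v D * (i.mat v D)ᵀ) ^ 2 ^ l).map (Int.castRingHom ℝ) := by
    rw [Matrix.map_pow, Matrix.map_mul, transpose_map]; rfl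
  simp [frobMoment, h]

/-- The moments do not exceed the modulus, because `2 ^ N.size ≤ 2N` and `N + 8N * 2N ≤ 17N²`. -/
theorem frobMoment_lt (v D : ℕ) : frobMoment (i.mat v D) i.N.size < i.R := by
  have h1 := frobMoment_le_of_abs_le (i.matR v D) (b := 2 ^ i.N)
    (fun A B => by
      have := i.abs_mat_le v D A B
      simp only [matR, map_apply]
      exact_mod_cast this) i.N.size
  rw [frobMoment_matR, Fintype.card_fin] at h1
  have h2 : frobMoment (i.mat v D) i.N.size ≤
      i.N * ((i.N * 2 ^ i.N) ^ 2) ^ 2 ^ (i.N.size + 1) := by exact_mod_cast h1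
  refine h2.trans_lt ?_
  have h3 : i.N * ((i.N * 2 ^ i.N) ^ 2) ^ 2 ^ (i.N.size + 1) < i.R := by
    rcases Nat.eq_zero_or_pos i.N with h0 | h0
    · rw [h0]; simpa using i.R_pos
    have h4 : i.N ≤ 2 ^ i.N := Nat.lt_two_pow_self.le
    calc i.N * ((i.N * 2 ^ i.N) ^ 2) ^ 2 ^ (i.N.size + 1)
        ≤ 2 ^ i.N * ((2 ^ i.N * 2 ^ i.N) ^ 2) ^ 2 ^ (i.N.size + 1) := by gcongr
      _ = 2 ^ (i.N + 8 * i.N * 2 ^ i.N.size) := by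
          rw [← pow_add, ← pow_mul, ← pow_mul, ← pow_add]; congr 1; ring
      _ < i.R := Nat.pow_lt_pow_right (by omega) ?_
    have := Nat.two_pow_size_le_of_pos h0
    nlinarith
  exact_mod_cast h3

/-- Computing modulo `R` does not change the moment. -/
theorem moment_eq (v D : ℕ) : (i.moment v D : ℝ) = frobMoment (i.matR v D) i.N.size := by
  have h := i.moment_modEq v D
  have h1 : (i.moment v D : ℤ) < i.R := by
    exact_mod_cast Nat.mod_lt _ i.R_pos
  rw [Int.ModEq, Int.emod_eq_of_lt (by positivity) h1, Int.emod_eq_of_lt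
    (a := frobMoment (i.mat v D) i.N.size) (Finset.sum_nonneg fun A _ => Finset.sum_nonneg fun B _ => sq_nonneg _)
    (i.frobMoment_lt v D)] at h
  rw [frobMoment_matR, ← h]; simp

/-! ### Completeness -/

/-- If `2 h q` vertices `e 0 < e 1 < …` in the common neighbourhood of `D` form a clique (in the link
of `v`, if `k` is odd), then `q` passes the test. The rows and columns of the certificate are the tuples with
one vertex in each of the first `h` blocks of length `q`, and in each of the next `h` blocks. -/
theorem passes_of_blocks {v D q : ℕ} (hh : 0 < i.h) {e : ℕ → ℕ} (hen : ∀ j < 2 * i.h * q, e j < i.n)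
    (hmono : ∀ a b, a < b → b < 2 * i.h * q → e a < e b)
    (hadm : ∀ c < i.n ^ (2 * i.h), Incr i.n (2 * i.h) c →
      (∀ j < 2 * i.h, ∃ l < 2 * i.h * q, dig i.n c j = e l) →
      i.Admissible v D c ∧ i.query (c + i.n ^ (2 * i.h) * v) = 1) :
    i.Passes v D q := by
  classical
  rcases Nat.eq_zero_or_pos q with rfl | hq
  · simp [Passes, hh.ne']
  let block : ℕ → Finset ℕ := fun t => (Finset.Ico (t * q) ((t + 1) * q)).image e
  have hlt : ∀ t < 2 * i.h, ∀ l < (t + 1) * q, l < 2 * i.h * q := fun t ht l hl =>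
    hl.trans_le (Nat.mul_le_mul_right q ht)
  have hcard : ∀ t < 2 * i.h, (block t).card = q := fun t ht => by
    rw [Finset.card_image_of_injOn]
    · simp [Nat.succ_mul]
    · intro a ha b hb hab
      simp only [Finset.coe_Ico, Set.mem_Ico] at ha hb
      rcases lt_trichotomy a b with h1 | h1 | h1
      · exact absurd hab (hmono a b h1 (hlt t ht b hb.2)).ne
      · exact h1
      · exact absurd hab (hmono b a h1 (hlt t ht a ha.2)).ne'
  -- the indicator of the tuples with one vertex in each of the blocks `s, s + 1, …, s + h - 1`
  let Xs : ℕ → Finset (Fin i.N) := fun s =>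
    Finset.univ.filter fun A => ∀ j < i.h, dig i.n A j ∈ block (s + j)
  have hXs : ∀ s, s + i.h ≤ 2 * i.h → (Xs s).card = q ^ i.h := fun s hs => by
    have h1 : (Fintype.piFinset fun j : Fin i.h =>
        Finset.univ.filter fun x : Fin i.n => (x : ℕ) ∈ block (s + j)).card = q ^ i.h := by
      rw [Fintype.card_piFinset]
      rw [Finset.prod_congr rfl (g := fun _ => q)]
      · simp
      · intro j _
        rw [← hcard (s + j) (by omega), ← Finset.card_image_of_injective _ Fin.val_injective]
        congr 1
        ext x
        simp only [Finset.mem_image, Finset.mem_filter, Finset.mem_univ, true_and]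
        constructor
        · rintro ⟨y, hy, rfl⟩; exact hy
        · intro hx
          obtain ⟨l, hl, rfl⟩ := Finset.mem_image.1 hx
          exact ⟨⟨e l, hen l (hlt (s + j) (by omega) l (Finset.mem_Ico.1 hl).2)⟩, hx, rfl⟩
    rw [← h1]
    refine (Finset.card_equiv (finFunctionFinEquiv (m := i.n) (n := i.h)) fun f => ?_).symm
    have h2 : ∀ j : Fin i.h, dig i.n (finFunctionFinEquiv f) j = f j := fun j =>
      congrArg Fin.val (congrFun (finFunctionFinEquiv.symm_apply_apply f) j)
    simp only [Fintype.mem_piFinset, Finset.mem_filter, Finset.mem_univ, true_and]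
    constructor
    · intro h
      refine Finset.mem_filter.2 ⟨Finset.mem_univ _, fun j hj => ?_⟩
      have := h ⟨j, hj⟩
      rwa [← h2 ⟨j, hj⟩] at this
    · intro h j
      rw [← h2 j]; exact (Finset.mem_filter.1 h).2 j j.2
  let x : Fin i.N → ℝ := fun A => if A ∈ Xs 0 then 1 else 0
  let y : Fin i.N → ℝ := fun A => if A ∈ Xs i.h then 1 else 0
  have hx : x ⬝ᵥ x = (q ^ i.h : ℕ) := by
    simp [x, dotProduct, hXs 0 (by omega)]
  have hy : y ⬝ᵥ y = (q ^ i.h : ℕ) := by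
    simp [y, dotProduct, hXs i.h (by omega)]
  have hM : ∀ A ∈ Xs 0, ∀ B ∈ Xs i.h, i.matR v D A B = ((2 ^ i.N - i.pNum : ℕ) : ℝ) := by
    intro A hA B hB
    simp only [Xs, Finset.mem_filter, Finset.mem_univ, true_and, zero_add] at hA hB
    have hN : i.N = i.n ^ i.h := rfl
    have hdig : ∀ j < 2 * i.h, dig i.n (A + i.N * B) j ∈ block j := fun j hj => by
      rcases lt_or_ge j i.h with h1 | h1
      · change dig i.n (A + i.n ^ i.h * B) j ∈ _
        rw [dig_add_of_lt _ h1]; exact hA j h1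
      · obtain ⟨r, rfl⟩ := Nat.exists_eq_add_of_le h1
        change dig i.n (A + i.n ^ i.h * B) (i.h + r) ∈ _
        rw [dig_add_of_le A.2]; exact hB r (by omega)
    have hinc : Incr i.n (2 * i.h) (A + i.N * B) := fun j hj => by
      obtain ⟨a, ha, hae⟩ := Finset.mem_image.1 (hdig j (by omega))
      obtain ⟨b, hb, hbe⟩ := Finset.mem_image.1 (hdig (j + 1) (by omega))
      rw [← hae, ← hbe]
      rw [Finset.mem_Ico] at ha hb
      exact hmono a b (ha.2.trans_le hb.1) (hlt (j + 1) (by omega) b hb.2)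
    have hlt' : (A : ℕ) + i.N * B < i.n ^ (2 * i.h) := by
      rw [two_mul, pow_add, ← hN]
      nlinarith [A.2, B.2]
    obtain ⟨h1, h2⟩ := hadm _ hlt' hinc fun j hj => by
      obtain ⟨a, ha, hae⟩ := Finset.mem_image.1 (hdig j hj)
      exact ⟨a, hlt j hj a (Finset.mem_Ico.1 ha).2, hae.symm⟩
    simp only [matR, map_apply, mat, if_pos h1, h2]
    push_cast [Nat.cast_sub i.pNum_le]
    ring
  have hform : x ⬝ᵥ (i.matR v D) *ᵥ y =
      ((2 ^ i.N - i.pNum : ℕ) : ℝ) * (q ^ i.h : ℕ) * (q ^ i.h : ℕ) := by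
    calc x ⬝ᵥ (i.matR v D) *ᵥ y = ∑ A ∈ Xs 0, ∑ B ∈ Xs i.h, i.matR v D A B := by
          simp [x, y, dotProduct, mulVec]
      _ = ∑ A ∈ Xs 0, ∑ B ∈ Xs i.h, ((2 ^ i.N - i.pNum : ℕ) : ℝ) :=
          Finset.sum_congr rfl fun A hA => Finset.sum_congr rfl fun B hB => hM A hA B hB
      _ = _ := by
          simp only [Finset.sum_const, hXs 0 (by omega), hXs i.h (by omega), nsmul_eq_mul]
          ring
  have ht : (0 : ℝ) < (q ^ i.h : ℕ) := by positivity
  have hmain := dotProduct_mulVec_pow_le_frobMoment (i.matR v D) x y ht hx hy i.N.size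
  rw [hform, mul_comm, mul_pow, ← moment_eq] at hmain
  have := le_of_mul_le_mul_left hmain (by positivity)
  unfold Passes
  exact_mod_cast this

theorem le_maxBlock {v D q : ℕ} (hv : v < i.n) (hD : D < i.n ^ i.d) (hg : i.GoodTuple v D)
    (hq : q ≤ i.n) (hp : i.Passes v D q) : q ≤ i.maxBlock := by
  classical
  unfold maxBlock
  refine le_trans ?_ (Finset.le_sup (Finset.mem_range.2 hv))
  refine le_trans ?_ (Finset.le_sup (Finset.mem_range.2 hD))
  rw [if_pos hg]
  refine le_trans ?_ (Finset.le_sup (Finset.mem_range.2 (Nat.lt_succ_of_le hq)))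
  rw [if_pos hp]

/-- In a larger clique choose `v`, then `D`, and divide the other vertices, in increasing order, into
`2h` blocks of equal length `q`, with a remainder of fewer than `2h` vertices. Then `q` passes the
test, and it is larger than `maxBlock`. -/
theorem card_le_of_isClique (hk : 2 ≤ i.k) {S : Finset (Fin i.n)} (hS : i.H.IsClique S) :
    S.card ≤ i.d + 1 + 2 * i.h * (1 + i.maxBlock) := by
  classical
  by_contra! hlt
  have hh : 0 < i.h := by unfold h; omega
  set S' := S.image fun j : Fin i.n => (j : ℕ) with hS'
  have hcS : S'.card = S.card := Finset.card_image_of_injective _ Fin.val_injective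
  have hSn : ∀ u ∈ S', u < i.n := fun u hu => by
    obtain ⟨j, -, rfl⟩ := Finset.mem_image.1 hu
    exact j.2
  obtain ⟨v, hv⟩ : S'.Nonempty := Finset.card_pos.1 (by omega)
  obtain ⟨D', hD', hcD⟩ := Finset.exists_subset_card_eq (s := S'.erase v) (n := i.d)
    (by rw [Finset.card_erase_of_mem hv]; omega)
  have hD'S : ∀ u ∈ D', u ∈ S' := fun u hu => Finset.mem_of_mem_erase (hD' hu)
  obtain ⟨D, hDlt, hDinc, hDset⟩ := exists_incr_code (n := i.n) (fun u hu => hSn u (hD'S u hu)) hcD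
  have hmemD : ∀ l < i.d, dig i.n D l ∈ D' := fun l hl => by
    rw [← hDset]; exact mem_digSet.2 ⟨l, hl, rfl⟩
  set U := (S'.erase v) \ D' with hU
  have hcU : U.card = S.card - 1 - i.d := by
    rw [hU, Finset.card_sdiff_of_subset hD', Finset.card_erase_of_mem hv, hcS, hcD]
  set q := U.card / (2 * i.h) with hq
  have hqU : 2 * i.h * q ≤ U.card := Nat.mul_div_le _ _
  -- the increasing enumeration of `U`; the value `0` beyond the end is never used
  let e : ℕ → ℕ := fun j => if hj : j < U.card then U.orderEmbOfFin rfl ⟨j, hj⟩ else 0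
  have heU : ∀ j < 2 * i.h * q, e j ∈ U := fun j hj => by
    simp only [e, dif_pos (hj.trans_le hqU)]; exact Finset.orderEmbOfFin_mem _ _ _
  have hUS : ∀ u ∈ U, u ∈ S' ∧ u ≠ v ∧ u ∉ D' := fun u hu => by
    simp only [hU, Finset.mem_sdiff, Finset.mem_erase] at hu
    exact ⟨hu.1.2, hu.1.1, hu.2⟩
  have hquery : ∀ c < i.n ^ (2 * i.h), (digSet i.n (2 * i.h) c).card = 2 * i.h →
      (∀ u ∈ digSet i.n (2 * i.h) c, u ∈ S' ∧ u ≠ v) →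
      i.query (c + i.n ^ (2 * i.h) * v) = 1 := by
    intro c hc hcard hmem
    rw [query_eq_one_iff i hc (hSn v hv)]
    refine hS.has ((linkSet_subset _).trans ?_) (card_linkSet hcard fun h => (hmem v h).2 rfl)
    exact Finset.insert_subset hv fun u hu => (hmem u hu).1
  have hcommon : ∀ w ∈ U, i.Common v D w := by
    intro w hw
    obtain ⟨hwS, hwv, hwD⟩ := hUS w hw
    refine ⟨hwv, fun l hl h => hwD (h ▸ hmemD l hl), fun T hT hTinc hTD => ?_⟩
    have e2 : 2 * i.h - 1 + 1 = 2 * i.h := by omega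
    have hset := digSet_add hT (hSn w hwS)
    rw [e2] at hset
    have hTm : ∀ u ∈ digSet i.n (2 * i.h - 1) T, u ∈ D' := fun u hu => by
      obtain ⟨j, hj, rfl⟩ := mem_digSet.1 hu
      obtain ⟨l, hl, h⟩ := hTD j hj
      rw [h]; exact hmemD l hl
    refine hquery _ ?_ ?_ ?_
    · conv_rhs => rw [← e2]
      rw [pow_succ]
      nlinarith [hSn w hwS]
    · rw [hset, Finset.card_insert_of_notMem fun h => hwD (hTm w h), hTinc.card_digSet, e2]
    · intro u hu
      rw [hset, Finset.mem_insert] at hu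
      rcases hu with rfl | hu
      · exact ⟨hwS, hwv⟩
      · have := hD' (hTm u hu)
        exact ⟨Finset.mem_of_mem_erase this, Finset.ne_of_mem_erase this⟩
  have hpass : i.Passes v D q := by
    refine i.passes_of_blocks hh (e := e) (fun j hj => hSn _ (hUS _ (heU j hj)).1) ?_ ?_
    · intro a b hab hb
      simp only [e, dif_pos (show a < U.card by omega), dif_pos (show b < U.card by omega)]
      exact (U.orderEmbOfFin rfl).strictMono hab
    · intro c hc hinc hce
      have hcU' : ∀ j < 2 * i.h, dig i.n c j ∈ U := fun j hj => by
        obtain ⟨l, hl, h⟩ := hce j hj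
        rw [h]; exact heU l hl
      refine ⟨⟨hinc, fun j hj => hcommon _ (hcU' j hj)⟩, hquery c hc hinc.card_digSet fun u hu => ?_⟩
      obtain ⟨j, hj, rfl⟩ := mem_digSet.1 hu
      exact ⟨(hUS _ (hcU' j hj)).1, (hUS _ (hcU' j hj)).2.1⟩
  have hqn : q ≤ i.n := by
    have h1 : S.card ≤ i.n := by simpa using S.card_le_univ
    have : q ≤ U.card := Nat.div_le_self _ _
    omega
  have hle := i.le_maxBlock (hSn v hv) hDlt
    ⟨hDinc, fun l hl => Finset.ne_of_mem_erase (hD' (hmemD l hl))⟩ hqn hpass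
  have h1 : U.card < 2 * i.h * (1 + q) := by
    have := Nat.lt_mul_div_succ U.card (show 0 < 2 * i.h by omega)
    rw [← hq] at this
    rwa [add_comm 1 q]
  have h2 : 2 * i.h * (1 + q) ≤ 2 * i.h * (1 + i.maxBlock) := by gcongr
  omega

theorem output_le : i.output ≤ i.n := min_le_left _ _

theorem cliqueNumber_le_output (hk : 2 ≤ i.k) : i.H.cliqueNumber ≤ i.output := by
  classical
  unfold UniformHypergraph.cliqueNumber
  refine Finset.sup_le fun S hS => le_min (by simpa using S.card_le_univ) ?_
  exact i.card_le_of_isClique hk (by simpa using hS)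

end CliqueInput

/-! ### Random hypergraphs -/

section Random

open Measure

/-- The distribution of the indicator of an event of probability `p`, as a measure on `Prop`. -/
noncomputable def bernoulliProp (p : I) : Measure Prop :=
  toNNReal p • dirac True + toNNReal (σ p) • dirac False

instance (p : I) : IsProbabilityMeasure (bernoulliProp p) where
  measure_univ := by
    simp only [bernoulliProp, measure_univ]

theorem bernoulliProp_true (p : I) : bernoulliProp p {True} = (toNNReal p : ENNReal) := by
  simp [bernoulliProp]

variable {ι : Type*}

/-- The random set, described by the independent indicators of its elements. -/
theorem setBernoulli_univ_apply (p : I) (S : Set (Set ι)) :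
    setBernoulli (Set.univ : Set ι) p S =
      infinitePi (fun _ : ι => bernoulliProp p) ((fun f => {i | f i}) ⁻¹' S) := by
  rw [setBernoulli_apply']
  simp [bernoulliProp]

/-- A given finite set is contained in the random set with probability `p ^ |E|`. -/
theorem setBernoulli_real_forall_mem (p : I) (E : Finset ι) :
    (setBernoulli (Set.univ : Set ι) p).real {H | ∀ e ∈ E, e ∈ H} = (p : ℝ) ^ E.card := by
  have h : (fun f : ι → Prop => {i | f i}) ⁻¹' {H : Set ι | ∀ e ∈ E, e ∈ H} =
      Set.pi E fun _ => {True} := by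
    ext f; simp [Set.mem_pi]
  rw [measureReal_def, setBernoulli_univ_apply, h, infinitePi_pi _ fun _ _ => .of_discrete]
  simp [bernoulliProp_true]

open Classical in
/-- Hoeffding's inequality for the number of elements of the random set in a given finite set. -/
theorem setBernoulli_real_abs_sum_ge_le (p : I) (E : Finset ι) {t : ℝ} (ht : 0 ≤ t) :
    (setBernoulli (Set.univ : Set ι) p).real
      {H | t ≤ |∑ e ∈ E, ((if e ∈ H then (1 : ℝ) else 0) - p)|} ≤
      2 * Real.exp (-(2 * t ^ 2) / E.card) := by
  set μ := infinitePi (fun _ : ι => bernoulliProp p)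
  let g : Prop → ℝ := fun q => (if q then (1 : ℝ) else 0) - p
  let X : ι → (ι → Prop) → ℝ := fun e f => g (f e)
  have hg : Measurable g := measurable_from_top
  have hgi : ∫ q, g q ∂(bernoulliProp p) = 0 := by
    have h1 : Integrable g (dirac True) := integrable_dirac (by simp)
    have h2 : Integrable g (dirac False) := integrable_dirac (by simp)
    rw [bernoulliProp, integral_add_measure h1.smul_measure_nnreal h2.smul_measure_nnreal]
    simp only [integral_smul_nnreal_measure, integral_dirac, g]
    simp [NNReal.smul_def]
    ring
  have hind : iIndepFun X μ := iIndepFun_infinitePi fun _ => hg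
  have hsub : ∀ e, HasSubgaussianMGF (X e) ((‖(1 - p : ℝ) - (-p)‖₊ / 2) ^ 2) μ := fun e => by
    refine hasSubgaussianMGF_of_mem_Icc_of_integral_eq_zero
      (hg.comp (measurable_pi_apply e)).aemeasurable ?_ ?_
    · refine Filter.Eventually.of_forall fun f => ?_
      have h0 := p.2.1
      simp only [X, g]
      split_ifs <;> constructor <;> linarith
    · rw [← hgi, ← infinitePi_map_eval (fun _ : ι => bernoulliProp p) e,
        integral_map (measurable_pi_apply e).aemeasurable hg.aestronglyMeasurable]
  have hc : ((∑ _e ∈ E, (‖(1 - p : ℝ) - (-p)‖₊ / 2) ^ 2 : NNReal) : ℝ) = E.card / 4 := by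
    have : ((‖(1 - p : ℝ) - (-p)‖₊ : NNReal) : ℝ) = 1 := by simp
    push_cast at this ⊢
    rw [Finset.sum_const, nsmul_eq_mul, this]; ring
  have hexp : -t ^ 2 / (2 * (E.card / 4 : ℝ)) = -(2 * t ^ 2) / E.card := by
    rcases Nat.eq_zero_or_pos E.card with h | h
    · simp [h]
    · field_simp; ring
  have h1 := HasSubgaussianMGF.measure_sum_ge_le_of_iIndepFun hind (s := E) (fun e _ => hsub e) ht
  have hind' : iIndepFun (fun e => -X e) μ :=
    iIndepFun_infinitePi (X := fun _ => -g) fun _ => hg.neg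
  have h2 := HasSubgaussianMGF.measure_sum_ge_le_of_iIndepFun hind' (s := E)
    (fun e _ => (hsub e).neg) ht
  rw [hc, hexp] at h1 h2
  rw [measureReal_def, setBernoulli_univ_apply, ← measureReal_def, two_mul]
  refine le_trans (measureReal_mono ?_) ((measureReal_union_le _ _).trans (add_le_add h1 h2))
  intro f hf
  simp only [Set.mem_preimage, Set.mem_ofPred_eq] at hf
  rcases le_abs.1 hf with h | h
  · exact .inl h
  · right
    simp only [Set.mem_ofPred_eq, Pi.neg_apply, Finset.sum_neg_distrib]
    exact h

end Random

instance (k n : ℕ) (p : I) : IsProbabilityMeasure (randomHypergraph k n p) :=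
  inferInstanceAs (IsProbabilityMeasure (setBernoulli _ p))

theorem UniformHypergraph.has_image_iff {n k : ℕ} (H : UniformHypergraph n k)
    (e : {e : Finset (Fin n) // e.card = k}) :
    H.Has (e.1.image fun i : Fin n => (i : ℕ)) ↔ e ∈ H := by
  refine ⟨fun ⟨e', he', h⟩ => ?_, fun h => ⟨e, h, rfl⟩⟩
  rwa [← Subtype.ext (Finset.image_injective Fin.val_injective h)]

theorem exists_edge_image_eq {n k : ℕ} {U : Finset ℕ} (hU : ∀ u ∈ U, u < n) (hk : U.card = k) :
    ∃ e : {e : Finset (Fin n) // e.card = k}, e.1.image (fun i : Fin n => (i : ℕ)) = U := by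
  obtain ⟨e, he⟩ : ∃ e : Finset (Fin n), e.image (fun i : Fin n => (i : ℕ)) = U := by
    refine ⟨Finset.univ.filter fun j => (j : ℕ) ∈ U, ?_⟩
    ext x
    simp only [Finset.mem_image, Finset.mem_filter, Finset.mem_univ, true_and]
    exact ⟨fun ⟨j, hj, e⟩ => e ▸ hj, fun hx => ⟨⟨x, hU x hx⟩, hx, rfl⟩⟩
  refine ⟨⟨e, ?_⟩, he⟩
  rw [← hk, ← he, Finset.card_image_of_injective _ Fin.val_injective]

theorem digSet_lt {n m c : ℕ} (hn : 0 < n) : ∀ u ∈ digSet n m c, u < n := fun u hu => by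
  obtain ⟨j, -, rfl⟩ := mem_digSet.1 hu
  exact dig_lt hn c j

theorem linkSet_injOn {k v : ℕ} {U U' : Finset ℕ} (hU : v ∉ U) (hU' : v ∉ U')
    (h : linkSet k v U = linkSet k v U') : U = U' := by
  unfold linkSet at h
  split_ifs at h
  · exact h
  · rw [← Finset.erase_insert hU, h, Finset.erase_insert hU']

/-- `c` is the code of a strictly increasing `2 * (k / 2)`-tuple that avoids `v`. -/
def Regular (n k v c : ℕ) : Prop := Incr n (2 * (k / 2)) c ∧ v ∉ digSet n (2 * (k / 2)) c

open Classical in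
/-- The sum over the rectangle `X × Y` of the entries of the centred adjacency matrix. -/
noncomputable def rectSum {n k : ℕ} (H : UniformHypergraph n k) (p : ℝ) (v : ℕ)
    (X Y : Finset (Fin (n ^ (k / 2)))) : ℝ :=
  ∑ A ∈ X, ∑ B ∈ Y, if Regular n k v (A + n ^ (k / 2) * B) then
    (if H.Has (linkSet k v (digSet n (2 * (k / 2)) (A + n ^ (k / 2) * B))) then (1 : ℝ) else 0) - p
    else 0

theorem pair_code_lt {n k : ℕ} (A B : Fin (n ^ (k / 2))) :
    (A : ℕ) + n ^ (k / 2) * B < n ^ (2 * (k / 2)) := by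
  rw [two_mul, pow_add]
  nlinarith [A.2, B.2]

theorem pair_code_injective {N : ℕ} {A B A' B' : Fin N}
    (h : (A : ℕ) + N * B = A' + N * B') : A = A' ∧ B = B' := by
  have hN : 0 < N := (Nat.zero_le _).trans_lt A.2
  have h1 := congrArg (· % N) h
  have h2 := congrArg (· / N) h
  simp only [Nat.add_mul_mod_self_left, Nat.mod_eq_of_lt A.2, Nat.mod_eq_of_lt A'.2,
    Nat.add_mul_div_left _ _ hN, Nat.div_eq_of_lt A.2, Nat.div_eq_of_lt A'.2, zero_add] at h1 h2
  exact ⟨Fin.ext h1, Fin.ext h2⟩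

/-- Every hyperedge contributes to at most one entry, so Hoeffding's inequality applies. -/
theorem real_abs_rectSum_ge_le {n k v : ℕ} (p : I) (hv : v < n)
    (X Y : Finset (Fin (n ^ (k / 2)))) {t : ℝ} (ht : 0 < t) :
    (randomHypergraph k n p).real {H | t ≤ |rectSum H p v X Y|} ≤
      2 * Real.exp (-(2 * t ^ 2) / (X.card * Y.card)) := by
  classical
  set P := (X ×ˢ Y).filter fun ab => Regular n k v (ab.1 + n ^ (k / 2) * ab.2) with hP
  let U : Fin (n ^ (k / 2)) × Fin (n ^ (k / 2)) → Finset ℕ := fun ab =>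
    linkSet k v (digSet n (2 * (k / 2)) (ab.1 + n ^ (k / 2) * ab.2))
  have hex : ∀ ab ∈ P, ∃ e : {e : Finset (Fin n) // e.card = k},
      e.1.image (fun i : Fin n => (i : ℕ)) = U ab := fun ab hab => by
    obtain ⟨h1, h2⟩ := (Finset.mem_filter.1 hab).2
    refine exists_edge_image_eq (fun u hu => ?_) (CliqueInput.card_linkSet h1.card_digSet h2)
    rcases Finset.mem_insert.1 (CliqueInput.linkSet_subset _ hu) with rfl | h
    · exact hv
    · exact digSet_lt (by omega) u h
  have hsumP : ∀ H : UniformHypergraph n k, rectSum H p v X Y =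
      ∑ ab ∈ P, ((if H.Has (U ab) then (1 : ℝ) else 0) - p) := fun H => by
    rw [rectSum, ← Finset.sum_product', hP, Finset.sum_filter]
  -- Hoeffding's bound has the junk denominator `0` if the rectangle contains no regular pair
  rcases P.eq_empty_or_nonempty with h0 | ⟨ab₀, hab₀⟩
  · have : {H : UniformHypergraph n k | t ≤ |rectSum H p v X Y|} = ∅ := by
      ext H
      simp [hsumP, h0, ht]
    rw [this, measureReal_empty]
    positivity
  have : Nonempty {e : Finset (Fin n) // e.card = k} := ⟨(hex ab₀ hab₀).choose⟩
  choose! e he using hex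
  have hinj : Set.InjOn e P := fun ab hab ab' hab' h => by
    obtain ⟨h1, h2⟩ := (Finset.mem_filter.1 hab).2
    obtain ⟨h1', h2'⟩ := (Finset.mem_filter.1 hab').2
    have hU : U ab = U ab' := by rw [← he ab hab, ← he ab' hab', h]
    have := pair_code_injective (h1.ext h1' (pair_code_lt _ _) (pair_code_lt _ _)
      (linkSet_injOn h2 h2' hU))
    exact Prod.ext this.1 this.2
  have hsum : ∀ H : UniformHypergraph n k, rectSum H p v X Y =
      ∑ x ∈ P.image e, ((if x ∈ H then (1 : ℝ) else 0) - p) := fun H => by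
    rw [Finset.sum_image hinj, hsumP]
    refine Finset.sum_congr rfl fun ab hab => ?_
    simp only [← H.has_image_iff, he ab hab]
  have hcard : ((P.image e).card : ℝ) ≤ X.card * Y.card := by
    have : (P.image e).card ≤ X.card * Y.card := by
      rw [← Finset.card_product]
      exact Finset.card_image_le.trans (Finset.card_filter_le _ _)
    exact_mod_cast this
  have hpos : (0 : ℝ) < (P.image e).card := by exact_mod_cast Finset.card_pos.2 ⟨_, Finset.mem_image_of_mem e hab₀⟩
  simp only [hsum]
  refine (setBernoulli_real_abs_sum_ge_le p (P.image e) ht.le).trans ?_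
  rw [neg_div, neg_div]
  gcongr

/-! ### The two random events -/

/-- The sum in the union bound over the nonempty sets is `(1 + b) ^ N - 1`. -/
theorem sum_pow_card_le {N : ℕ} {b : ℝ} (hb : 0 ≤ b) (hNb : N * b ≤ 1 / 2) :
    ∑ X : Finset (Fin N) with X.Nonempty, b ^ X.card ≤ 2 * (N * b) := by
  classical
  have h1 : ∑ X : Finset (Fin N), b ^ X.card = (1 + b) ^ N := by
    have := Finset.sum_pow_mul_eq_add_pow b 1 (Finset.univ : Finset (Fin N))
    simp only [one_pow, mul_one, Finset.powerset_univ, Finset.card_univ, Fintype.card_fin] at this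
    rw [this, add_comm]
  have h2 : ∑ X : Finset (Fin N) with X.Nonempty, b ^ X.card + 1 = (1 + b) ^ N := by
    rw [← h1, ← Finset.sum_filter_add_sum_filter_not Finset.univ fun X : Finset (Fin N) => X.Nonempty]
    congr 1
    have : (Finset.univ.filter fun X : Finset (Fin N) => ¬ X.Nonempty) = {∅} := by
      ext X; simp
    rw [this]; simp
  have h3 : (1 + b) ^ N ≤ Real.exp (N * b) := by
    rw [Real.exp_nat_mul]
    exact pow_le_pow_left₀ (by positivity) (by linarith [Real.add_one_le_exp b]) N
  have h4 : Real.exp (N * b) ≤ 1 / (1 - N * b) :=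
    Real.exp_bound_div_one_sub_of_interval (by positivity) (by linarith)
  have h5 : 1 / (1 - N * b) ≤ 1 + 2 * (N * b) := by
    have : 0 ≤ N * b := by positivity
    rw [div_le_iff₀ (by linarith)]
    nlinarith
  linarith

/-- All rectangle sums are small with high probability. -/
theorem real_exists_rectSum_ge_le {n k : ℕ} (p : I) (hn : 2 ≤ n) (c : ℕ) :
    (randomHypergraph k n p).real {H | ∃ v < n, ∃ X Y : Finset (Fin (n ^ (k / 2))),
      X.Nonempty ∧ Y.Nonempty ∧ √(((k / 2 : ℕ) + c + 3) * Real.log n / 2 *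
        (X.card * Y.card * (X.card + Y.card))) ≤ |rectSum H p v X Y|} ≤
      1 / 2 * (1 / (n : ℝ) ^ c) := by
  classical
  set h := k / 2
  set N := n ^ h
  have hn' : (2 : ℝ) ≤ n := by exact_mod_cast hn
  have hlog : 0 < Real.log n := Real.log_pos (by linarith)
  set K : ℝ := (h + c + 3) * Real.log n / 2 with hK
  have hKpos : 0 < K := by positivity
  set b : ℝ := 1 / (n : ℝ) ^ (h + c + 3) with hb
  have hbexp : Real.exp (-(2 * K)) = b := by
    have : -(2 * K) = -(((h + c + 3 : ℕ) : ℝ) * Real.log n) := by push_cast; rw [hK]; ring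
    rw [this, Real.exp_neg, Real.exp_nat_mul, Real.exp_log (by linarith), hb, one_div]
  have hNb : (N : ℝ) * b = 1 / (n : ℝ) ^ (c + 3) := by
    rw [hb, show h + c + 3 = h + (c + 3) by ring, pow_add]
    simp only [N]
    push_cast
    field_simp
  have hNb2 : (N : ℝ) * b ≤ 1 / 2 := by
    rw [hNb]
    refine one_div_le_one_div_of_le (by norm_num) ?_
    calc (2 : ℝ) ≤ n ^ 1 := by simpa using hn'
      _ ≤ n ^ (c + 3) := pow_le_pow_right₀ (by linarith) (by omega)
  set F := (Finset.univ : Finset (Finset (Fin N))).filter fun X => X.Nonempty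
  have hsub : {H : UniformHypergraph n k | ∃ v < n, ∃ X Y : Finset (Fin N),
      X.Nonempty ∧ Y.Nonempty ∧ √(K * (X.card * Y.card * (X.card + Y.card))) ≤
        |rectSum H p v X Y|} ⊆ ⋃ q ∈ Finset.range n ×ˢ (F ×ˢ F),
      {H | √(K * (q.2.1.card * q.2.2.card * (q.2.1.card + q.2.2.card))) ≤
        |rectSum H p q.1 q.2.1 q.2.2|} := by
    rintro H ⟨v, hv, X, Y, hX, hY, hH⟩
    simp only [Set.mem_iUnion]
    exact ⟨(v, X, Y), by simp [F, hv, hX, hY], hH⟩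
  refine (measureReal_mono hsub (measure_ne_top _ _)).trans
    ((measureReal_biUnion_finset_le _ _).trans ?_)
  have hterm : ∀ q ∈ Finset.range n ×ˢ (F ×ˢ F), (randomHypergraph k n p).real
      {H | √(K * (q.2.1.card * q.2.2.card * (q.2.1.card + q.2.2.card))) ≤
        |rectSum H p q.1 q.2.1 q.2.2|} ≤ 2 * (b ^ q.2.1.card * b ^ q.2.2.card) := by
    rintro ⟨v, X, Y⟩ hq
    simp only [Finset.mem_product, Finset.mem_range, F, Finset.mem_filter, Finset.mem_univ,
      true_and] at hq
    have hX : (0 : ℝ) < X.card := by exact_mod_cast Finset.card_pos.2 hq.2.1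
    have hY : (0 : ℝ) < Y.card := by exact_mod_cast Finset.card_pos.2 hq.2.2
    -- with this threshold, Hoeffding's bound is the product of a power for `X` and a power for `Y`
    refine (real_abs_rectSum_ge_le p hq.1 X Y (Real.sqrt_pos.2 (by positivity))).trans ?_
    rw [Real.sq_sqrt (by positivity), ← pow_add, ← hbexp, ← Real.exp_nat_mul]
    refine mul_le_mul_of_nonneg_left (Real.exp_le_exp.2 (le_of_eq ?_)) (by norm_num)
    push_cast
    field_simp
  refine (Finset.sum_le_sum hterm).trans ?_
  have hprod : ∑ q ∈ Finset.range n ×ˢ (F ×ˢ F), 2 * (b ^ q.2.1.card * b ^ q.2.2.card) =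
      n * (2 * ((∑ X ∈ F, b ^ X.card) * ∑ Y ∈ F, b ^ Y.card)) := by
    rw [Finset.sum_product]
    dsimp only
    rw [Finset.sum_const, Finset.card_range, nsmul_eq_mul, ← Finset.mul_sum, Finset.sum_product,
      Finset.sum_mul_sum]
  rw [hprod]
  have hS := sum_pow_card_le (N := N) (b := b) (by positivity) hNb2
  rw [hNb] at hS
  calc (n : ℝ) * (2 * ((∑ X ∈ F, b ^ X.card) * ∑ Y ∈ F, b ^ Y.card))
      ≤ n * (2 * ((2 * (1 / (n : ℝ) ^ (c + 3))) * (2 * (1 / (n : ℝ) ^ (c + 3))))) := by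
        have h0 : 0 ≤ ∑ X ∈ F, b ^ X.card := Finset.sum_nonneg fun X _ => by positivity
        gcongr
    _ = 16 / (n : ℝ) ^ (c + 5) * (1 / 2 * (1 / (n : ℝ) ^ c)) := by
        have : (n : ℝ) ≠ 0 := by positivity
        field_simp
        ring
    _ ≤ 1 * (1 / 2 * (1 / (n : ℝ) ^ c)) := by
        gcongr
        rw [div_le_one (by positivity)]
        calc (16 : ℝ) ≤ 2 ^ 5 := by norm_num
          _ ≤ n ^ 5 := by gcongr
          _ ≤ n ^ (c + 5) := pow_le_pow_right₀ (by linarith) (by omega)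
    _ = _ := one_mul _

namespace CliqueInput

variable (i : CliqueInput)

open Classical in
/-- The common neighbourhood of `D`. -/
noncomputable def nbhd (v D : ℕ) : Finset ℕ := (Finset.range i.n).filter (i.Common v D)

theorem mem_nbhd {v D w : ℕ} : w ∈ i.nbhd v D ↔ w < i.n ∧ i.Common v D w := by
  simp [nbhd]

/-- A vertex of the common neighbourhood and any `2 * h - 1` vertices of `D` (and `v`, if `k` is odd)
form a hyperedge, whatever the order of the vertices. -/
theorem Common.has {v D w : ℕ} (hk : 2 ≤ i.k) (hv : v < i.n) (hw : w < i.n) (h : i.Common v D w)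
    {T : Finset ℕ} (hT : T ⊆ digSet i.n i.d D) (hc : T.card = 2 * i.h - 1) :
    i.H.Has (linkSet i.k v (insert w T)) := by
  have hn : 0 < i.n := by omega
  have e2 : 2 * i.h - 1 + 1 = 2 * i.h := by
    have : 1 ≤ i.h := by unfold CliqueInput.h; omega
    omega
  obtain ⟨c, hclt, hinc, rfl⟩ := exists_incr_code (n := i.n) (fun u hu => digSet_lt hn u (hT hu)) hc
  have hq := h.2.2 c hclt hinc fun j hj => by
    obtain ⟨l, hl, hle⟩ := mem_digSet.1 (hT (mem_digSet.2 ⟨j, hj, rfl⟩))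
    exact ⟨l, hl, hle.symm⟩
  rw [query_eq_one_iff i ?_ hv] at hq
  · have hset := digSet_add hclt hw
    rw [e2] at hset
    rwa [hset] at hq
  · conv_rhs => rw [← e2]
    rw [pow_succ]
    nlinarith

end CliqueInput

/-- If there are `u` common neighbours, then there is a `u`-set `U` of vertices such that the
`(d choose (2h - 1)) u` hyperedges which a vertex of `U` forms with vertices of `D` are all present.
The estimate is the union bound over `U`. -/
theorem real_le_card_nbhd_le {n k d v D : ℕ} (p : I) (hk : 2 ≤ k) (hv : v < n) (hD : Incr n d D)
    (hvD : v ∉ digSet n d D) (u : ℕ) :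
    (randomHypergraph k n p).real {H | u ≤ (CliqueInput.nbhd ⟨n, k, H, p, d⟩ v D).card} ≤
      n.choose u * ((p : ℝ) ^ d.choose (2 * (k / 2) - 1)) ^ u := by
  classical
  set V := Finset.range n \ insert v (digSet n d D) with hV
  let f : ℕ × Finset ℕ → Finset ℕ := fun q => linkSet k v (insert q.1 q.2)
  let Ts := (digSet n d D).powersetCard (2 * (k / 2) - 1)
  let E : Finset ℕ → Finset {e : Finset (Fin n) // e.card = k} := fun U =>
    Finset.univ.filter fun e => e.1.image (fun i : Fin n => (i : ℕ)) ∈ (U ×ˢ Ts).image f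
  have hVmem : ∀ w ∈ V, w < n ∧ w ≠ v ∧ w ∉ digSet n d D := fun w hw => by
    simpa [hV, not_or] using hw
  have hTs : ∀ T ∈ Ts, T ⊆ digSet n d D ∧ T.card = 2 * (k / 2) - 1 := fun T hT =>
    Finset.mem_powersetCard.1 hT
  have e2 : 2 * (k / 2) - 1 + 1 = 2 * (k / 2) := by omega
  have hcardE : ∀ U ∈ V.powersetCard u, d.choose (2 * (k / 2) - 1) * u ≤ (E U).card := by
    intro U hU
    obtain ⟨hUV, hUc⟩ := Finset.mem_powersetCard.1 hU
    have hvnot : ∀ q ∈ U ×ˢ Ts, v ∉ insert q.1 q.2 := fun q hq => by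
      obtain ⟨h1, h2⟩ := Finset.mem_product.1 hq
      rw [Finset.mem_insert, not_or]
      exact ⟨(hVmem _ (hUV h1)).2.1.symm, fun h => hvD ((hTs _ h2).1 h)⟩
    have hinj : Set.InjOn f (U ×ˢ Ts : Finset (ℕ × Finset ℕ)) := by
      rintro ⟨w, T⟩ hq ⟨w', T'⟩ hq' h
      have h' := linkSet_injOn (hvnot _ hq) (hvnot _ hq') h
      obtain ⟨h1, h2⟩ := Finset.mem_product.1 hq
      obtain ⟨h1', h2'⟩ := Finset.mem_product.1 hq'
      simp only at h1 h2 h1' h2' h'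
      have hw : w ∉ T := fun h => (hVmem _ (hUV h1)).2.2 ((hTs _ h2).1 h)
      have hw2 : w ∉ T' := fun h => (hVmem _ (hUV h1)).2.2 ((hTs _ h2').1 h)
      have hw' : w' ∉ T' := fun h => (hVmem _ (hUV h1')).2.2 ((hTs _ h2').1 h)
      have hww : w = w' := by
        have : w ∈ insert w' T' := h' ▸ Finset.mem_insert_self w T
        exact (Finset.mem_insert.1 this).resolve_right hw2
      subst hww
      rw [← Finset.erase_insert hw, h', Finset.erase_insert hw2]
    have h1 : ((U ×ˢ Ts).image f).card = u * d.choose (2 * (k / 2) - 1) := by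
      rw [Finset.card_image_of_injOn hinj, Finset.card_product, hUc, Finset.card_powersetCard,
        hD.card_digSet]
    rw [mul_comm, ← h1]
    refine le_trans (Finset.card_le_card fun W hW => ?_)
      (Finset.card_image_le (s := E U) (f := fun e => e.1.image fun i : Fin n => (i : ℕ)))
    obtain ⟨q, hq, rfl⟩ := Finset.mem_image.1 hW
    obtain ⟨h1, h2⟩ := Finset.mem_product.1 hq
    obtain ⟨e, he⟩ := exists_edge_image_eq (n := n) (k := k) (U := f q) (fun x hx => by
        rcases Finset.mem_insert.1 (CliqueInput.linkSet_subset _ hx) with rfl | hx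
        · exact hv
        rcases Finset.mem_insert.1 hx with rfl | hx
        · exact (hVmem _ (hUV h1)).1
        · exact digSet_lt (by omega) _ ((hTs _ h2).1 hx))
      (CliqueInput.card_linkSet (by
        rw [Finset.card_insert_of_notMem fun h => (hVmem _ (hUV h1)).2.2 ((hTs _ h2).1 h),
          (hTs _ h2).2, e2]) (hvnot q hq))
    exact Finset.mem_image.2 ⟨e, Finset.mem_filter.2 ⟨Finset.mem_univ _, by rw [he]; exact hW⟩, he⟩
  have hsub : {H | u ≤ (CliqueInput.nbhd ⟨n, k, H, p, d⟩ v D).card} ⊆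
      ⋃ U ∈ V.powersetCard u, {H : UniformHypergraph n k | ∀ e ∈ E U, e ∈ H} := by
    intro H hH
    obtain ⟨U, hU, hUc⟩ := Finset.exists_subset_card_eq (Set.mem_ofPred_eq ▸ hH)
    have hUm : ∀ w ∈ U, w < n ∧ CliqueInput.Common ⟨n, k, H, p, d⟩ v D w := fun w hw =>
      (CliqueInput.mem_nbhd _).1 (hU hw)
    simp only [Set.mem_iUnion]
    refine ⟨U, Finset.mem_powersetCard.2 ⟨fun w hw => ?_, hUc⟩, fun e he => ?_⟩
    · obtain ⟨h1, h2, h3, -⟩ := hUm w hw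
      simp only [hV, Finset.mem_sdiff, Finset.mem_range, Finset.mem_insert, not_or, mem_digSet,
        not_exists, not_and]
      exact ⟨h1, h2, h3⟩
    · obtain ⟨q, hq, hqe⟩ := Finset.mem_image.1 (Finset.mem_filter.1 he).2
      obtain ⟨h1, h2⟩ := Finset.mem_product.1 hq
      rw [← H.has_image_iff, ← hqe]
      exact (hUm _ h1).2.has ⟨n, k, H, p, d⟩ hk hv (hUm _ h1).1 (hTs _ h2).1 (hTs _ h2).2
  refine (measureReal_mono hsub (measure_ne_top _ _)).trans
    ((measureReal_biUnion_finset_le _ _).trans ?_)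
  have hterm : ∀ U ∈ V.powersetCard u,
      (randomHypergraph k n p).real {H : UniformHypergraph n k | ∀ e ∈ E U, e ∈ H} ≤
        ((p : ℝ) ^ d.choose (2 * (k / 2) - 1)) ^ u := fun U hU => by
    rw [randomHypergraph, setBernoulli_real_forall_mem, ← pow_mul]
    exact pow_le_pow_of_le_one p.2.1 p.2.2 (hcardE U hU)
  refine (Finset.sum_le_sum hterm).trans ?_
  rw [Finset.sum_const, Finset.card_powersetCard, nsmul_eq_mul]
  have hp0 : 0 ≤ (p : ℝ) := p.2.1
  have hVn : V.card ≤ n := (Finset.card_le_card Finset.sdiff_subset).trans (by simp)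
  gcongr

/-- By `n choose u ≤ n ^ u / u!` and `u ^ u / u! ≤ e ^ u`; the factor `8` exceeds `e ^ 2`. -/
theorem choose_mul_pow_le_exp {n u : ℕ} {q : ℝ} (hq : 0 ≤ q) (hu : 8 * (n * q) ≤ u) :
    n.choose u * q ^ u ≤ Real.exp (-u) := by
  have h1 : (n.choose u : ℝ) ≤ (n : ℝ) ^ u / u.factorial := Nat.choose_le_pow_div u n
  have h2 : (u : ℝ) ^ u / u.factorial ≤ Real.exp u :=
    Real.pow_div_factorial_le_exp _ (Nat.cast_nonneg u) u
  have h3 : Real.exp 1 ^ 2 ≤ 8 := by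
    have := Real.exp_one_lt_d9
    have h0 := Real.exp_pos 1
    nlinarith
  have h4 : Real.exp u * Real.exp u ≤ 8 ^ u := by
    rw [← Real.exp_one_pow, ← mul_pow, ← sq]
    exact pow_le_pow_left₀ (by positivity) h3 u
  have h5 : (8 : ℝ) ^ u * (n.choose u * q ^ u) ≤ Real.exp u := by
    calc (8 : ℝ) ^ u * (n.choose u * q ^ u) ≤ 8 ^ u * ((n : ℝ) ^ u / u.factorial * q ^ u) := by
          gcongr
      _ = (8 * (n * q)) ^ u / u.factorial := by rw [mul_pow, mul_pow]; ring
      _ ≤ (u : ℝ) ^ u / u.factorial := by gcongr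
      _ ≤ _ := h2
  rw [Real.exp_neg, ← one_div, le_div_iff₀ (Real.exp_pos _)]
  have h6 : Real.exp u * (n.choose u * q ^ u * Real.exp u) ≤ Real.exp u * 1 := by
    calc _ = (Real.exp u * Real.exp u) * (n.choose u * q ^ u) := by ring
      _ ≤ 8 ^ u * (n.choose u * q ^ u) := by gcongr
      _ ≤ _ := by rw [mul_one]; exact h5
  exact le_of_mul_le_mul_left h6 (Real.exp_pos _)

/-- All common neighbourhoods are small with high probability. -/
theorem real_exists_card_nbhd_gt_le {n k d : ℕ} (p : I) (hk : 2 ≤ k) (hn : 2 ≤ n) (c : ℕ) :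
    (randomHypergraph k n p).real {H | ∃ v < n, ∃ D < n ^ d,
      CliqueInput.GoodTuple ⟨n, k, H, p, d⟩ v D ∧
      max (8 * (n * (p : ℝ) ^ d.choose (2 * (k / 2) - 1))) ((d + c + 2) * Real.log n) <
        (CliqueInput.nbhd ⟨n, k, H, p, d⟩ v D).card} ≤ 1 / 2 * (1 / (n : ℝ) ^ c) := by
  classical
  have hn' : (2 : ℝ) ≤ n := by exact_mod_cast hn
  have hp0 : 0 ≤ (p : ℝ) := p.2.1
  set m := max (8 * (n * (p : ℝ) ^ d.choose (2 * (k / 2) - 1))) ((d + c + 2) * Real.log n)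
  set u := ⌈m⌉₊
  have hum : m ≤ u := Nat.le_ceil m
  set I₀ := (Finset.range n ×ˢ Finset.range (n ^ d)).filter fun q =>
    Incr n d q.2 ∧ q.1 ∉ digSet n d q.2
  have hsub : {H | ∃ v < n, ∃ D < n ^ d, CliqueInput.GoodTuple ⟨n, k, H, p, d⟩ v D ∧
      m < (CliqueInput.nbhd ⟨n, k, H, p, d⟩ v D).card} ⊆ ⋃ q ∈ I₀,
      {H | u ≤ (CliqueInput.nbhd ⟨n, k, H, p, d⟩ q.1 q.2).card} := by
    rintro H ⟨v, hv, D, hD, hg, hH⟩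
    simp only [Set.mem_iUnion]
    refine ⟨(v, D), ?_, Nat.ceil_le.2 hH.le⟩
    refine Finset.mem_filter.2 ⟨by simp [hv, hD], hg.1, fun h => ?_⟩
    obtain ⟨l, hl, h⟩ := mem_digSet.1 h
    exact hg.2 l hl h
  have hterm : ∀ q ∈ I₀, (randomHypergraph k n p).real
      {H | u ≤ (CliqueInput.nbhd ⟨n, k, H, p, d⟩ q.1 q.2).card} ≤ 1 / (n : ℝ) ^ (d + c + 2) := by
    intro q hq
    obtain ⟨h1, h2, h3⟩ := Finset.mem_filter.1 hq
    obtain ⟨h4, h5⟩ := Finset.mem_product.1 h1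
    refine (real_le_card_nbhd_le p hk (Finset.mem_range.1 h4) h2 h3 u).trans
      ((choose_mul_pow_le_exp (by positivity) ((le_max_left _ _).trans hum)).trans ?_)
    have h6 : ((d + c + 2 : ℕ) : ℝ) * Real.log n ≤ u := by
      push_cast
      exact (le_max_right _ _).trans hum
    calc Real.exp (-u) ≤ Real.exp (-(((d + c + 2 : ℕ) : ℝ) * Real.log n)) := by gcongr
      _ = _ := by rw [Real.exp_neg, Real.exp_nat_mul, Real.exp_log (by linarith), one_div]
  refine (measureReal_mono hsub (measure_ne_top _ _)).trans
    ((measureReal_biUnion_finset_le _ _).trans ((Finset.sum_le_sum hterm).trans ?_))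
  rw [Finset.sum_const, nsmul_eq_mul]
  have hI : (I₀.card : ℝ) ≤ (n : ℝ) ^ (d + 1) := by
    have : I₀.card ≤ n * n ^ d := (Finset.card_filter_le _ _).trans (by simp)
    rw [pow_succ']
    exact_mod_cast this
  calc (I₀.card : ℝ) * (1 / (n : ℝ) ^ (d + c + 2)) ≤
        (n : ℝ) ^ (d + 1) * (1 / (n : ℝ) ^ (d + c + 2)) := by gcongr
    _ = 1 / n * (1 / (n : ℝ) ^ c) := by
        have : (n : ℝ) ≠ 0 := by positivity
        field_simp
        ring
    _ ≤ 1 / 2 * (1 / (n : ℝ) ^ c) := by gcongr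

/-! ### Soundness on typical hypergraphs -/

theorem rectSum_empty_left {n k : ℕ} (H : UniformHypergraph n k) (p : ℝ) (v : ℕ)
    (Y : Finset (Fin (n ^ (k / 2)))) : rectSum H p v ∅ Y = 0 := by
  simp [rectSum]

theorem rectSum_empty_right {n k : ℕ} (H : UniformHypergraph n k) (p : ℝ) (v : ℕ)
    (X : Finset (Fin (n ^ (k / 2)))) : rectSum H p v X ∅ = 0 := by
  simp [rectSum]

namespace CliqueInput

variable (i : CliqueInput)

theorem pNum_approx : 0 ≤ 2 ^ i.N * (i.p : ℝ) - i.pNum ∧ 2 ^ i.N * (i.p : ℝ) - i.pNum ≤ 1 := by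
  have h0 : 0 ≤ 2 ^ i.N * (i.p : ℝ) := by have := i.p.2.1; positivity
  have h1 := Nat.floor_le h0
  have h2 := Nat.lt_floor_add_one (2 ^ i.N * (i.p : ℝ))
  unfold pNum
  constructor <;> linarith

open Classical in
theorem query_eq_ite {c v : ℕ} (hc : c < i.n ^ (2 * i.h)) (hv : v < i.n) :
    (i.query (c + i.n ^ (2 * i.h) * v) : ℝ) =
      if i.H.Has (linkSet i.k v (digSet i.n (2 * i.h) c)) then 1 else 0 := by
  have h := i.query_eq_one_iff hc hv
  have h1 := i.query_le_one (c + i.n ^ (2 * i.h) * v)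
  split_ifs with h2
  · rw [h.2 h2]; simp
  · have : i.query (c + i.n ^ (2 * i.h) * v) ≠ 1 := fun h3 => h2 (h.1 h3)
    have h0 : i.query (c + i.n ^ (2 * i.h) * v) = 0 := by omega
    rw [h0]; simp

open Classical in
/-- The codes of the `h`-tuples in the common neighbourhood, among those in `X`. -/
noncomputable def inNbhd (v D : ℕ) (X : Finset (Fin i.N)) : Finset (Fin i.N) :=
  X.filter fun A => ∀ j < i.h, i.Common v D (dig i.n A j)

theorem card_inNbhd_le_card (v D : ℕ) (X : Finset (Fin i.N)) : (i.inNbhd v D X).card ≤ X.card := by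
  classical
  exact Finset.card_filter_le _ _

theorem card_inNbhd_le (hn : 0 < i.n) (v D : ℕ) (X : Finset (Fin i.N)) :
    (i.inNbhd v D X).card ≤ (i.nbhd v D).card ^ i.h := by
  classical
  have h1 : (Fintype.piFinset fun _ : Fin i.h =>
      Finset.univ.filter fun x : Fin i.n => (x : ℕ) ∈ i.nbhd v D).card ≤
      (i.nbhd v D).card ^ i.h := by
    rw [Fintype.card_piFinset]
    simp only [Finset.prod_const, Finset.card_univ, Fintype.card_fin]
    refine Nat.pow_le_pow_left ?_ _
    rw [← Finset.card_image_of_injective _ Fin.val_injective]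
    refine Finset.card_le_card fun x hx => ?_
    obtain ⟨y, hy, rfl⟩ := Finset.mem_image.1 hx
    exact (Finset.mem_filter.1 hy).2
  refine le_trans (Finset.card_le_card_of_injOn
    (finFunctionFinEquiv (m := i.n) (n := i.h)).symm (fun A hA => ?_)
    (Equiv.injective _).injOn) h1
  simp only [Finset.mem_coe, Fintype.mem_piFinset, Finset.mem_filter, Finset.mem_univ, true_and]
  intro j
  exact i.mem_nbhd.2 ⟨dig_lt hn _ _, (Finset.mem_filter.1 hA).2 j j.2⟩

theorem admissible_pair_iff {v D : ℕ} (A B : Fin i.N) :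
    i.Admissible v D (A + i.N * B) ↔ Incr i.n (2 * i.h) (A + i.N * B) ∧
      (∀ j < i.h, i.Common v D (dig i.n A j)) ∧ ∀ j < i.h, i.Common v D (dig i.n B j) := by
  have h1 : ∀ j < i.h, dig i.n (A + i.N * B) j = dig i.n A j := fun j hj =>
    dig_add_of_lt (m := i.h) _ hj
  have h2 : ∀ j, dig i.n (A + i.N * B) (i.h + j) = dig i.n B j := fun j =>
    dig_add_of_le (m := i.h) A.2 _ _
  unfold Admissible
  refine and_congr_right fun _ => ⟨fun h => ⟨fun j hj => ?_, fun j hj => ?_⟩, fun h j hj => ?_⟩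
  · rw [← h1 j hj]; exact h j (by omega)
  · rw [← h2 j]; exact h _ (by omega)
  · rcases lt_or_ge j i.h with hj' | hj'
    · rw [h1 j hj']; exact h.1 j hj'
    · obtain ⟨r, rfl⟩ := Nat.exists_eq_add_of_le hj'
      rw [h2]; exact h.2 r (by omega)

theorem regular_of_admissible {v D c : ℕ} (h : i.Admissible v D c) : Regular i.n i.k v c :=
  ⟨h.1, fun hv => by
    obtain ⟨j, hj, e⟩ := mem_digSet.1 hv
    exact (h.2 j hj).1 e⟩

open Classical in
theorem rectSum_eq (v : ℕ) (X Y : Finset (Fin i.N)) : rectSum i.H i.p v X Y =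
    ∑ A ∈ X, ∑ B ∈ Y, if Regular i.n i.k v (A + i.N * B) then
      (if i.H.Has (linkSet i.k v (digSet i.n (2 * i.h) (A + i.N * B))) then (1 : ℝ) else 0) - i.p
      else 0 :=
  rfl

/-- Up to the error of the approximation to `p`, the sums over rectangles of the matrix that the
algorithm uses are sums over smaller rectangles of the centred adjacency matrix of the whole
hypergraph, which does not depend on `D`. -/
theorem abs_sum_matR_le {v : ℕ} (D : ℕ) (hv : v < i.n) (X Y : Finset (Fin i.N)) :
    |∑ A ∈ X, ∑ B ∈ Y, i.matR v D A B| ≤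
      2 ^ i.N * |rectSum i.H i.p v (i.inNbhd v D X) (i.inNbhd v D Y)| +
        (i.inNbhd v D X).card * (i.inNbhd v D Y).card := by
  classical
  set θ : ℝ := 2 ^ i.N * (i.p : ℝ) - i.pNum with hθ
  obtain ⟨hθ0, hθ1⟩ := i.pNum_approx
  have hentry : ∀ A B, i.matR v D A B =
      if (∀ j < i.h, i.Common v D (dig i.n A j)) then
        if (∀ j < i.h, i.Common v D (dig i.n B j)) then
          2 ^ i.N * (if Regular i.n i.k v (A + i.N * B) then
            (if i.H.Has (linkSet i.k v (digSet i.n (2 * i.h) (A + i.N * B))) then (1 : ℝ) else 0)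
              - i.p else 0) + (if Regular i.n i.k v (A + i.N * B) then θ else 0)
        else 0 else 0 := by
    intro A B
    have hq := i.query_eq_ite (pair_code_lt (k := i.k) A B) hv
    have hiff := i.admissible_pair_iff (v := v) (D := D) A B
    simp only [matR, Matrix.map_apply, mat]
    by_cases hA : ∀ j < i.h, i.Common v D (dig i.n A j)
    · by_cases hB : ∀ j < i.h, i.Common v D (dig i.n B j)
      · rw [if_pos hA, if_pos hB]
        by_cases hinc : Incr i.n (2 * i.h) (A + i.N * B)
        · have hadm := hiff.2 ⟨hinc, hA, hB⟩
          have hreg := i.regular_of_admissible hadm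
          rw [if_pos hadm, if_pos hreg, if_pos hreg]
          push_cast
          have hq' : (i.query (A + i.N * B + i.n ^ (2 * i.h) * v) : ℝ) =
            if i.H.Has (linkSet i.k v (digSet i.n (2 * i.h) (A + i.N * B))) then 1 else 0 := hq
          rw [hq', hθ]
          ring
        · have hreg : ¬ Regular i.n i.k v (A + i.N * B) := fun h => hinc h.1
          rw [if_neg hreg, if_neg hreg, if_neg fun h => hinc (hiff.1 h).1]
          simp
      · rw [if_pos hA, if_neg hB, if_neg fun h => hB (hiff.1 h).2.2]
        simp
    · rw [if_neg hA, if_neg fun h => hA (hiff.1 h).2.1]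
      simp
  have hsum : ∑ A ∈ X, ∑ B ∈ Y, i.matR v D A B =
      2 ^ i.N * rectSum i.H i.p v (i.inNbhd v D X) (i.inNbhd v D Y) +
      ∑ A ∈ i.inNbhd v D X, ∑ B ∈ i.inNbhd v D Y,
        if Regular i.n i.k v (A + i.N * B) then θ else 0 := by
    rw [i.rectSum_eq, Finset.mul_sum, ← Finset.sum_add_distrib, inNbhd, Finset.sum_filter]
    refine Finset.sum_congr rfl fun A _ => ?_
    simp only [hentry]
    split_ifs with hA
    · rw [Finset.mul_sum, ← Finset.sum_add_distrib, inNbhd, Finset.sum_filter]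
    · simp
  rw [hsum]
  refine (abs_add_le _ _).trans (add_le_add ?_ ?_)
  · rw [abs_mul, abs_of_pos (by positivity : (0 : ℝ) < 2 ^ i.N)]
  · calc _ ≤ ∑ _A ∈ i.inNbhd v D X, ∑ _B ∈ i.inNbhd v D Y, (1 : ℝ) := by
          refine (Finset.abs_sum_le_sum_abs _ _).trans (Finset.sum_le_sum fun A _ => ?_)
          refine (Finset.abs_sum_le_sum_abs _ _).trans (Finset.sum_le_sum fun B _ => ?_)
          split_ifs
          · rw [abs_of_nonneg hθ0]; exact hθ1
          · simp
      _ = _ := by simp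

/-- If the rectangle sums of the centred adjacency matrix are small, then only small `q` pass the
test. -/
theorem Passes.le {v D q : ℕ} {K m : ℝ} (hv : v < i.n) (hK : 0 ≤ K)
    (hrect : ∀ X Y : Finset (Fin i.N), X.Nonempty → Y.Nonempty →
      |rectSum i.H i.p v X Y| ≤ √(K / 2 * (X.card * Y.card * (X.card + Y.card))))
    (hm : ((i.nbhd v D).card : ℝ) ≤ m) (hq : i.Passes v D q) :
    (1 - i.p) * (q : ℝ) ^ i.h ≤ 2 * (√(K * m ^ i.h) + 1) * (8 * i.N.size + 6) := by
  have hm0 : 0 ≤ m := (Nat.cast_nonneg _).trans hm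
  have hp2 : (0 : ℝ) < 2 ^ i.N := by positivity
  set κ : ℝ := 2 ^ i.N * (√(K * m ^ i.h) + 1) with hκ
  have hκ0 : 0 ≤ κ := by positivity
  have hM : ∀ X Y : Finset (Fin i.N), |∑ A ∈ X, ∑ B ∈ Y, i.matR v D A B| ≤
      κ * √((X.card : ℝ) * Y.card) := by
    intro X Y
    refine (i.abs_sum_matR_le D hv X Y).trans ?_
    set X' := i.inNbhd v D X
    set Y' := i.inNbhd v D Y
    have hXX : X'.card ≤ X.card := i.card_inNbhd_le_card v D X
    have hYY : Y'.card ≤ Y.card := i.card_inNbhd_le_card v D Y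
    have hle : √((X'.card : ℝ) * Y'.card) ≤ √((X.card : ℝ) * Y.card) := by gcongr
    rcases X'.eq_empty_or_nonempty with hX | hX
    · have h0 : rectSum i.H i.p v X' Y' = 0 := by
        rw [hX]; exact rectSum_empty_left _ _ _ _
      rw [h0, hX]
      simp only [abs_zero, Finset.card_empty, Nat.cast_zero, mul_zero, zero_mul, add_zero]
      positivity
    rcases Y'.eq_empty_or_nonempty with hY | hY
    · have h0 : rectSum i.H i.p v X' Y' = 0 := by
        rw [hY]; exact rectSum_empty_right _ _ _ _
      rw [h0, hY]
      simp only [abs_zero, Finset.card_empty, Nat.cast_zero, mul_zero, add_zero]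
      positivity
    have hcard : ∀ Z, ((i.inNbhd v D Z).card : ℝ) ≤ m ^ i.h := fun Z => by
      calc ((i.inNbhd v D Z).card : ℝ) ≤ ((i.nbhd v D).card : ℝ) ^ i.h := by
            exact_mod_cast i.card_inNbhd_le (by omega) v D Z
        _ ≤ _ := by gcongr
    have h1 : |rectSum i.H i.p v X' Y'| ≤ √(K * m ^ i.h) * √((X'.card : ℝ) * Y'.card) := by
      refine (hrect X' Y' hX hY).trans ?_
      rw [← Real.sqrt_mul (by positivity)]
      refine Real.sqrt_le_sqrt ?_
      have h2 : (X'.card : ℝ) + Y'.card ≤ 2 * m ^ i.h := by linarith [hcard X, hcard Y]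
      calc K / 2 * ((X'.card : ℝ) * Y'.card * (X'.card + Y'.card))
          ≤ K / 2 * ((X'.card : ℝ) * Y'.card * (2 * m ^ i.h)) := by gcongr
        _ = _ := by ring
    -- the error of the approximation to `p` is at most of the order of the rectangle sums, because
    -- the precision `2 ^ N` exceeds the side lengths of the rectangles
    have h2 : (X'.card : ℝ) * Y'.card ≤ 2 ^ i.N * √((X'.card : ℝ) * Y'.card) := by
      have h3 : √((X'.card : ℝ) * Y'.card) ≤ 2 ^ i.N := by
        have hN : ∀ Z : Finset (Fin i.N), (Z.card : ℝ) ≤ 2 ^ i.N := fun Z => by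
          have h4 : Z.card ≤ i.N := by simpa using Z.card_le_univ
          exact_mod_cast h4.trans Nat.lt_two_pow_self.le
        refine Real.sqrt_le_iff.2 ⟨by positivity, ?_⟩
        rw [sq]
        exact mul_le_mul (hN _) (hN _) (by positivity) (by positivity)
      calc (X'.card : ℝ) * Y'.card = √((X'.card : ℝ) * Y'.card) * √((X'.card : ℝ) * Y'.card) :=
            (Real.mul_self_sqrt (by positivity)).symm
        _ ≤ _ := by gcongr
    calc _ ≤ 2 ^ i.N * (√(K * m ^ i.h) * √((X'.card : ℝ) * Y'.card)) +
          2 ^ i.N * √((X'.card : ℝ) * Y'.card) := by gcongr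
      _ = κ * √((X'.card : ℝ) * Y'.card) := by rw [hκ]; ring
      _ ≤ _ := by gcongr
  have hNsize : i.N ≤ 2 ^ i.N.size := (Nat.lt_size_self _).le
  have hF := frobMoment_le_of_rectangles (i.matR v D) hκ0 hM (L := 2 * i.N.size)
    (by rw [Fintype.card_fin, mul_comm, pow_mul]; exact Nat.pow_le_pow_left hNsize 2) i.N.size
  rw [← moment_eq, Fintype.card_fin] at hF
  set Λ : ℝ := 8 * i.N.size + 6 with hΛ
  have hΛe : (4 * ((2 * i.N.size : ℕ) + 1) + 2 : ℝ) = Λ := by push_cast; rw [hΛ]; ring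
  rw [hΛe] at hF
  have hΛ0 : 0 ≤ Λ := by positivity
  -- the exponent is larger than `log N`, so the factor `N` in `hF` becomes a factor `2` in the root
  have hN : (i.N : ℝ) ≤ 2 ^ 2 ^ (i.N.size + 2) := by
    have h1 : i.N.size ≤ 2 ^ (i.N.size + 2) :=
      Nat.lt_two_pow_self.le.trans (Nat.pow_le_pow_right (by omega) (by omega))
    exact_mod_cast hNsize.trans (Nat.pow_le_pow_right (by omega) h1)
  have hpow : (((2 ^ i.N - i.pNum : ℕ) : ℝ) * (q : ℝ) ^ i.h) ^ 2 ^ (i.N.size + 2) ≤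
      (2 * (κ * Λ)) ^ 2 ^ (i.N.size + 2) := by
    calc _ ≤ (i.moment v D : ℝ) := by unfold Passes at hq; exact_mod_cast hq
      _ ≤ i.N * (κ * Λ) ^ 2 ^ (i.N.size + 2) := hF
      _ ≤ 2 ^ 2 ^ (i.N.size + 2) * (κ * Λ) ^ 2 ^ (i.N.size + 2) := by gcongr
      _ = _ := (mul_pow _ _ _).symm
  have hle := le_of_pow_le_pow_left₀ (by positivity) (by positivity) hpow
  have hδ : 2 ^ i.N * (1 - (i.p : ℝ)) ≤ ((2 ^ i.N - i.pNum : ℕ) : ℝ) := by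
    rw [Nat.cast_sub i.pNum_le]
    push_cast
    linarith [i.pNum_approx.1]
  have hfin : 2 ^ i.N * ((1 - (i.p : ℝ)) * (q : ℝ) ^ i.h) ≤
      2 ^ i.N * (2 * (√(K * m ^ i.h) + 1) * Λ) := by
    calc _ = 2 ^ i.N * (1 - (i.p : ℝ)) * (q : ℝ) ^ i.h := by ring
      _ ≤ ((2 ^ i.N - i.pNum : ℕ) : ℝ) * (q : ℝ) ^ i.h := by gcongr
      _ ≤ _ := hle
      _ = _ := by rw [hκ]; ring
  exact le_of_mul_le_mul_left hfin hp2

theorem maxBlock_le {B : ℝ} (hB : 0 ≤ B) (h : ∀ v < i.n, ∀ D < i.n ^ i.d, i.GoodTuple v D → ∀ q,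
    i.Passes v D q → (q : ℝ) ≤ B) : (i.maxBlock : ℝ) ≤ B := by
  classical
  refine (Nat.le_floor_iff hB).1 ?_
  unfold maxBlock
  refine Finset.sup_le fun v hv => Finset.sup_le fun D hD => ?_
  split_ifs with hg
  · refine Finset.sup_le fun q _ => ?_
    split_ifs with hp
    · exact Nat.le_floor (h v (Finset.mem_range.1 hv) D (Finset.mem_range.1 hD) hg q hp)
    · exact Nat.zero_le _
  · exact Nat.zero_le _

end CliqueInput

/-! ### Estimates -/

/-- The factor that is lost in the passage from sums over rectangles to the operator norm. -/
theorem size_pow_le {n h : ℕ} (hn : 2 ≤ n) (hh : 1 ≤ h) :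
    8 * ((n ^ h).size : ℝ) + 6 ≤ 40 * (h * Real.log n) := by
  have hpos : 0 < n ^ h := by positivity
  have h1 : ((2 : ℝ) ^ (n ^ h).size) ≤ 2 * (n : ℝ) ^ h := by
    exact_mod_cast Nat.two_pow_size_le_of_pos hpos
  have h2 := Real.log_le_log (by positivity) h1
  have hn' : (2 : ℝ) ≤ n := by exact_mod_cast hn
  rw [Real.log_pow, Real.log_mul (by norm_num) (by positivity), Real.log_pow] at h2
  have h3 := Real.log_two_gt_d9
  have h4 : Real.log 2 ≤ Real.log n := Real.log_le_log (by norm_num) hn'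
  have h5 : (1 : ℝ) ≤ h := by exact_mod_cast hh
  have h6 : Real.log 2 ≤ h * Real.log n := by nlinarith
  have h7 : (0 : ℝ) ≤ (n ^ h).size := Nat.cast_nonneg _
  nlinarith

/-- Solving the estimate of `CliqueInput.Passes.le` for `q`: here `x` stands for
`n p ^ (d choose (2h - 1))`. -/
theorem le_of_mul_pow_le {n h d c q : ℕ} {p x : ℝ} (hn : 2 ≤ n) (hh : 1 ≤ h) (hd : 1 ≤ d)
    (hp : p < 1)
    (hq : (1 - p) * (q : ℝ) ^ h ≤
      2 * (√((h + c + 3) * Real.log n * max (8 * x) ((d + c + 2) * Real.log n) ^ h) + 1) *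
        (8 * ((n ^ h).size : ℝ) + 6)) :
    (q : ℝ) ≤ 640 * (c + 4) * √(8 * (c + 3)) *
      ((d * Real.log n ^ 2 / (1 - p)) ^ ((1 : ℝ) / h) * √(max x (d * Real.log n))) := by
  have hn' : (2 : ℝ) ≤ n := by exact_mod_cast hn
  have hh' : (1 : ℝ) ≤ h := by exact_mod_cast hh
  have hd' : (1 : ℝ) ≤ d := by exact_mod_cast hd
  have hc' : (0 : ℝ) ≤ c := Nat.cast_nonneg c
  set ℓ := Real.log n with hℓ
  have hℓ2 : 0.69 ≤ ℓ := by
    have := Real.log_two_gt_d9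
    have h4 : Real.log 2 ≤ ℓ := Real.log_le_log (by norm_num) hn'
    linarith
  set M := max x (d * ℓ) with hM
  have hdℓ : ℓ ≤ d * ℓ := by nlinarith
  have hM0 : 0.69 ≤ M := (hℓ2.trans hdℓ).trans (le_max_right _ _)
  set G := 8 * (c + 3) * M with hG
  have hG1 : 1 ≤ G := by rw [hG]; nlinarith
  have hmG : max (8 * x) ((d + c + 2) * ℓ) ≤ G := by
    refine max_le ?_ ?_
    · have : x ≤ M := le_max_left _ _
      rw [hG]; nlinarith
    · have h1 : d * ℓ ≤ M := le_max_right _ _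
      have h2 : (d + c + 2 : ℝ) ≤ (c + 3) * d := by nlinarith
      calc (d + c + 2) * ℓ ≤ (c + 3) * d * ℓ := by gcongr
        _ = (c + 3) * (d * ℓ) := by ring
        _ ≤ (c + 3) * M := by gcongr
        _ ≤ G := by rw [hG]; nlinarith
  have hm0 : 0 ≤ max (8 * x) ((d + c + 2) * ℓ) := le_max_of_le_right (by positivity)
  set a := (h + c + 3) * ℓ with ha
  have ha1 : 1 ≤ a := by rw [ha]; nlinarith
  have hsqrt : √(a * max (8 * x) ((d + c + 2) * ℓ) ^ h) ≤ a * √G ^ h := by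
    calc _ ≤ √(a * G ^ h) := by gcongr
      _ = √a * √(G ^ h) := Real.sqrt_mul (by positivity) _
      _ ≤ a * √G ^ h := by
        have h1 : √a ≤ a := Real.sqrt_le_iff.2 ⟨by positivity, by nlinarith⟩
        have h2 : √(G ^ h) = √G ^ h := by
          rw [Real.sqrt_eq_iff_mul_self_eq (by positivity) (by positivity), ← mul_pow,
            Real.mul_self_sqrt (by positivity)]
        rw [h2]; gcongr
  have hsG : 1 ≤ √G ^ h := one_le_pow₀ (Real.one_le_sqrt.2 hG1)
  have hs1 : 1 ≤ a * √G ^ h := one_le_mul_of_one_le_of_one_le ha1 hsG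
  have hah : a ≤ (c + 4) * h * ℓ := by
    rw [ha]; gcongr; nlinarith
  -- hence the factors `h` contribute only a constant to the `h`-th root
  have hh4 : (h : ℝ) * h ≤ 4 ^ h := by
    have : (h : ℝ) ≤ 2 ^ h := by exact_mod_cast Nat.lt_two_pow_self.le
    calc (h : ℝ) * h ≤ 2 ^ h * 2 ^ h := by gcongr
      _ = 4 ^ h := by rw [← mul_pow]; norm_num
  have hbig : (1 - p) * (q : ℝ) ^ h ≤ (640 * (c + 4) * √G) ^ h * ℓ ^ 2 := by
    calc (1 - p) * (q : ℝ) ^ h ≤ 2 * (a * √G ^ h + a * √G ^ h) * (40 * (h * ℓ)) := by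
          refine hq.trans ?_
          have := size_pow_le hn hh
          gcongr
      _ = 160 * a * (h * ℓ) * √G ^ h := by ring
      _ ≤ 160 * ((c + 4) * h * ℓ) * (h * ℓ) * √G ^ h := by gcongr
      _ = 160 * (c + 4) * (h * h) * √G ^ h * ℓ ^ 2 := by ring
      _ ≤ (160 * (c + 4)) ^ h * 4 ^ h * √G ^ h * ℓ ^ 2 := by
          gcongr
          exact le_self_pow₀ (by nlinarith) (by omega)
      _ = _ := by
          rw [← mul_pow, ← mul_pow]
          congr 2
          ring
  have h1p : 0 < 1 - p := by linarith
  set Z := d * ℓ ^ 2 / (1 - p) with hZ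
  have hZ0 : 0 ≤ Z := by positivity
  have hqh : (q : ℝ) ^ h ≤ (640 * (c + 4) * √G * Z ^ ((1 : ℝ) / h)) ^ h := by
    rw [mul_pow _ (Z ^ ((1 : ℝ) / h)), ← Real.rpow_natCast (Z ^ ((1 : ℝ) / h)), ← Real.rpow_mul hZ0,
      one_div_mul_cancel (by positivity), Real.rpow_one]
    have h2 : (q : ℝ) ^ h ≤ (640 * (c + 4) * √G) ^ h * ℓ ^ 2 / (1 - p) := by
      rw [le_div_iff₀ h1p, mul_comm]; exact hbig
    refine h2.trans ?_
    rw [mul_div_assoc, hZ]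
    gcongr
    nlinarith [sq_nonneg ℓ]
  have hfin := le_of_pow_le_pow_left₀ (by omega) (by positivity) hqh
  refine hfin.trans (le_of_eq ?_)
  rw [hG, Real.sqrt_mul (by positivity)]
  ring

/-- A lower bound for the main term, by which it absorbs the additive constants: `log 2 ≥ 0.69`, so
the base is at least `0.4`, and the exponent is at most `1`. -/
theorem one_quarter_le {n h d : ℕ} {p x : ℝ} (hn : 2 ≤ n) (hh : 1 ≤ h) (hd : 1 ≤ d)
    (hp0 : 0 ≤ p) (hp : p < 1) :
    1 / 4 ≤ (d * Real.log n ^ 2 / (1 - p)) ^ ((1 : ℝ) / h) * √(max x (d * Real.log n)) := by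
  have hn' : (2 : ℝ) ≤ n := by exact_mod_cast hn
  have hh' : (1 : ℝ) ≤ h := by exact_mod_cast hh
  have hd' : (1 : ℝ) ≤ d := by exact_mod_cast hd
  have hℓ2 : 0.69 ≤ Real.log n := by
    have := Real.log_two_gt_d9
    have h4 : Real.log 2 ≤ Real.log n := Real.log_le_log (by norm_num) hn'
    linarith
  have h1p : 0 < 1 - p := by linarith
  have h1 : 0.4 ≤ d * Real.log n ^ 2 / (1 - p) := by
    rw [le_div_iff₀ h1p]; nlinarith
  have h2 : (0.4 : ℝ) ≤ (d * Real.log n ^ 2 / (1 - p)) ^ ((1 : ℝ) / h) := by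
    calc (0.4 : ℝ) = 0.4 ^ (1 : ℝ) := (Real.rpow_one _).symm
      _ ≤ 0.4 ^ ((1 : ℝ) / h) := Real.rpow_le_rpow_of_exponent_ge (by norm_num) (by norm_num)
          (by rw [div_le_one (by positivity)]; exact hh')
      _ ≤ _ := Real.rpow_le_rpow (by norm_num) h1 (by positivity)
  have h3 : (0.69 : ℝ) ≤ √(max x (d * Real.log n)) := by
    refine Real.le_sqrt_of_sq_le ?_
    exact le_max_of_le_right (by nlinarith)
  calc (1 / 4 : ℝ) ≤ 0.4 * 0.69 := by norm_num
    _ ≤ _ := by gcongr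

theorem evenPart_eq (k : ℕ) : evenPart k = 2 * (k / 2) := by
  unfold evenPart
  split_ifs with h
  · obtain ⟨r, hr⟩ := h; omega
  · obtain ⟨r, hr⟩ := Nat.not_even_iff_odd.1 h; omega

/-- The constant in the high probability bound. -/
noncomputable def boundConst (c : ℕ) : ℝ := 8 + 640 * (c + 4) * √(8 * (c + 3))

theorem boundConst_pos (c : ℕ) : 0 < boundConst c := by unfold boundConst; positivity

/-- The high probability bound: it holds outside of two events of probability at most
`n ^ (-c) / 2`. -/
theorem output_le_whp (c n k d : ℕ) (p : I) (hk : 2 ≤ k) (hd : 1 ≤ d) (hp : (p : ℝ) < 1) :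
    1 - 1 / (n : ℝ) ^ c ≤ (randomHypergraph k n p).real {H : UniformHypergraph n k |
      (CliqueInput.output ⟨n, k, H, p, d⟩ : ℝ) ≤
        d + boundConst c * k * (d * Real.log n ^ 2 / (1 - p)) ^ ((2 : ℝ) / (evenPart k : ℝ)) *
          √(max (n * (p : ℝ) ^ d.choose (evenPart k - 1)) (d * Real.log n))} := by
  have hp0 : 0 ≤ (p : ℝ) := p.2.1
  have h1p : 0 < 1 - (p : ℝ) := by linarith
  have hC := boundConst_pos c
  rw [evenPart_eq k]
  set h := k / 2 with hh
  have hh1 : 1 ≤ h := by omega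
  have hexp : (2 : ℝ) / ((2 * h : ℕ) : ℝ) = 1 / h := by
    push_cast
    rw [div_mul_eq_div_div]; norm_num
  rw [hexp]
  set x := n * (p : ℝ) ^ d.choose (2 * h - 1) with hx
  set T := (d * Real.log n ^ 2 / (1 - p)) ^ ((1 : ℝ) / h) * √(max x (d * Real.log n)) with hT
  have hT0 : 0 ≤ T := by positivity
  rcases Nat.lt_or_ge n 2 with hn | hn
  · -- for `n ≤ 1` the output is at most `1 ≤ d`
    have huniv : {H : UniformHypergraph n k | (CliqueInput.output ⟨n, k, H, p, d⟩ : ℝ) ≤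
        d + boundConst c * k * (d * Real.log n ^ 2 / (1 - p)) ^ ((1 : ℝ) / h) *
          √(max x (d * Real.log n))} = Set.univ := by
      refine Set.eq_univ_of_forall fun H => ?_
      have h1 : CliqueInput.output ⟨n, k, H, p, d⟩ ≤ d :=
        (CliqueInput.output_le _).trans (by simp only; omega)
      have h2 : (CliqueInput.output ⟨n, k, H, p, d⟩ : ℝ) ≤ d := by exact_mod_cast h1
      refine h2.trans (le_add_of_nonneg_right ?_)
      positivity
    rw [huniv, probReal_univ]
    have : (0 : ℝ) ≤ 1 / (n : ℝ) ^ c := by positivity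
    linarith
  set E1 := {H : UniformHypergraph n k | ∃ v < n, ∃ X Y : Finset (Fin (n ^ h)),
      X.Nonempty ∧ Y.Nonempty ∧ √((h + c + 3) * Real.log n / 2 *
        (X.card * Y.card * (X.card + Y.card))) ≤ |rectSum H p v X Y|} with hE1
  set E2 := {H : UniformHypergraph n k | ∃ v < n, ∃ D < n ^ d,
      CliqueInput.GoodTuple ⟨n, k, H, p, d⟩ v D ∧ max (8 * x) ((d + c + 2) * Real.log n) <
        (CliqueInput.nbhd ⟨n, k, H, p, d⟩ v D).card} with hE2
  have h1 : (randomHypergraph k n p).real E1 ≤ 1 / 2 * (1 / (n : ℝ) ^ c) :=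
    real_exists_rectSum_ge_le p hn c
  have h2 : (randomHypergraph k n p).real E2 ≤ 1 / 2 * (1 / (n : ℝ) ^ c) :=
    real_exists_card_nbhd_gt_le p hk hn c
  set S := {H : UniformHypergraph n k | (CliqueInput.output ⟨n, k, H, p, d⟩ : ℝ) ≤
        d + boundConst c * k * (d * Real.log n ^ 2 / (1 - p)) ^ ((1 : ℝ) / h) *
          √(max x (d * Real.log n))} with hS
  have hcover : Set.univ ⊆ S ∪ (E1 ∪ E2) := by
    intro H _
    by_contra hH
    simp only [Set.mem_union, not_or] at hH
    obtain ⟨hHS, hH1, hH2⟩ := hH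
    refine hHS ?_
    set i : CliqueInput := ⟨n, k, H, p, d⟩ with hi
    have hblock : (i.maxBlock : ℝ) ≤ 640 * (c + 4) * √(8 * (c + 3)) * T := by
      refine i.maxBlock_le (by positivity) fun v hv D hD hg q hq => ?_
      have hlog : 0 ≤ Real.log n := Real.log_natCast_nonneg n
      refine le_of_mul_pow_le hn hh1 hd hp (CliqueInput.Passes.le i hv (K := (h + c + 3) * Real.log n)
        (by positivity) (fun X Y hX hY => ?_) ?_ hq)
      · by_contra hlt
        exact hH1 ⟨v, hv, X, Y, hX, hY, (not_le.1 hlt).le⟩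
      · by_contra hlt
        exact hH2 ⟨v, hv, D, hD, hg, not_le.1 hlt⟩
    have hout : (i.output : ℝ) ≤ d + 1 + 2 * h * (1 + i.maxBlock) := by
      have : i.output ≤ d + 1 + 2 * h * (1 + i.maxBlock) := min_le_right _ _
      exact_mod_cast this
    have hquarter : 1 / 4 ≤ T := one_quarter_le hn hh1 hd hp0 hp
    have h2h : 2 * (h : ℝ) ≤ k := by
      have : 2 * h ≤ k := by omega
      exact_mod_cast this
    have hk' : (2 : ℝ) ≤ k := by exact_mod_cast hk
    calc (i.output : ℝ) ≤ d + 1 + 2 * h * (1 + i.maxBlock) := hout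
      _ ≤ d + 1 + k * (1 + 640 * (c + 4) * √(8 * (c + 3)) * T) := by gcongr
      _ = d + ((1 + k) + k * (640 * (c + 4) * √(8 * (c + 3)) * T)) := by ring
      _ ≤ d + (8 * k * T + k * (640 * (c + 4) * √(8 * (c + 3)) * T)) := by
          gcongr
          nlinarith
      _ = _ := by rw [hT, boundConst]; ring
  have htot : (1 : ℝ) ≤ (randomHypergraph k n p).real S + (1 / 2 * (1 / (n : ℝ) ^ c) +
      1 / 2 * (1 / (n : ℝ) ^ c)) := by
    calc (1 : ℝ) = (randomHypergraph k n p).real Set.univ := probReal_univ.symm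
      _ ≤ (randomHypergraph k n p).real (S ∪ (E1 ∪ E2)) := measureReal_mono hcover
      _ ≤ (randomHypergraph k n p).real S + ((randomHypergraph k n p).real E1 +
          (randomHypergraph k n p).real E2) := (measureReal_union_le _ _).trans
            (add_le_add le_rfl (measureReal_union_le _ _))
      _ ≤ _ := by gcongr
  linarith

/-- For constant `k` and `d`, and `p` bounded away from `1`, the bound is `O(√n log² n)`. -/
theorem bound_le_sqrt {n k d : ℕ} {p q C : ℝ} (hn : 2 ≤ n) (hk : 2 ≤ k) (hd : 1 ≤ d)
    (hp0 : 0 ≤ p) (hpq : p ≤ q) (hq : q < 1) (hC : 0 ≤ C) :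
    d + C * k * (d * Real.log n ^ 2 / (1 - p)) ^ ((2 : ℝ) / (evenPart k : ℝ)) *
        √(max (n * p ^ d.choose (evenPart k - 1)) (d * Real.log n)) ≤
      (4 * d + C * k * (4 * d / (1 - q)) * d) * √n * Real.log n ^ 2 := by
  rw [evenPart_eq k]
  set h := k / 2 with hh
  have hh1 : 1 ≤ h := by omega
  have hh1' : (1 : ℝ) ≤ h := by exact_mod_cast hh1
  have hexp : (2 : ℝ) / ((2 * h : ℕ) : ℝ) = 1 / h := by
    push_cast
    rw [div_mul_eq_div_div]; norm_num
  rw [hexp]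
  have hn' : (2 : ℝ) ≤ n := by exact_mod_cast hn
  have hd' : (1 : ℝ) ≤ d := by exact_mod_cast hd
  set ℓ := Real.log n with hℓ
  have hℓ2 : 0.69 ≤ ℓ := by
    have := Real.log_two_gt_d9
    have h4 : Real.log 2 ≤ ℓ := Real.log_le_log (by norm_num) hn'
    linarith
  have hℓ4 : 1 ≤ 4 * ℓ ^ 2 := by nlinarith
  have hsn : 1 ≤ √(n : ℝ) := Real.one_le_sqrt.2 (by linarith)
  have h1q : 0 < 1 - q := by linarith
  have h1p : 0 < 1 - p := by linarith
  -- the base is at least `1` after multiplication by `4`, so the exponent `1 / h ≤ 1` can be dropped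
  have hZ : (d * ℓ ^ 2 / (1 - p)) ^ ((1 : ℝ) / h) ≤ 4 * d / (1 - q) * ℓ ^ 2 := by
    have hle : d * ℓ ^ 2 / (1 - p) ≤ 4 * d / (1 - q) * ℓ ^ 2 := by
      calc d * ℓ ^ 2 / (1 - p) ≤ (4 * (d * ℓ ^ 2)) / (1 - q) := by
            have h2 : 0 ≤ d * ℓ ^ 2 := by positivity
            exact div_le_div₀ (by positivity) (by linarith) h1q (by linarith)
        _ = _ := by ring
    have h1 : 1 ≤ 4 * d / (1 - q) * ℓ ^ 2 := by
      rw [div_mul_eq_mul_div, le_div_iff₀ h1q]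
      nlinarith
    calc (d * ℓ ^ 2 / (1 - p)) ^ ((1 : ℝ) / h) ≤ (4 * d / (1 - q) * ℓ ^ 2) ^ ((1 : ℝ) / h) :=
          Real.rpow_le_rpow (by positivity) hle (by positivity)
      _ ≤ (4 * d / (1 - q) * ℓ ^ 2) ^ (1 : ℝ) := Real.rpow_le_rpow_of_exponent_le h1
          (by rw [div_le_one (by positivity)]; exact hh1')
      _ = _ := Real.rpow_one _
  have hS : √(max (n * p ^ d.choose (2 * h - 1)) (d * ℓ)) ≤ d * √n := by
    have hmax : max (n * p ^ d.choose (2 * h - 1)) (d * ℓ) ≤ d ^ 2 * n := by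
      have hd2 : (d : ℝ) ≤ d ^ 2 := by nlinarith
      refine max_le ?_ ?_
      · have : p ^ d.choose (2 * h - 1) ≤ 1 := pow_le_one₀ hp0 (by linarith)
        nlinarith
      · have : ℓ ≤ n := (Real.log_le_sub_one_of_pos (by linarith)).trans (by linarith)
        calc d * ℓ ≤ d * n := by gcongr
          _ ≤ _ := by gcongr
    calc _ ≤ √(d ^ 2 * (n : ℝ)) := Real.sqrt_le_sqrt hmax
      _ = d * √n := by rw [Real.sqrt_mul (by positivity), Real.sqrt_sq (by positivity)]
  have hfirst : (d : ℝ) ≤ 4 * d * √n * ℓ ^ 2 := by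
    calc (d : ℝ) ≤ d * (1 * 1) := by ring_nf; rfl
      _ ≤ d * ((4 * ℓ ^ 2) * √n) := by gcongr
      _ = _ := by ring
  calc _ ≤ 4 * d * √n * ℓ ^ 2 + C * k * (4 * d / (1 - q) * ℓ ^ 2) * (d * √n) := by gcongr
    _ = _ := by ring

theorem theorem2 :
    ∃ (P : Prog) (B : ℕ) (ωalg : CliqueInput → ℕ),
      -- running time `n ^ O(d + k)`, range `[0, n]`, and completeness, on all inputs
      (∀ i : CliqueInput, 2 ≤ i.k → 1 ≤ i.d →
        (∃ t : ℕ, P.Outputs i (ωalg i) t ∧ t ≤ (max i.n 2) ^ (B * (i.d + i.k))) ∧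
        ωalg i ≤ i.n ∧
        i.H.cliqueNumber ≤ ωalg i) ∧
      -- the high probability bound
      (∀ c : ℕ, ∃ C : ℝ, ∀ (n k d : ℕ) (p : I), 2 ≤ k → 1 ≤ d → (p : ℝ) < 1 →
        1 - 1 / (n : ℝ) ^ c ≤
          (randomHypergraph k n p).real
            {H : UniformHypergraph n k |
              (ωalg ⟨n, k, H, p, d⟩ : ℝ) ≤
                d + C * k * (d * Real.log n ^ 2 / (1 - p)) ^ ((2 : ℝ) / (evenPart k : ℝ)) *
                  Real.sqrt (max (n * (p : ℝ) ^ d.choose (evenPart k - 1)) (d * Real.log n))}) ∧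
      -- for constant `k` and `d`, and `p` bounded away from `1`, the bound is `√n * polylog n`
      (∀ (k d : ℕ) (q : ℝ) (c : ℕ), 2 ≤ k → 1 ≤ d → q < 1 →
        ∃ (C : ℝ) (a : ℕ), ∀ (n : ℕ) (p : I), 2 ≤ n → (p : ℝ) ≤ q →
          1 - 1 / (n : ℝ) ^ c ≤
            (randomHypergraph k n p).real
              {H : UniformHypergraph n k |
                (ωalg ⟨n, k, H, p, d⟩ : ℝ) ≤ C * Real.sqrt n * Real.log n ^ a}) := by
  obtain ⟨P, B, hP⟩ := exists_prog_output
  refine ⟨P, B, CliqueInput.output, fun i hk _ =>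
    ⟨hP i hk, i.output_le, i.cliqueNumber_le_output hk⟩,
    fun c => ⟨boundConst c, fun n k d p hk hd hp => output_le_whp c n k d p hk hd hp⟩,
    fun k d q c hk hd hq => ⟨4 * d + boundConst c * k * (4 * d / (1 - q)) * d, 2,
      fun n p hn hpq => ?_⟩⟩
  refine (output_le_whp c n k d p hk hd (hpq.trans_lt hq)).trans (measureReal_mono ?_)
  intro H hH
  exact le_trans hH (bound_le_sqrt hn hk hd p.2.1 hpq hq (boundConst_pos c).le)
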